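/- **Setting.** Let $X$ be a spectrally negative Lévy process with Laplace exponent $$\psi(\theta)=\gamma\theta+\tfrac12\sigma^2\theta^2+\int_0^\infty\bigl(e^{-\theta z}-1+\theta z\mathbf 1_{(0,1]}(z)\bigr)\,\nu(dz),\qquad \theta\ge 0,$$ where $\gamma\in\mathbb R$, $\sigma\ge0$ and $\nu$ is a measure on $(0,\infty)$ with $\int_0^\infty(1\wedge z^2)\,\nu(dz)<\infty$. Assume that $X$ is not the negative of a subordinator, i.e. if $X$ has paths of bounded variation ($\sigma=0$ and $\int_{(0,1]}z\,\nu(dz)<\infty$), then its drift $\gamma+\int_{(0,1]}z\,\nu(dz)$ is positive. Assume moreover that $\nu$ is absolutely continuous with respect to Lebesgue measure if $X$ has paths of bounded variation, and that $x\mapsto\nu(x,\infty)$ is log-convex on $(0,\infty)$ (with $\log 0=-\infty$, so that $\nu=0$ is allowed). For $p>0$ let $\Phi(p)=\sup\{\lambda\ge0:\psi(\lambda)=p\}$, and let $W_p:\mathbb R\to[0,\infty)$ be the $p$-scale function of $X$: the function that vanishes on $(-\infty,0)$, is continuous on $[0,\infty)$ and strictly increasing on $(0,\infty)$, and satisfies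 $\int_0^\infty e^{-\theta x}W_p(x)\,dx=\frac1{\psi(\theta)-p}$ for all $\theta>\Phi(p)$. Let $q>0$, $\beta>0$, and let $\omega:\mathbb R\to[0,\infty)$ be a bankruptcy rate function: $\omega$ is non-increasing, there are $a\le0$ and $\phi>0$ with $\omega=\phi$ on $(-\infty,a)$, $\omega=0$ on $[0,\infty)$, and there are points $a=a_1<a_2<\dots<a_n\le a_{n+1}=0$ (with $n\ge1$) such that $\omega$ is continuous on each $(a_k,a_{k+1})$, $1\le k\le n$, and $\omega(a_k-)>\omega(a_k+)$ for $2\le k\le n$. Put $\omega_q=q+\omega$, and let $\mathcal H^{\omega_q}:\mathbb R\to\mathbb R$ be the $\omega_q$-scale function, i.e. the continuous solution of $$\mathcal H^{\omega_q}(x)=e^{\Phi(q+\phi)(x-a)}+\int_{[a,x)}W_{q+\phi}(x-y)\bigl(\omega_q(y)-(q+\phi)\bigr)\mathcal H^{\omega_q}(y)\,dy,\qquad x\in\mathbb R,$$ where the integral is $0$ for $x\le a$. Finally, let $$g(c_1,c_2)=\frac{\mathcal H^{\omega_q}(c_2)-\mathcal H^{\omega_q}(c_1)}{c_2-c_1-\beta},\qquad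 \mathrm{dom}(g)=\{(c_1,c_2):c_1\ge0,\ c_2>\beta+c_1\},$$ and let $C^\ast$ be the set of all $(c_1^\ast,c_2^\ast)\in\mathrm{dom}(g)$ with $g(c_1^\ast,c_2^\ast)=\inf_{\mathrm{dom}(g)}g$. **Proposition.** The set $C^\ast$ is non-empty. For every $(c_1^\ast,c_2^\ast)\in C^\ast$, the function $\mathcal H^{\omega_q}$ is differentiable at $c_2^\ast$ and $$\mathcal H^{\omega_q\prime}(c_2^\ast)=\frac{\mathcal H^{\omega_q}(c_2^\ast)-\mathcal H^{\omega_q}(c_1^\ast)}{c_2^\ast-c_1^\ast-\beta}.$$ In addition, either $\mathcal H^{\omega_q}$ is differentiable at $c_1^\ast$ with $\mathcal H^{\omega_q\prime}(c_1^\ast)=\mathcal H^{\omega_q\prime}(c_2^\ast)$, or $c_1^\ast=0$ (or both). -/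

import Mathlib

open MeasureTheory Set

noncomputable section

/-- The Lévy triplet `(γ, σ, ν)` of a spectrally negative Lévy process; `ν` is the Lévy measure of
the sizes of the downward jumps, so it is carried by `(0, ∞)`. -/
structure LevyTriplet where
  γ : ℝ
  σ : ℝ
  ν : Measure ℝ
  σ_nonneg : 0 ≤ σ
  ν_Iic : ν (Iic 0) = 0
  ν_lintegral : ∫⁻ z in Ioi (0 : ℝ), ENNReal.ofReal (min 1 (z ^ 2)) ∂ν < ⊤

namespace LevyTriplet

/-- The Laplace exponent
`ψ(θ) = γ θ + σ² θ² / 2 + ∫_(0,∞) (exp(-θ z) - 1 + θ z 1_{(0,1]}(z)) ν(dz)`. -/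
def psi (T : LevyTriplet) (θ : ℝ) : ℝ :=
  T.γ * θ + T.σ ^ 2 * θ ^ 2 / 2 +
    ∫ z in Ioi (0 : ℝ), (Real.exp (-θ * z) - 1 + (Ioc (0 : ℝ) 1).indicator (fun z => θ * z) z) ∂T.ν

/-- The paths have bounded variation: no Gaussian part and `∫_(0,1] z ν(dz) < ∞`. -/
def BoundedVariation (T : LevyTriplet) : Prop :=
  T.σ = 0 ∧ ∫⁻ z in Ioc (0 : ℝ) 1, ENNReal.ofReal z ∂T.ν < ⊤

/-- In the bounded variation case `X_t = X_0 + drift * t - (sum of the jump sizes up to t)`. -/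
def drift (T : LevyTriplet) : ℝ := T.γ + ∫ z in Ioc (0 : ℝ) 1, z ∂T.ν

/-- The process is not the negative of a subordinator (its paths are not non-increasing). -/
def NotNegSubordinator (T : LevyTriplet) : Prop := T.BoundedVariation → 0 < T.drift

/-- The tail `x ↦ ν(x, ∞)` of the Lévy measure (finite for `x > 0`). -/
def tail (T : LevyTriplet) (x : ℝ) : ℝ := T.ν.real (Ioi x)

/-- The tail is log-convex on `(0, ∞)`, in the multiplicative form, which amounts to the convention
`log 0 = -∞`. -/
def LogConvexTail (T : LevyTriplet) : Prop :=
  ∀ x y s t : ℝ, 0 < x → 0 < y → 0 ≤ s → 0 ≤ t → s + t = 1 →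
    T.tail (s * x + t * y) ≤ T.tail x ^ s * T.tail y ^ t

/-- The right inverse `Φ(p) = sup {l ≥ 0 : ψ(l) = p}` of the Laplace exponent. -/
def Phi (T : LevyTriplet) (p : ℝ) : ℝ := sSup {l : ℝ | 0 ≤ l ∧ T.psi l = p}

/-- The characterisation of the `p`-scale function: it vanishes on `(-∞, 0)`, is continuous on
`[0, ∞)`, strictly increasing on `(0, ∞)`, and has Laplace transform `1 / (ψ(θ) - p)` on
`(Φ(p), ∞)`. -/
structure IsScaleFunction (T : LevyTriplet) (p : ℝ) (W : ℝ → ℝ) : Prop where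
  eq_zero : ∀ x < 0, W x = 0
  continuousOn : ContinuousOn W (Ici 0)
  strictMonoOn : StrictMonoOn W (Ioi 0)
  integrableOn : ∀ θ > T.Phi p, IntegrableOn (fun x => Real.exp (-θ * x) * W x) (Ioi 0)
  laplace : ∀ θ > T.Phi p, ∫ x in Ioi (0 : ℝ), Real.exp (-θ * x) * W x = 1 / (T.psi θ - p)

/-- The `p`-scale function `W_p`: the function with the characterisation above. -/
def scaleFunction (T : LevyTriplet) (p : ℝ) : ℝ → ℝ := Classical.epsilon (T.IsScaleFunction p)

/-- `H` is a continuous solution of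
`H(x) = exp(Φ(φ) (x - a)) + ∫_[a,x) W_φ(x - y) (w(y) - φ) H(y) dy`, `x ∈ ℝ`
(the integral is `0` for `x ≤ a`), where `w` is equal to `φ` on `(-∞, a)`. -/
structure IsOmegaScaleFunction (T : LevyTriplet) (w : ℝ → ℝ) (a φ : ℝ) (H : ℝ → ℝ) : Prop where
  continuous : Continuous H
  eq : ∀ x, H x = Real.exp (T.Phi φ * (x - a)) +
    ∫ y in Ico a x, T.scaleFunction φ (x - y) * (w y - φ) * H y

/-- The `w`-scale function `ℋ^w`: the solution of the functional equation above. -/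
def omegaScaleFunction (T : LevyTriplet) (w : ℝ → ℝ) (a φ : ℝ) : ℝ → ℝ :=
  Classical.epsilon (T.IsOmegaScaleFunction w a φ)

end LevyTriplet

/-- `ω` is a discounting intensity, equal to `φ` on `(-∞, a)` and to `ρ` on `[0, ∞)`. The partition
points are `p 1 = a < p 2 < ⋯ < p n ≤ p (n + 1) = 0`. -/
structure IsDiscountingIntensity (ω : ℝ → ℝ) (a φ ρ : ℝ) : Prop where
  nonneg : ∀ x, 0 ≤ ω x
  antitone : Antitone ω
  a_nonpos : a ≤ 0
  φ_pos : 0 < φ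
  eq_left : ∀ x < a, ω x = φ
  ρ_mem : ρ ∈ Icc 0 (Function.leftLim ω 0)
  eq_right : ∀ x ≥ 0, ω x = ρ
  piecewise : ∃ (n : ℕ) (p : ℕ → ℝ), 1 ≤ n ∧ p 1 = a ∧ p (n + 1) = 0 ∧
    (∀ k, 1 ≤ k → k < n → p k < p (k + 1)) ∧ p n ≤ p (n + 1) ∧
    (∀ k, 1 ≤ k → k ≤ n → ContinuousOn ω (Ioo (p k) (p (k + 1)))) ∧
    (∀ k, 2 ≤ k → k ≤ n → Function.rightLim ω (p k) < Function.leftLim ω (p k))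

/-- A bankruptcy rate function is a discounting intensity that vanishes on `[0, ∞)`. -/
def IsBankruptcyRate (ω : ℝ → ℝ) (a φ : ℝ) : Prop := IsDiscountingIntensity ω a φ 0

/-- The domain `{(c₁, c₂) : c₁ ≥ 0, c₂ > β + c₁}` of `g`. -/
def gDom (β : ℝ) : Set (ℝ × ℝ) := {c | 0 ≤ c.1 ∧ β + c.1 < c.2}

/-- `g(c₁, c₂) = (H(c₂) - H(c₁)) / (c₂ - c₁ - β)`. -/
def gFun (H : ℝ → ℝ) (β : ℝ) (c : ℝ × ℝ) : ℝ := (H c.2 - H c.1) / (c.2 - c.1 - β)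

/-- The set of the points of the domain at which `g` attains its infimum over the domain. -/
def Cstar (H : ℝ → ℝ) (β : ℝ) : Set (ℝ × ℝ) :=
  {c | c ∈ gDom β ∧ IsGLB (gFun H β '' gDom β) (gFun H β c)}

end

/-! The existence of a minimiser and the first-order conditions follow from three facts about H =
ℋ^{ω_q} on [0, ∞): it is positive, it satisfies exp(rδ) H(x) ≤ H(x + δ) for some r > 0, and it is
differentiable on (0, ∞). Exponential growth makes g blow up both as c₂ - c₁ decreases to β and as
c₂ → ∞ (`gFun_lower_bounds`), so g attains its infimum on a compact set. At a minimiser, c₂ is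
interior and c₁ is interior unless it is 0; a vanishing partial derivative says that H' equals g
there.

The facts about H come from W_q. Convolving the defining equation with W_q and using the resolvent
identity φ W_q ∗ W_{q+φ} = W_{q+φ} - W_q gives, for x ≥ 0, H(x) = `baseFun`(x) + ∫_[a,0) W_q(x - y)
ω(y) H(y) dy, where `baseFun` is itself a positive integral of W_q over a tail
(`IsOmegaScaleFunction.eq_baseFun_add`). Since ω ≥ 0, positivity and growth pass from W_q to H.
Since y < 0 in the integral, only W_q away from 0 is involved, and there local Lipschitz continuity
together with differentiability almost everywhere permits differentiation under the integral.

Those properties of W_q are drawn from its log-concavity on [0, ∞), in the form W(x) W(y + δ) ≤ W(x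
+ δ) W(y) for x ≤ y. The process is approximated by compound Poisson processes on a lattice whose
upward jumps are single steps. Their scale functions solve a renewal recursion with kernel (p + rate
of downward jumps of at least j + 1 steps) / (upward rate); this kernel is non-increasing in j,
which forces the solution to be log-concave (`renewalSeq.mul_succ_le`). A Helly-type selection
passes to the limit (`exists_limit_of_laplace`), and uniqueness of Laplace transforms identifies the
limit with W_p. The same limit supplies the existence of W_p, and a contraction argument that of H.
-/

noncomputable section

open Filter Topology

/-! ### Bounds for the Laplace exponent, and its right inverse -/

namespace LevyTriplet

/-- The integrand of the Lévy–Khintchine formula. -/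
def levyKernel (θ z : ℝ) : ℝ :=
  Real.exp (-θ * z) - 1 + (Ioc (0 : ℝ) 1).indicator (fun z => θ * z) z

theorem levyKernel_eq_of_le {θ z : ℝ} (h0 : 0 < z) (h1 : z ≤ 1) :
    levyKernel θ z = Real.exp (-θ * z) - 1 + θ * z := by
  simp [levyKernel, h0, h1]

theorem levyKernel_eq_of_gt {θ z : ℝ} (h1 : 1 < z) :
    levyKernel θ z = Real.exp (-θ * z) - 1 := by
  simp [levyKernel, h1.not_ge]

theorem abs_exp_neg_sub_le {u : ℝ} (hu : 0 ≤ u) : |Real.exp (-u) - 1 + u| ≤ u ^ 2 := by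
  have h1 : 0 ≤ Real.exp (-u) - 1 + u := by linarith [Real.add_one_le_exp (-u)]
  rw [abs_of_nonneg h1]
  by_cases h : u ≤ 1
  · have := Real.abs_exp_sub_one_sub_id_le (x := -u) (by rw [abs_neg, abs_of_nonneg hu]; exact h)
    have := (abs_le.1 this).2
    nlinarith
  · have : Real.exp (-u) ≤ 1 := Real.exp_le_one_iff.2 (by linarith)
    nlinarith

theorem abs_exp_neg_sub_one_le {u : ℝ} (hu : 0 ≤ u) : |Real.exp (-u) - 1| ≤ 1 := by
  have h1 : Real.exp (-u) ≤ 1 := Real.exp_le_one_iff.2 (by linarith)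
  have h2 := Real.exp_pos (-u)
  rw [abs_le]; constructor <;> linarith

theorem abs_levyKernel_le {θ z : ℝ} (hθ : 0 ≤ θ) (hz : 0 < z) :
    |levyKernel θ z| ≤ (1 + θ ^ 2) * min 1 (z ^ 2) := by
  rcases le_or_gt z 1 with h | h
  · have hz2 : z ^ 2 ≤ 1 := by nlinarith
    rw [levyKernel_eq_of_le hz h, min_eq_right hz2, neg_mul]
    have := abs_exp_neg_sub_le (mul_nonneg hθ hz.le)
    nlinarith [sq_nonneg z]
  · have hz2 : 1 ≤ z ^ 2 := by nlinarith
    rw [levyKernel_eq_of_gt h, min_eq_left hz2, neg_mul]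
    have := abs_exp_neg_sub_one_le (mul_nonneg hθ hz.le)
    nlinarith [sq_nonneg θ]

theorem measurable_levyKernel (θ : ℝ) : Measurable (levyKernel θ) := by
  unfold levyKernel
  refine Measurable.add (by fun_prop) ?_
  exact (by fun_prop : Measurable fun z : ℝ => θ * z).indicator measurableSet_Ioc

variable (T : LevyTriplet)

theorem integrableOn_min_one_sq :
    IntegrableOn (fun z : ℝ => min 1 (z ^ 2)) (Ioi 0) T.ν := by
  refine ⟨by fun_prop, ?_⟩
  rw [hasFiniteIntegral_iff_ofReal]
  · exact T.ν_lintegral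
  · exact Eventually.of_forall fun z => le_min zero_le_one (sq_nonneg z)

theorem integrableOn_of_abs_le {f : ℝ → ℝ} {C : ℝ} (hf : Measurable f)
    (h : ∀ z, 0 < z → |f z| ≤ C * min 1 (z ^ 2)) : IntegrableOn f (Ioi 0) T.ν := by
  refine Integrable.mono' (T.integrableOn_min_one_sq.const_mul C) hf.aestronglyMeasurable ?_
  refine (ae_restrict_iff' measurableSet_Ioi).2 (Eventually.of_forall fun z hz => ?_)
  exact h z hz

theorem integrableOn_levyKernel {θ : ℝ} (hθ : 0 ≤ θ) :
    IntegrableOn (levyKernel θ) (Ioi 0) T.ν :=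
  T.integrableOn_of_abs_le (measurable_levyKernel θ) fun _ hz => abs_levyKernel_le hθ hz

theorem psi_eq (θ : ℝ) :
    T.psi θ = T.γ * θ + T.σ ^ 2 * θ ^ 2 / 2 + ∫ z in Ioi (0 : ℝ), levyKernel θ z ∂T.ν := rfl

theorem psi_zero : T.psi 0 = 0 := by
  have : ∀ z, levyKernel 0 z = 0 := fun z => by simp [levyKernel]
  simp [psi_eq, this]

/-- The Laplace transform 1/(ψ - p) of the scale function therefore decays no faster than θ⁻², which
rules out a scale function vanishing near 0. -/
theorem psi_le_mul_sq : ∃ C, ∀ θ, 1 ≤ θ → T.psi θ ≤ C * θ ^ 2 := by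
  set M := ∫ z in Ioi (0 : ℝ), min 1 (z ^ 2) ∂T.ν with hM
  have hM0 : 0 ≤ M := integral_nonneg fun z => le_min zero_le_one (sq_nonneg z)
  refine ⟨|T.γ| + T.σ ^ 2 / 2 + 2 * M, fun θ hθ => ?_⟩
  have h1 : ∫ z in Ioi (0 : ℝ), levyKernel θ z ∂T.ν ≤ (1 + θ ^ 2) * M := by
    rw [hM, ← integral_const_mul]
    refine setIntegral_mono_on (T.integrableOn_levyKernel (by linarith))
      (T.integrableOn_min_one_sq.const_mul _) measurableSet_Ioi fun z hz => ?_
    exact (le_abs_self _).trans (abs_levyKernel_le (by linarith) hz)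
  have h2 : T.γ * θ ≤ |T.γ| * θ ^ 2 := by
    have := le_abs_self T.γ
    have := abs_nonneg T.γ
    have h3 : T.γ * θ ≤ |T.γ| * θ := by gcongr
    have h4 : θ ≤ θ ^ 2 := by nlinarith
    nlinarith
  have h3 : M ≤ M * θ ^ 2 := le_mul_of_one_le_right hM0 (by nlinarith)
  rw [psi_eq]
  nlinarith [sq_nonneg θ]

theorem continuousOn_psi : ContinuousOn T.psi (Ici 0) := by
  have h : ContinuousOn (fun θ => ∫ z in Ioi (0 : ℝ), levyKernel θ z ∂T.ν) (Ici 0) := by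
    intro θ₀ hθ₀
    have hθ₀ : 0 ≤ θ₀ := hθ₀
    refine continuousWithinAt_of_dominated
      (bound := fun z => (1 + (θ₀ + 1) ^ 2) * min 1 (z ^ 2)) ?_ ?_ ?_ ?_
    · exact Eventually.of_forall fun θ => (measurable_levyKernel θ).aestronglyMeasurable
    · have h1 : ∀ᶠ θ in 𝓝[Ici 0] θ₀, θ < θ₀ + 1 :=
        nhdsWithin_le_nhds (eventually_lt_nhds (by linarith))
      filter_upwards [h1, self_mem_nhdsWithin] with θ h1 h2
      have h2 : 0 ≤ θ := h2
      refine (ae_restrict_iff' measurableSet_Ioi).2 (Eventually.of_forall fun z hz => ?_)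
      refine (abs_levyKernel_le h2 hz).trans ?_
      have : 0 ≤ min 1 (z ^ 2) := le_min zero_le_one (sq_nonneg z)
      gcongr
    · exact T.integrableOn_min_one_sq.const_mul _
    · refine Eventually.of_forall fun z => Continuous.continuousWithinAt ?_
      unfold levyKernel
      by_cases hz : z ∈ Ioc (0 : ℝ) 1
      · simp only [indicator_of_mem hz]; fun_prop
      · simp only [indicator_of_notMem hz]; fun_prop
  have h2 : T.psi = fun θ => T.γ * θ + T.σ ^ 2 * θ ^ 2 / 2 +
    ∫ z in Ioi (0 : ℝ), levyKernel θ z ∂T.ν := rfl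
  rw [h2]
  exact ContinuousOn.add (by fun_prop) h

theorem tail_lt_top {ε : ℝ} (hε : 0 < ε) : T.ν (Ioi ε) < ⊤ := by
  have hi := T.integrableOn_min_one_sq.mono_set (Ioi_subset_Ioi hε.le)
  have hm : 0 < min 1 (ε ^ 2) := lt_min one_pos (by positivity)
  have h := hi.measure_ge_lt_top hm
  refine lt_of_le_of_lt ?_ h
  rw [Measure.restrict_apply (measurableSet_le measurable_const (by fun_prop))]
  refine measure_mono fun z hz => ⟨?_, hz⟩
  have hz : ε < z := hz
  have h5 : ε ^ 2 ≤ z ^ 2 := pow_le_pow_left₀ hε.le hz.le 2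
  exact min_le_min le_rfl h5

/-- The drift after the compensation of the jumps of size in `(ε, 1]` is removed. -/
def truncDrift (ε : ℝ) : ℝ := T.γ + ∫ z in Ioc ε 1, z ∂T.ν

theorem integrableOn_id_Ioc {ε : ℝ} (hε : 0 < ε) : IntegrableOn (fun z : ℝ => z) (Ioc ε 1) T.ν := by
  have : T.ν (Ioc ε 1) < ⊤ := (measure_mono Ioc_subset_Ioi_self).trans_lt (T.tail_lt_top hε)
  refine Measure.integrableOn_of_bounded (M := 1) this.ne (by fun_prop) ?_
  refine (ae_restrict_iff' measurableSet_Ioc).2 (Eventually.of_forall fun z hz => ?_)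
  rw [Real.norm_eq_abs, abs_le]
  exact ⟨by linarith [hz.1], hz.2⟩

theorem truncDrift_anti {ε δ : ℝ} (hε : 0 < ε) (h : ε ≤ δ) : T.truncDrift δ ≤ T.truncDrift ε := by
  unfold truncDrift
  have := setIntegral_mono_set (T.integrableOn_id_Ioc hε)
    ((ae_restrict_iff' measurableSet_Ioc).2
      (Eventually.of_forall fun z (hz : z ∈ Ioc ε 1) => (hε.trans hz.1).le))
    (Ioc_subset_Ioc_left h : Ioc δ 1 ⊆ Ioc ε 1).eventuallyLE
  linarith

theorem le_truncDrift {ε : ℝ} (hε : 0 < ε) : T.γ ≤ T.truncDrift ε := by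
  have : 0 ≤ ∫ z in Ioc ε 1, z ∂T.ν :=
    setIntegral_nonneg measurableSet_Ioc fun z hz => (hε.trans hz.1).le
  unfold truncDrift; linarith

/-- By monotone convergence the truncated drift increases, as ε ↓ 0, to the true drift for bounded
variation and to +∞ otherwise (here σ = 0); both limits are positive. -/
theorem exists_truncDrift_pos (hT : T.NotNegSubordinator) (hσ : T.σ = 0) :
    ∃ ε, 0 < ε ∧ 0 < T.truncDrift ε := by
  by_cases hγ : 0 < T.γ
  · exact ⟨1, one_pos, hγ.trans_le (T.le_truncDrift one_pos)⟩
  have hγ : T.γ ≤ 0 := not_lt.1 hγ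
  have hlt : ENNReal.ofReal (-T.γ) < ∫⁻ z in Ioc (0 : ℝ) 1, ENNReal.ofReal z ∂T.ν := by
    by_cases hb : ∫⁻ z in Ioc (0 : ℝ) 1, ENNReal.ofReal z ∂T.ν < ⊤
    · have hd : 0 < T.drift := hT ⟨hσ, hb⟩
      unfold drift at hd
      rw [integral_eq_lintegral_of_nonneg_ae] at hd
      · rw [ENNReal.ofReal_lt_iff_lt_toReal (by linarith) hb.ne]
        linarith
      · exact (ae_restrict_iff' measurableSet_Ioc).2 (Eventually.of_forall fun z hz => hz.1.le)
      · fun_prop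
    · rw [not_lt, top_le_iff] at hb
      rw [hb]; exact ENNReal.ofReal_lt_top
  have hU : Ioc (0 : ℝ) 1 = ⋃ n : ℕ, Ioc (1 / ((n : ℝ) + 1)) 1 := by
    ext z
    simp only [mem_Ioc, mem_iUnion]
    constructor
    · rintro ⟨h0, h1⟩
      obtain ⟨n, hn⟩ := exists_nat_one_div_lt h0
      exact ⟨n, hn, h1⟩
    · rintro ⟨n, h0, h1⟩
      exact ⟨lt_trans (by positivity) h0, h1⟩
  rw [hU, setLIntegral_iUnion_of_directed, lt_iSup_iff] at hlt
  · obtain ⟨n, hn⟩ := hlt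
    have hn0 : (0 : ℝ) < 1 / ((n : ℝ) + 1) := by positivity
    refine ⟨1 / ((n : ℝ) + 1), hn0, ?_⟩
    have hi := T.integrableOn_id_Ioc hn0
    rw [← ofReal_integral_eq_lintegral_ofReal hi] at hn
    · have := (ENNReal.ofReal_lt_ofReal_iff_of_nonneg (by linarith)).1 hn
      unfold truncDrift; linarith
    · exact (ae_restrict_iff' measurableSet_Ioc).2
        (Eventually.of_forall fun z hz => (hn0.trans hz.1).le)
  · refine Monotone.directed_le fun m n hmn => Ioc_subset_Ioc_left ?_
    exact one_div_le_one_div_of_le (by positivity) (by gcongr)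

/-- The kernel is non-negative for z ≤ ε; for z > ε the exponential is dropped, which costs at most
the mass ν(ε, ∞). -/
theorem psi_ge {ε θ : ℝ} (hε : 0 < ε) (hε1 : ε ≤ 1) (hθ : 0 ≤ θ) :
    T.truncDrift ε * θ + T.σ ^ 2 * θ ^ 2 / 2 - T.ν.real (Ioi ε) ≤ T.psi θ := by
  have hfin := T.tail_lt_top hε
  have hI1 : IntegrableOn (fun z => (Ioc ε 1).indicator (fun z => θ * z) z) (Ioi 0) T.ν := by
    have h : IntegrableOn (fun z : ℝ => θ * z) (Ioc ε 1) T.ν := (T.integrableOn_id_Ioc hε).const_mul θ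
    exact (h.integrable_indicator measurableSet_Ioc).integrableOn
  have hI2 : IntegrableOn (fun z => (Ioi ε).indicator (fun _ => (1 : ℝ)) z) (Ioi 0) T.ν := by
    have h : IntegrableOn (fun _ : ℝ => (1 : ℝ)) (Ioi ε) T.ν := integrableOn_const hfin.ne
    exact (h.integrable_indicator measurableSet_Ioi).integrableOn
  have h1 : ∫ z in Ioi (0 : ℝ), ((Ioc ε 1).indicator (fun z => θ * z) z -
      (Ioi ε).indicator (fun _ => 1) z) ∂T.ν ≤ ∫ z in Ioi (0 : ℝ), levyKernel θ z ∂T.ν := by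
    refine setIntegral_mono_on ?_ (T.integrableOn_levyKernel hθ) measurableSet_Ioi fun z hz => ?_
    · exact hI1.sub hI2
    · have hz : 0 < z := hz
      have hexp := Real.exp_pos (-θ * z)
      have hexp2 := Real.add_one_le_exp (-θ * z)
      rcases le_or_gt z 1 with h | h
      · rw [levyKernel_eq_of_le hz h]
        by_cases h' : ε < z
        · rw [indicator_of_mem (show z ∈ Ioc ε 1 from ⟨h', h⟩), indicator_of_mem (mem_Ioi.2 h')]
          linarith
        · rw [indicator_of_notMem (fun hh : z ∈ Ioc ε 1 => h' hh.1),
            indicator_of_notMem (fun hh : z ∈ Ioi ε => h' hh)]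
          linarith
      · rw [levyKernel_eq_of_gt h, indicator_of_notMem (fun hh : z ∈ Ioc ε 1 => h.not_ge hh.2),
          indicator_of_mem (mem_Ioi.2 (hε1.trans_lt h))]
        linarith
  have h2 : ∫ z in Ioi (0 : ℝ), ((Ioc ε 1).indicator (fun z => θ * z) z -
      (Ioi ε).indicator (fun _ => 1) z) ∂T.ν = θ * (∫ z in Ioc ε 1, z ∂T.ν) - T.ν.real (Ioi ε) := by
    rw [integral_sub, setIntegral_indicator measurableSet_Ioc, setIntegral_indicator measurableSet_Ioi,
      inter_eq_right.2 (Ioc_subset_Ioi_self.trans (Ioi_subset_Ioi hε.le)),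
      inter_eq_right.2 (Ioi_subset_Ioi hε.le), integral_const_mul]
    · simp
    · exact hI1
    · exact hI2
  rw [psi_eq]
  unfold truncDrift
  linarith

theorem tendsto_psi_atTop (hT : T.NotNegSubordinator) : Tendsto T.psi atTop atTop := by
  by_cases hσ : T.σ = 0
  · obtain ⟨ε, hε, hpos⟩ := T.exists_truncDrift_pos hT hσ
    have hε' : 0 < min ε 1 := lt_min hε one_pos
    have hpos' := hpos.trans_le (T.truncDrift_anti hε' (min_le_left ε 1))
    refine tendsto_atTop_mono' atTop (f₁ := fun θ => T.truncDrift (min ε 1) * θ -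
      T.ν.real (Ioi (min ε 1))) ?_ ?_
    · filter_upwards [eventually_ge_atTop 0] with θ hθ
      have := T.psi_ge hε' (min_le_right _ _) hθ
      simpa [hσ] using this
    · exact tendsto_atTop_add_const_right _ _ (tendsto_id.const_mul_atTop hpos')
  · have hσ' : 0 < T.σ ^ 2 := by positivity
    refine tendsto_atTop_mono' atTop (f₁ := fun θ => (T.γ + T.σ ^ 2 / 2 * θ) * θ -
      T.ν.real (Ioi 1)) ?_ ?_
    · filter_upwards [eventually_ge_atTop 0] with θ hθ
      have := T.psi_ge one_pos le_rfl hθ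
      simp only [truncDrift, Ioc_self, Measure.restrict_empty, integral_zero_measure] at this
      linarith
    · refine tendsto_atTop_add_const_right _ _ (Tendsto.atTop_mul_atTop₀ ?_ tendsto_id)
      exact tendsto_atTop_add_const_left _ _ (tendsto_id.const_mul_atTop (by positivity))

section Phi

variable {T} {p : ℝ}

theorem exists_psi_eq (hT : T.NotNegSubordinator) {l : ℝ} (hl : 0 ≤ l) (h : T.psi l ≤ p) :
    ∃ m, l ≤ m ∧ T.psi m = p := by
  obtain ⟨b, hb, hlb⟩ := ((T.tendsto_psi_atTop hT).eventually_ge_atTop p |>.and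
    (eventually_ge_atTop l)).exists
  have hc : ContinuousOn T.psi (Icc l b) :=
    T.continuousOn_psi.mono fun x hx => hl.trans hx.1
  obtain ⟨m, hm, hmp⟩ := intermediate_value_Icc hlb hc ⟨h, hb⟩
  exact ⟨m, hm.1, hmp⟩

theorem bddAbove_psi_eq (hT : T.NotNegSubordinator) : BddAbove {l : ℝ | 0 ≤ l ∧ T.psi l = p} := by
  obtain ⟨B, hB⟩ := eventually_atTop.1 ((T.tendsto_psi_atTop hT).eventually_gt_atTop p)
  refine ⟨B, fun l hl => ?_⟩
  by_contra h
  exact absurd hl.2 (hB l (not_le.1 h).le).ne'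

theorem Phi_mem (hT : T.NotNegSubordinator) (hp : 0 < p) : 0 ≤ T.Phi p ∧ T.psi (T.Phi p) = p := by
  have hne : {l : ℝ | 0 ≤ l ∧ T.psi l = p}.Nonempty := by
    obtain ⟨m, hm, hmp⟩ := exists_psi_eq hT le_rfl (T.psi_zero.trans_le hp.le)
    exact ⟨m, hm, hmp⟩
  have hcl : IsClosed {l : ℝ | 0 ≤ l ∧ T.psi l = p} := by
    have := T.continuousOn_psi.preimage_isClosed_of_isClosed isClosed_Ici (isClosed_singleton (x := p))
    exact this
  exact hcl.csSup_mem hne (bddAbove_psi_eq hT)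

theorem psi_Phi (hT : T.NotNegSubordinator) (hp : 0 < p) : T.psi (T.Phi p) = p := (Phi_mem hT hp).2

theorem Phi_pos (hT : T.NotNegSubordinator) (hp : 0 < p) : 0 < T.Phi p := by
  refine (Phi_mem hT hp).1.lt_of_ne fun h => ?_
  have := psi_Phi hT hp
  rw [← h, psi_zero] at this
  exact hp.ne this

theorem lt_psi_of_Phi_lt (hT : T.NotNegSubordinator) (hp : 0 < p) {θ : ℝ} (h : T.Phi p < θ) :
    p < T.psi θ := by
  by_contra hle
  have h0 := (Phi_pos hT hp).trans h
  obtain ⟨m, hm, hmp⟩ := exists_psi_eq hT h0.le (not_lt.1 hle)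
  have : m ≤ T.Phi p := le_csSup (bddAbove_psi_eq hT) ⟨h0.le.trans hm, hmp⟩
  linarith

theorem Phi_lt_Phi (hT : T.NotNegSubordinator) {q : ℝ} (hq : 0 < q) (hqp : q < p) :
    T.Phi q < T.Phi p := by
  obtain ⟨m, hm, hmp⟩ := exists_psi_eq (p := p) hT (Phi_pos hT hq).le
    ((psi_Phi hT hq).trans_le hqp.le)
  have h1 : m ≤ T.Phi p := le_csSup (bddAbove_psi_eq hT) ⟨(Phi_pos hT hq).le.trans hm, hmp⟩
  refine (hm.trans h1).lt_of_ne fun h => ?_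
  have := psi_Phi hT hq
  rw [h, psi_Phi hT (hq.trans hqp)] at this
  exact hqp.ne' this

end Phi

end LevyTriplet

/-! ### Log-concavity and generating functions of renewal sequences -/

/-- The solution of the renewal recursion `w n = c + ∑_{i < n} k (n - 1 - i) * w i`. -/
def renewalSeq (k : ℕ → ℝ) (c : ℝ) (n : ℕ) : ℝ :=
  c + ∑ i : Fin n, k (n - 1 - i) * renewalSeq k c i
termination_by n
decreasing_by exact i.2

namespace renewalSeq

variable {k : ℕ → ℝ} {c : ℝ}

theorem eq_range (n : ℕ) :
    renewalSeq k c n = c + ∑ i ∈ Finset.range n, k (n - 1 - i) * renewalSeq k c i := by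
  rw [renewalSeq, Finset.sum_range]

theorem eq_range_flip (n : ℕ) :
    renewalSeq k c n = c + ∑ j ∈ Finset.range n, k j * renewalSeq k c (n - 1 - j) := by
  rw [eq_range, ← Finset.sum_range_reflect]
  congr 1
  refine Finset.sum_congr rfl fun j hj => ?_
  have := Finset.mem_range.1 hj
  rw [show n - 1 - (n - 1 - j) = j by omega]

theorem pos (hk : ∀ n, 0 ≤ k n) (hc : 0 < c) (n : ℕ) : 0 < renewalSeq k c n := by
  induction n using Nat.strong_induction_on with
  | _ n ih =>
    rw [eq_range]
    have : 0 ≤ ∑ i ∈ Finset.range n, k (n - 1 - i) * renewalSeq k c i :=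
      Finset.sum_nonneg fun i hi => mul_nonneg (hk _) (ih i (Finset.mem_range.1 hi)).le
    linarith

/-- Difference of two consecutive recursions. For a non-increasing kernel the coefficients k j - k
(j + 1) are non-negative, which is what allows ratios of the sequence to be compared. -/
theorem succ_eq (n : ℕ) :
    renewalSeq k c (n + 1) = (1 + k 0) * renewalSeq k c n -
      ∑ j ∈ Finset.range n, (k j - k (j + 1)) * renewalSeq k c (n - 1 - j) := by
  have h1 : renewalSeq k c (n + 1) = c + (∑ j ∈ Finset.range n,
      k (j + 1) * renewalSeq k c (n - 1 - j) + k 0 * renewalSeq k c n) := by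
    rw [eq_range_flip, Finset.sum_range_succ']
    simp only [Nat.add_sub_cancel, Nat.sub_zero]
    congr 2
    refine Finset.sum_congr rfl fun j _ => ?_
    rw [show n - (j + 1) = n - 1 - j by omega]
  have h2 := eq_range_flip (k := k) (c := c) n
  simp only [sub_mul, Finset.sum_sub_distrib]
  rw [h1]
  linarith

theorem le_succ (hk : ∀ n, 0 ≤ k n) (hc : 0 < c) (n : ℕ) :
    renewalSeq k c n ≤ renewalSeq k c (n + 1) := by
  induction n using Nat.strong_induction_on with
  | _ n ih =>
    rw [eq_range_flip n, eq_range_flip (n + 1), Finset.sum_range_succ]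
    have h1 : ∑ j ∈ Finset.range n, k j * renewalSeq k c (n - 1 - j) ≤
        ∑ j ∈ Finset.range n, k j * renewalSeq k c (n + 1 - 1 - j) := by
      refine Finset.sum_le_sum fun j hj => ?_
      have hj := Finset.mem_range.1 hj
      have := ih (n - 1 - j) (by omega)
      rw [show n - 1 - j + 1 = n + 1 - 1 - j by omega] at this
      exact mul_le_mul_of_nonneg_left this (hk j)
    have h2 : 0 ≤ k n * renewalSeq k c (n + 1 - 1 - n) := mul_nonneg (hk n) (pos hk hc _).le
    linarith

theorem monotone (hk : ∀ n, 0 ≤ k n) (hc : 0 < c) : Monotone (renewalSeq k c) :=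
  monotone_nat_of_le_succ (le_succ hk hc)

/-- The ratios w (n + 1) / w n decrease. By `succ_eq` such a ratio is 1 + k 0 minus a non-negative
combination of the quotients w (n - 1 - j) / w n; passing from n to n + 1 increases each quotient,
by the induction hypothesis, and adds one more non-negative term. -/
theorem mul_succ_le (hk : ∀ n, 0 ≤ k n) (ha : Antitone k) (hc : 0 < c) (n : ℕ) :
    ∀ i ≤ n, renewalSeq k c i * renewalSeq k c (n + 1) ≤
      renewalSeq k c (i + 1) * renewalSeq k c n := by
  induction n with
  | zero =>
    intro i hi
    obtain rfl : i = 0 := by omega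
    exact (mul_comm _ _).le
  | succ n ih =>
    have key : renewalSeq k c n * renewalSeq k c (n + 2) ≤
        renewalSeq k c (n + 1) * renewalSeq k c (n + 1) := by
      have h1 := succ_eq (k := k) (c := c) (n + 1)
      have h2 := succ_eq (k := k) (c := c) n
      rw [Finset.sum_range_succ] at h1
      have h3 : (∑ j ∈ Finset.range n, (k j - k (j + 1)) * renewalSeq k c (n - 1 - j)) *
            renewalSeq k c (n + 1) ≤
          (∑ j ∈ Finset.range n, (k j - k (j + 1)) * renewalSeq k c (n + 1 - 1 - j)) *
            renewalSeq k c n := by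
        rw [Finset.sum_mul, Finset.sum_mul]
        refine Finset.sum_le_sum fun j hj => ?_
        have hj := Finset.mem_range.1 hj
        have h4 := ih (n - 1 - j) (by omega)
        rw [show n - 1 - j + 1 = n + 1 - 1 - j by omega] at h4
        rw [mul_assoc, mul_assoc]
        exact mul_le_mul_of_nonneg_left h4 (sub_nonneg.2 (ha (Nat.le_succ j)))
      have h5 : 0 ≤ (k n - k (n + 1)) * renewalSeq k c (n + 1 - 1 - n) * renewalSeq k c n :=
        mul_nonneg (mul_nonneg (sub_nonneg.2 (ha (Nat.le_succ n))) (pos hk hc _).le)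
          (pos hk hc _).le
      have h6 : renewalSeq k c n * renewalSeq k c (n + 2) = renewalSeq k c n *
        renewalSeq k c (n + 1 + 1) := rfl
      have h7 : renewalSeq k c (n + 1) * renewalSeq k c (n + 1) = ((1 + k 0) * renewalSeq k c n -
          ∑ j ∈ Finset.range n, (k j - k (j + 1)) * renewalSeq k c (n - 1 - j)) *
            renewalSeq k c (n + 1) := by rw [← h2]
      rw [h6, h1, h7]
      linarith
    intro i hi
    rcases Nat.lt_or_ge n i with h | h
    · obtain rfl : i = n + 1 := by omega
      exact (mul_comm _ _).le
    · have hn := pos hk hc n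
      have h1 := ih i h
      have h2 := (pos hk hc i).le
      have h3 := (pos hk hc (n + 1)).le
      refine le_of_mul_le_mul_left ?_ hn
      calc renewalSeq k c n * (renewalSeq k c i * renewalSeq k c (n + 1 + 1))
          = renewalSeq k c i * (renewalSeq k c n * renewalSeq k c (n + 2)) := by ring
        _ ≤ renewalSeq k c i * (renewalSeq k c (n + 1) * renewalSeq k c (n + 1)) :=
            mul_le_mul_of_nonneg_left key h2
        _ = (renewalSeq k c i * renewalSeq k c (n + 1)) * renewalSeq k c (n + 1) := by ring
        _ ≤ (renewalSeq k c (i + 1) * renewalSeq k c n) * renewalSeq k c (n + 1) :=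
            mul_le_mul_of_nonneg_right h1 h3
        _ = _ := by ring

/-- Log-concavity of the renewal sequence of a non-increasing kernel. -/
theorem mul_add_le (hk : ∀ n, 0 ≤ k n) (ha : Antitone k) (hc : 0 < c) {i l : ℕ} (hil : i ≤ l)
    (d : ℕ) : renewalSeq k c i * renewalSeq k c (l + d) ≤
      renewalSeq k c (i + d) * renewalSeq k c l := by
  induction d with
  | zero => simp
  | succ d ih =>
    have hp := pos hk hc (l + d)
    have h1 := mul_succ_le hk ha hc (l + d) (i + d) (by omega)
    have h2 := (pos hk hc l).le
    have h3 := (pos hk hc (l + (d + 1))).le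
    refine le_of_mul_le_mul_left ?_ hp
    calc renewalSeq k c (l + d) * (renewalSeq k c i * renewalSeq k c (l + (d + 1)))
        = (renewalSeq k c i * renewalSeq k c (l + d)) * renewalSeq k c (l + (d + 1)) := by ring
      _ ≤ (renewalSeq k c (i + d) * renewalSeq k c l) * renewalSeq k c (l + (d + 1)) :=
          mul_le_mul_of_nonneg_right ih h3
      _ = (renewalSeq k c (i + d) * renewalSeq k c (l + d + 1)) * renewalSeq k c l := by
          rw [show l + (d + 1) = l + d + 1 from rfl]; ring
      _ ≤ (renewalSeq k c (i + d + 1) * renewalSeq k c (l + d)) * renewalSeq k c l :=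
          mul_le_mul_of_nonneg_right h1 h2
      _ = _ := by rw [show i + (d + 1) = i + d + 1 from rfl]; ring

/-- The generating function of the renewal sequence. -/
theorem hasSum (hk : ∀ n, 0 ≤ k n) (hc : 0 < c) {s K : ℝ} (hs0 : 0 < s) (hs1 : s < 1)
    (hK : HasSum (fun j => k j * s ^ (j + 1)) K) (hK1 : K < 1) :
    HasSum (fun n => renewalSeq k c n * s ^ n) (c / ((1 - s) * (1 - K))) := by
  have hw := fun n => (pos hk hc n).le
  have h1s : 0 < 1 - s := by linarith
  have h1K : 0 < 1 - K := by linarith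
  have hconv : ∀ n, renewalSeq k c n * s ^ n = c * s ^ n +
      ∑ j ∈ Finset.range n, (k j * s ^ (j + 1)) *
        (renewalSeq k c (n - 1 - j) * s ^ (n - 1 - j)) := by
    intro n
    rw [eq_range_flip, add_mul, Finset.sum_mul]
    congr 1
    refine Finset.sum_congr rfl fun j hj => ?_
    have hj := Finset.mem_range.1 hj
    have : s ^ n = s ^ (j + 1) * s ^ (n - 1 - j) := by rw [← pow_add]; congr 1; omega
    rw [this]; ring
  -- The partial sums satisfy S ≤ c / (1 - s) + K S. Since K < 1 this bounds them, so that
  -- summability is known before the Cauchy product is used to find the exact value.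
  have hbound : ∀ N, ∑ n ∈ Finset.range N, renewalSeq k c n * s ^ n ≤ c / ((1 - s) * (1 - K)) := by
    intro N
    set S := ∑ n ∈ Finset.range N, renewalSeq k c n * s ^ n with hS
    have hS0 : ∀ m, 0 ≤ renewalSeq k c m * s ^ m := fun m => mul_nonneg (hw m) (by positivity)
    have h1 : S ≤ c / (1 - s) + K * S := by
      have hg : ∑ n ∈ Finset.range N, c * s ^ n ≤ c / (1 - s) := by
        rw [← Finset.mul_sum, div_eq_mul_inv, ← tsum_geometric_of_lt_one hs0.le hs1]
        exact mul_le_mul_of_nonneg_left ((summable_geometric_of_lt_one hs0.le hs1).sum_le_tsum _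
          fun i _ => by positivity) hc.le
      have hd : ∑ n ∈ Finset.range N, ∑ j ∈ Finset.range n, (k j * s ^ (j + 1)) *
          (renewalSeq k c (n - 1 - j) * s ^ (n - 1 - j)) ≤ K * S := by
        have h2 : ∑ n ∈ Finset.range N, ∑ j ∈ Finset.range n, (k j * s ^ (j + 1)) *
            (renewalSeq k c (n - 1 - j) * s ^ (n - 1 - j)) ≤
            ∑ j ∈ Finset.range N, (k j * s ^ (j + 1)) * S := by
          rw [Finset.sum_comm' (t' := Finset.range N) (s' := fun j => Finset.Ico (j + 1) N)
            (fun n j => by simp only [Finset.mem_range, Finset.mem_Ico]; omega)]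
          refine Finset.sum_le_sum fun j _ => ?_
          rw [← Finset.mul_sum, Finset.sum_Ico_eq_sum_range]
          refine mul_le_mul_of_nonneg_left ?_ (mul_nonneg (hk j) (by positivity))
          refine le_trans (le_of_eq (Finset.sum_congr rfl fun i _ => ?_))
            (Finset.sum_le_sum_of_subset_of_nonneg
              (Finset.range_mono (Nat.sub_le N (j + 1))) fun i _ _ => hS0 i)
          rw [show j + 1 + i - 1 - j = i by omega]
        refine h2.trans ?_
        rw [← Finset.sum_mul]
        refine mul_le_mul_of_nonneg_right ?_ (Finset.sum_nonneg fun n _ => hS0 n)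
        exact sum_le_hasSum _ (fun j _ => mul_nonneg (hk j) (by positivity)) hK
      calc S = ∑ n ∈ Finset.range N, c * s ^ n + ∑ n ∈ Finset.range N, ∑ j ∈ Finset.range n,
            (k j * s ^ (j + 1)) * (renewalSeq k c (n - 1 - j) * s ^ (n - 1 - j)) := by
              rw [hS, ← Finset.sum_add_distrib]; exact Finset.sum_congr rfl fun n _ => hconv n
        _ ≤ _ := add_le_add hg hd
    rw [le_div_iff₀ (by positivity)]
    have h3 : S * (1 - K) ≤ c / (1 - s) := by linarith
    rw [le_div_iff₀ h1s] at h3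
    linarith
  have hsum : Summable fun n => renewalSeq k c n * s ^ n :=
    summable_of_sum_range_le (fun n => mul_nonneg (hw n) (by positivity)) hbound
  have hprod := tsum_mul_tsum_eq_tsum_sum_range_of_summable_norm hK.summable.norm hsum.norm
  have hprods := (summable_norm_sum_mul_range_of_summable_norm hK.summable.norm hsum.norm).of_norm
  rw [hK.tsum_eq] at hprod
  have hgeo := (hasSum_geometric_of_lt_one hs0.le hs1).mul_left (c * s)
  have hS := hsum.tsum_eq_zero_add
  have hsucc : ∀ n, renewalSeq k c (n + 1) * s ^ (n + 1) = c * s * s ^ n +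
      ∑ j ∈ Finset.range (n + 1), (k j * s ^ (j + 1)) *
        (renewalSeq k c (n - j) * s ^ (n - j)) := by
    intro n
    rw [hconv]
    simp only [Nat.add_sub_cancel]
    ring
  have hw0 : renewalSeq k c 0 = c := by rw [eq_range]; simp
  rw [tsum_congr hsucc, hgeo.summable.tsum_add hprods, hgeo.tsum_eq, ← hprod, hw0, pow_zero] at hS
  refine hsum.hasSum_iff.2 ?_
  set S := ∑' n, renewalSeq k c n * s ^ n
  field_simp at hS
  rw [eq_div_iff (by positivity)]
  linarith

end renewalSeq

/-! ### Step functions and scale functions of skip-free walks -/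

theorem iUnion_Ico_nat_mul {h : ℝ} (hh : 0 < h) :
    ⋃ n : ℕ, Ico ((n : ℝ) * h) (((n : ℝ) + 1) * h) = Ici 0 := by
  ext x
  simp only [mem_iUnion, mem_Ico, mem_Ici]
  constructor
  · rintro ⟨n, hn, -⟩
    exact le_trans (by positivity) hn
  · intro hx
    refine ⟨⌊x / h⌋₊, ?_, ?_⟩
    · rw [← le_div_iff₀ hh]; exact Nat.floor_le (by positivity)
    · rw [← div_lt_iff₀ hh]; exact Nat.lt_floor_add_one _

theorem floor_div_eq {h x : ℝ} (hh : 0 < h) {n : ℕ}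
    (hx : x ∈ Ico ((n : ℝ) * h) (((n : ℝ) + 1) * h)) : ⌊x / h⌋₊ = n := by
  rw [Nat.floor_eq_iff (div_nonneg (le_trans (by positivity) hx.1) hh.le),
    le_div_iff₀ hh, div_lt_iff₀ hh]
  exact hx

theorem pairwise_disjoint_Ico_nat_mul {h : ℝ} (hh : 0 < h) :
    Pairwise (Function.onFun Disjoint fun n : ℕ => Ico ((n : ℝ) * h) (((n : ℝ) + 1) * h)) := by
  intro m n hmn
  refine disjoint_left.2 fun x hm hn => hmn ?_
  rw [← floor_div_eq hh hm, floor_div_eq hh hn]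

theorem integral_Ico_exp_neg {θ : ℝ} (hθ : 0 < θ) {u v : ℝ} (huv : u ≤ v) :
    ∫ x in Ico u v, Real.exp (-θ * x) = (Real.exp (-θ * u) - Real.exp (-θ * v)) / θ := by
  rw [integral_Ico_eq_integral_Ioc, ← intervalIntegral.integral_of_le huv]
  have : ∀ x ∈ uIcc u v, HasDerivAt (fun x => -Real.exp (-θ * x) / θ) (Real.exp (-θ * x)) x := by
    intro x _
    have h := ((((hasDerivAt_id x).const_mul (-θ)).exp).neg).div_const θ
    refine h.congr_deriv ?_
    simp only [id]
    field_simp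
  rw [intervalIntegral.integral_eq_sub_of_hasDerivAt this
    (Continuous.intervalIntegrable (by fun_prop) _ _)]
  ring

/-- The Laplace transform of a step function. -/
theorem laplace_step {w : ℕ → ℝ} (hw : ∀ n, 0 ≤ w n) {θ h S : ℝ} (hθ : 0 < θ) (hh : 0 < h)
    (hS : HasSum (fun n => w n * Real.exp (-θ * h) ^ n) S) :
    IntegrableOn (fun x => Real.exp (-θ * x) * w ⌊x / h⌋₊) (Ioi 0) ∧
      ∫ x in Ioi (0 : ℝ), Real.exp (-θ * x) * w ⌊x / h⌋₊ =
        (1 - Real.exp (-θ * h)) / θ * S := by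
  set s := Real.exp (-θ * h) with hs
  have hle : ∀ n : ℕ, (n : ℝ) * h ≤ ((n : ℝ) + 1) * h := fun n => by nlinarith
  have hval : ∀ n : ℕ, ∫ x in Ico ((n : ℝ) * h) (((n : ℝ) + 1) * h),
      Real.exp (-θ * x) * w ⌊x / h⌋₊ = (1 - s) / θ * (w n * s ^ n) := by
    intro n
    rw [setIntegral_congr_fun (g := fun x => Real.exp (-θ * x) * w n) measurableSet_Ico
      fun x hx => by simp only [floor_div_eq hh hx]]
    rw [integral_mul_const, integral_Ico_exp_neg hθ (hle n)]
    have h1 : Real.exp (-θ * (n * h)) = s ^ n := by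
      rw [hs, ← Real.exp_nat_mul]; congr 1; ring
    have h2 : Real.exp (-θ * ((n + 1) * h)) = s ^ n * s := by
      rw [← pow_succ, hs, ← Real.exp_nat_mul]; congr 1; push_cast; ring
    rw [h1, h2]; ring
  have hint : ∀ n : ℕ, IntegrableOn (fun x => Real.exp (-θ * x) * w ⌊x / h⌋₊)
      (Ico ((n : ℝ) * h) (((n : ℝ) + 1) * h)) := by
    intro n
    refine IntegrableOn.congr_fun (f := fun x => Real.exp (-θ * x) * w n) ?_
      (fun x hx => by simp only [floor_div_eq hh hx]) measurableSet_Ico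
    exact (Continuous.integrableOn_Icc (by fun_prop)).mono_set Ico_subset_Icc_self
  have hnorm : ∀ x, ‖Real.exp (-θ * x) * w ⌊x / h⌋₊‖ = Real.exp (-θ * x) * w ⌊x / h⌋₊ := fun x =>
    Real.norm_of_nonneg (mul_nonneg (Real.exp_pos _).le (hw _))
  have hI : IntegrableOn (fun x => Real.exp (-θ * x) * w ⌊x / h⌋₊) (Ici 0) := by
    rw [← iUnion_Ico_nat_mul hh]
    refine integrableOn_iUnion_of_summable_integral_norm hint ?_
    simp only [hnorm, hval]
    exact (hS.mul_left _).summable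
  refine ⟨hI.mono_set Ioi_subset_Ici_self, ?_⟩
  rw [← integral_Ici_eq_integral_Ioi]
  have h1 := hasSum_integral_iUnion (fun n => measurableSet_Ico) (pairwise_disjoint_Ico_nat_mul hh)
    (by rw [iUnion_Ico_nat_mul hh]; exact hI)
  rw [iUnion_Ico_nat_mul hh] at h1
  simp only [hval] at h1
  exact h1.unique (hS.mul_left _)

section Kernel

variable {lam : Measure ℝ} {N : ℝ → ℕ} {A p : ℝ}

/-- The renewal kernel of an upward skip-free random walk with killing. -/
def skipFreeKernel (lam : Measure ℝ) (N : ℝ → ℕ) (A p : ℝ) (j : ℕ) : ℝ :=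
  (p + lam.real {z | j + 1 ≤ N z}) / A

theorem skipFreeKernel_nonneg (hA : 0 < A) (hp : 0 < p) (j : ℕ) :
    0 ≤ skipFreeKernel lam N A p j := by
  unfold skipFreeKernel; positivity

theorem skipFreeKernel_antitone [IsFiniteMeasure lam] (hA : 0 < A) : Antitone (skipFreeKernel lam N A p) := by
  intro i j hij
  unfold skipFreeKernel
  have : lam.real {z | j + 1 ≤ N z} ≤ lam.real {z | i + 1 ≤ N z} :=
    measureReal_mono fun z (hz : j + 1 ≤ N z) => show i + 1 ≤ N z by omega
  gcongr

/-- Layer-cake summation: the sum of s ^ (j + 1) over j < N z is s (1 - s ^ N z) / (1 - s), and the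
sum is exchanged with the integral. -/
theorem hasSum_skipFreeKernel [IsFiniteMeasure lam] (hN : Measurable N) {s : ℝ} (hs0 : 0 < s) (hs1 : s < 1) :
    HasSum (fun j => skipFreeKernel lam N A p j * s ^ (j + 1))
      (s / (1 - s) * (p + ∫ z, (1 - s ^ N z) ∂lam) / A) := by
  have h1s : 0 < 1 - s := by linarith
  have hms : ∀ j : ℕ, MeasurableSet {z | j + 1 ≤ N z} := fun j =>
    measurableSet_le measurable_const hN
  have hFi : ∀ j : ℕ, Integrable ({z | j + 1 ≤ N z}.indicator fun _ => s ^ (j + 1)) lam := fun j =>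
    (integrable_const _).indicator (hms j)
  have hFv : ∀ j : ℕ, ∫ z, {z | j + 1 ≤ N z}.indicator (fun _ => s ^ (j + 1)) z ∂lam =
      lam.real {z | j + 1 ≤ N z} * s ^ (j + 1) := fun j => by
    rw [integral_indicator (hms j)]; simp
  have hnorm : ∀ (j : ℕ) z, ‖{z | j + 1 ≤ N z}.indicator (fun _ => s ^ (j + 1)) z‖ =
      {z | j + 1 ≤ N z}.indicator (fun _ => s ^ (j + 1)) z := fun j z =>
    Real.norm_of_nonneg (indicator_nonneg (fun _ _ => by positivity) _)
  have hgeo : Summable fun j : ℕ => s ^ (j + 1) :=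
    ((summable_geometric_of_lt_one hs0.le hs1).mul_left s).congr fun j => by ring
  have hsum : Summable fun j : ℕ => ∫ z, ‖{z | j + 1 ≤ N z}.indicator
      (fun _ => s ^ (j + 1)) z‖ ∂lam := by
    simp only [hnorm, hFv]
    refine Summable.of_nonneg_of_le (fun j => by positivity) (fun j => ?_)
      (hgeo.mul_left (lam.real univ))
    exact mul_le_mul_of_nonneg_right (measureReal_mono (subset_univ _)) (by positivity)
  have h1 := hasSum_integral_of_summable_integral_norm hFi hsum
  have hpt : ∀ z, ∑' j : ℕ, {z | j + 1 ≤ N z}.indicator (fun _ => s ^ (j + 1)) z =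
      s / (1 - s) * (1 - s ^ N z) := by
    intro z
    rw [tsum_eq_sum (s := Finset.range (N z))]
    · rw [Finset.sum_congr rfl (g := fun j => s * s ^ j), ← Finset.mul_sum, geom_sum_eq hs1.ne]
      · have : s - 1 ≠ 0 := by linarith
        field_simp
        ring
      · intro j hj
        have : z ∈ {z | j + 1 ≤ N z} := Finset.mem_range.1 hj
        rw [indicator_of_mem this]; ring
    · intro j hj
      refine indicator_of_notMem (fun h => hj (Finset.mem_range.2 ?_)) _
      exact h
  simp only [hFv, hpt, integral_const_mul] at h1
  have h2 : HasSum (fun j : ℕ => p * s ^ (j + 1)) (p * (s / (1 - s))) := by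
    refine HasSum.mul_left p ?_
    rw [div_eq_mul_inv]
    exact ((hasSum_geometric_of_lt_one hs0.le hs1).mul_left s).congr_fun fun j => by ring
  have h3 := (h2.add h1).div_const A
  rw [mul_comm p, ← mul_add] at h3
  refine h3.congr_fun fun j => ?_
  unfold skipFreeKernel
  ring

/-- The Laplace exponent of an upward skip-free random walk on `h ℤ`. -/
def skipFreeExponent (lam : Measure ℝ) (N : ℝ → ℕ) (A h θ : ℝ) : ℝ :=
  A * (Real.exp (θ * h) - 1) - ∫ z, (1 - Real.exp (-θ * h) ^ N z) ∂lam

/-- The scale function of an upward skip-free random walk on `h ℤ`. -/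
theorem exists_skipFree_scale [IsFiniteMeasure lam] (hN : Measurable N) (hA : 0 < A) (hp : 0 < p)
    {h : ℝ} (hh : 0 < h) :
    ∃ f : ℝ → ℝ, (∀ x, 0 ≤ f x) ∧ Monotone f ∧
      (∀ x y δ, 0 ≤ x → x ≤ y → 0 ≤ δ → f x * f (y + δ) ≤ f (x + δ + h) * f y) ∧
      ∀ θ, 0 < θ → p < skipFreeExponent lam N A h θ →
        IntegrableOn (fun x => Real.exp (-θ * x) * f x) (Ioi 0) ∧
          ∫ x in Ioi (0 : ℝ), Real.exp (-θ * x) * f x =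
            (Real.exp (θ * h) - 1) / (θ * h) / (skipFreeExponent lam N A h θ - p) := by
  set k := skipFreeKernel lam N A p
  have hk : ∀ n, 0 ≤ k n := skipFreeKernel_nonneg hA hp
  have hka : Antitone k := skipFreeKernel_antitone hA
  -- The initial value 1 / (A h) normalises the Laplace transform: the factor left over, (exp(θh) -
  -- 1) / (θh), tends to 1 as the mesh shrinks.
  have hc : 0 < 1 / (A * h) := by positivity
  have hmono := renewalSeq.monotone hk hc
  have hfl : ∀ {x y : ℝ}, x ≤ y → ⌊x / h⌋₊ ≤ ⌊y / h⌋₊ := fun hxy =>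
    Nat.floor_mono (by gcongr)
  refine ⟨fun x => renewalSeq k (1 / (A * h)) ⌊x / h⌋₊, fun x => (renewalSeq.pos hk hc _).le,
    fun x y hxy => hmono (hfl hxy), fun x y δ hx hxy hδ => ?_, fun θ hθ hψ => ?_⟩
  · obtain ⟨d, hd⟩ := Nat.exists_eq_add_of_le (hfl (by linarith : y ≤ y + δ))
    have hy0 : 0 ≤ y := hx.trans hxy
    -- The number d of lattice points passed between y and y + δ is less than δ / h + 1, so it may
    -- exceed by one the number passed between x and x + δ; the extra h absorbs this.
    have h1 : ⌊x / h⌋₊ + d ≤ ⌊(x + δ + h) / h⌋₊ := by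
      refine Nat.le_floor ?_
      have a1 : ((⌊(y + δ) / h⌋₊ : ℕ) : ℝ) ≤ (y + δ) / h := Nat.floor_le (by positivity)
      rw [hd] at a1
      have a2 := Nat.lt_floor_add_one (y / h)
      have a3 : ((⌊x / h⌋₊ : ℕ) : ℝ) ≤ x / h := Nat.floor_le (by positivity)
      have a4 : (x + δ + h) / h = x / h + δ / h + 1 := by field_simp
      rw [add_div] at a1
      push_cast at a1 ⊢
      rw [a4]
      linarith
    have h2 := renewalSeq.mul_add_le hk hka hc (hfl hxy) d
    simp only
    rw [hd]
    exact h2.trans (mul_le_mul_of_nonneg_right (hmono h1) (renewalSeq.pos hk hc _).le)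
  · set s := Real.exp (-θ * h) with hs
    have hs0 : 0 < s := Real.exp_pos _
    have hs1 : s < 1 := Real.exp_lt_one_iff.2 (by nlinarith [mul_pos hθ hh])
    have hse : Real.exp (θ * h) = 1 / s := by
      rw [hs, neg_mul, Real.exp_neg, one_div, inv_inv]
    have h1s : 0 < 1 - s := by linarith
    have hK := hasSum_skipFreeKernel (lam := lam) (A := A) (p := p) hN hs0 hs1
    unfold skipFreeExponent at hψ ⊢
    rw [← hs] at hψ ⊢
    rw [hse] at hψ ⊢
    set J := ∫ z, (1 - s ^ N z) ∂lam
    set K := s / (1 - s) * (p + J) / A with hKdef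
    -- This turns the condition that the exponent exceeds p into K < 1, which is what the generating
    -- function needs.
    have hKe : (1 - s) * (1 - K) = s / A * (A * (1 / s - 1) - J - p) := by
      rw [hKdef]; field_simp; ring
    have hK1 : K < 1 := by
      have : 0 < (1 - s) * (1 - K) := by
        rw [hKe]; exact mul_pos (by positivity) (by linarith)
      have := (pos_iff_pos_of_mul_pos this).1 h1s
      linarith
    have hS := renewalSeq.hasSum hk hc hs0 hs1 hK hK1
    obtain ⟨hi, hv⟩ := laplace_step (fun n => (renewalSeq.pos hk hc n).le) hθ hh hS
    refine ⟨hi, ?_⟩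
    rw [hv, ← hs, hKe]
    have hne : A * (1 / s - 1) - J - p ≠ 0 := by linarith
    set D := A * (1 / s - 1) - J - p
    field_simp

end Kernel

/-! ### Lattice approximation of the Lévy process -/

theorem exp_sub_one_sub_le {u : ℝ} (hu : 0 ≤ u) : Real.exp u - 1 - u ≤ u ^ 2 * Real.exp u := by
  have h1 := Real.add_one_le_exp (-u)
  have h2 : Real.exp u * Real.exp (-u) = 1 := by rw [← Real.exp_add]; simp
  have h3 := Real.exp_pos u
  have h4 : Real.exp u * (1 - u) ≤ 1 := by
    rw [← h2]; exact mul_le_mul_of_nonneg_left (by linarith) h3.le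
  nlinarith

/-- The forward difference quotient of `x ↦ exp (θ x)` at `0`. -/
def expQuot (θ h : ℝ) : ℝ := (Real.exp (θ * h) - 1) / h

theorem tendsto_expQuot (θ : ℝ) : Tendsto (expQuot θ) (𝓝[>] 0) (𝓝 θ) := by
  have h : HasDerivAt (fun x => Real.exp (θ * x)) θ 0 := by
    have := ((hasDerivAt_id (0 : ℝ)).const_mul θ).exp
    simpa using this
  have h1 := (hasDerivAt_iff_tendsto_slope_zero.1 h).mono_left
    (nhdsWithin_mono 0 fun x (hx : 0 < x) => hx.ne')
  refine h1.congr fun x => ?_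
  simp [expQuot, div_eq_inv_mul]

theorem abs_expQuot_sub_le {θ h : ℝ} (hθ : 0 ≤ θ) (hh : 0 < h) (h1 : h ≤ 1) :
    |expQuot θ h - θ| ≤ θ ^ 2 * Real.exp θ * h := by
  have h0 : 0 ≤ θ * h := mul_nonneg hθ hh.le
  have e1 := exp_sub_one_sub_le h0
  have e2 := Real.add_one_le_exp (θ * h)
  have e3 : Real.exp (θ * h) ≤ Real.exp θ := Real.exp_le_exp.2 (by nlinarith)
  have e4 : expQuot θ h - θ = (Real.exp (θ * h) - 1 - θ * h) / h := by
    unfold expQuot; field_simp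
  rw [e4, abs_of_nonneg (div_nonneg (by linarith) hh.le), div_le_iff₀ hh]
  calc Real.exp (θ * h) - 1 - θ * h ≤ (θ * h) ^ 2 * Real.exp (θ * h) := e1
    _ ≤ (θ * h) ^ 2 * Real.exp θ := by gcongr
    _ = _ := by ring

theorem abs_exp_neg_sub_exp_neg_le {a b : ℝ} (ha : 0 ≤ a) (hab : a ≤ b) :
    |Real.exp (-a) - Real.exp (-b)| ≤ b - a := by
  have h1 : Real.exp (-b) ≤ Real.exp (-a) := Real.exp_le_exp.2 (by linarith)
  rw [abs_of_nonneg (by linarith)]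
  have h2 := Real.add_one_le_exp (-(b - a))
  have h3 : Real.exp (-b) = Real.exp (-a) * Real.exp (-(b - a)) := by rw [← Real.exp_add]; ring_nf
  have h4 : Real.exp (-a) ≤ 1 := Real.exp_le_one_iff.2 (by linarith)
  have h5 := Real.exp_pos (-a)
  nlinarith

theorem exp_pow_floor {θ h z : ℝ} :
    Real.exp (-θ * h) ^ ⌊z / h⌋₊ = Real.exp (-(θ * (h * ⌊z / h⌋₊))) := by
  rw [← Real.exp_nat_mul]; congr 1; ring

theorem mul_floor_mem {h z : ℝ} (hh : 0 < h) (hz : 0 ≤ z) :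
    h * ⌊z / h⌋₊ ≤ z ∧ z ≤ h * ⌊z / h⌋₊ + h := by
  have h1 := Nat.floor_le (div_nonneg hz hh.le)
  have h2 := (Nat.lt_floor_add_one (z / h)).le
  rw [le_div_iff₀ hh] at h1
  rw [div_le_iff₀ hh] at h2
  constructor <;> linarith

namespace LevyTriplet

variable (T : LevyTriplet)

/-- The rate of the upward jumps of the lattice approximation. -/
def upRate (ε : ℝ) : ℝ := T.σ ^ 2 / (2 * (ε ^ 2) ^ 2) + T.truncDrift ε / ε ^ 2

/-- The measure of the downward jumps of the approximation, before rounding to the lattice. -/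
def jumpMeasure (ε : ℝ) : Measure ℝ :=
  T.ν.restrict (Ioi ε) + ENNReal.ofReal (T.σ ^ 2 / (2 * (ε ^ 2) ^ 2)) • Measure.dirac (ε ^ 2)

theorem isFiniteMeasure_jumpMeasure {ε : ℝ} (hε : 0 < ε) : IsFiniteMeasure (T.jumpMeasure ε) := by
  refine ⟨?_⟩
  have := T.tail_lt_top hε
  simp only [jumpMeasure, Measure.add_apply, Measure.smul_apply, Measure.restrict_apply_univ]
  rw [ENNReal.add_lt_top]
  exact ⟨this, by simp⟩

/-- If σ > 0, the term σ² / (2ε⁴) beats the drift term, which is at least -|γ| / ε²; this is ensured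
by 2ε² (|γ| + 1) ≤ σ². If σ = 0, the truncated drift is positive for small ε. -/
theorem exists_upRate_pos (hT : T.NotNegSubordinator) :
    ∃ ε₀, 0 < ε₀ ∧ ε₀ ≤ 1 ∧ ∀ ε, 0 < ε → ε ≤ ε₀ → 0 < T.upRate ε := by
  by_cases hσ : T.σ = 0
  · obtain ⟨ε, hε, hpos⟩ := T.exists_truncDrift_pos hT hσ
    refine ⟨min ε 1, lt_min hε one_pos, min_le_right _ _, fun δ hδ hle => ?_⟩
    have := hpos.trans_le (T.truncDrift_anti hδ (hle.trans (min_le_left ε 1)))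
    simp only [upRate, hσ]
    positivity
  · have hσ' : 0 < T.σ ^ 2 := by positivity
    refine ⟨min 1 (T.σ ^ 2 / (2 * (|T.γ| + 1))), lt_min one_pos (by positivity), min_le_left _ _,
      fun ε hε hle => ?_⟩
    have h1 : ε ≤ 1 := hle.trans (min_le_left _ _)
    have h2 : ε ≤ T.σ ^ 2 / (2 * (|T.γ| + 1)) := hle.trans (min_le_right _ _)
    rw [le_div_iff₀ (by positivity)] at h2
    have h3 : ε ^ 2 ≤ ε := by nlinarith
    have h4 := T.le_truncDrift hε
    have h5 := neg_abs_le T.γ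
    have h6 := abs_nonneg T.γ
    have h7 : T.upRate ε = (T.σ ^ 2 + 2 * ε ^ 2 * T.truncDrift ε) / (2 * (ε ^ 2) ^ 2) := by
      unfold upRate; field_simp
    rw [h7]
    refine div_pos ?_ (by positivity)
    have h8 : 0 < ε ^ 2 := by positivity
    nlinarith

/-- The Laplace exponent of the lattice approximation. -/
def approxExponent (ε θ : ℝ) : ℝ :=
  skipFreeExponent (T.jumpMeasure ε) (fun z => ⌊z / ε ^ 2⌋₊) (T.upRate ε) (ε ^ 2) θ

/-- The analogue of `levyKernel` for the lattice approximation. -/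
def approxKernel (ε θ z : ℝ) : ℝ :=
  (Ioi ε).indicator (fun z => Real.exp (-θ * ε ^ 2) ^ ⌊z / ε ^ 2⌋₊ - 1 +
    (Ioc (0 : ℝ) 1).indicator (fun z => expQuot θ (ε ^ 2) * z) z) z

theorem measurable_approxKernel (ε θ : ℝ) : Measurable (approxKernel ε θ) := by
  unfold approxKernel
  refine Measurable.indicator ?_ measurableSet_Ioi
  refine Measurable.add (by fun_prop) ?_
  exact (by fun_prop : Measurable fun z : ℝ => expQuot θ (ε ^ 2) * z).indicator measurableSet_Ioc

/-- This explains the mesh ε² against the cut-off ε: rounding a jump z > ε to the lattice moves it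
by at most ε² ≤ z², and replacing θ by its difference quotient costs O(ε²) z. Both errors are O(z²)
for z ≤ 1, so the bound is ν-integrable uniformly in ε. -/
theorem abs_approxKernel_le {ε θ z : ℝ} (hε : 0 < ε) (hε1 : ε ≤ 1) (hθ : 0 ≤ θ) (hz : 0 < z) :
    |approxKernel ε θ z| ≤ (1 + θ ^ 2 + θ + θ ^ 2 * Real.exp θ) * min 1 (z ^ 2) := by
  have hmin : 0 ≤ min 1 (z ^ 2) := le_min zero_le_one (sq_nonneg z)
  have hexp := (Real.exp_pos θ).le
  unfold approxKernel
  by_cases hzε : ε < z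
  swap
  · rw [indicator_of_notMem (show z ∉ Ioi ε from hzε), abs_zero]; positivity
  rw [indicator_of_mem (mem_Ioi.2 hzε)]
  have hh : 0 < ε ^ 2 := by positivity
  have hh1 : ε ^ 2 ≤ 1 := by nlinarith
  obtain ⟨hN1, hN2⟩ := mul_floor_mem hh hz.le
  have hN0 : 0 ≤ ε ^ 2 * (⌊z / ε ^ 2⌋₊ : ℝ) := by positivity
  rw [exp_pow_floor]
  rcases le_or_gt z 1 with h | h
  · have hz2 : z ^ 2 ≤ 1 := by nlinarith
    have hεz : ε ^ 2 ≤ z ^ 2 := pow_le_pow_left₀ hε.le hzε.le 2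
    have hεz' : ε ^ 2 ≤ z := by nlinarith
    rw [indicator_of_mem (show z ∈ Ioc (0 : ℝ) 1 from ⟨hz, h⟩), min_eq_right hz2]
    have e1 := abs_exp_neg_sub_exp_neg_le (mul_nonneg hθ hN0) (mul_le_mul_of_nonneg_left hN1 hθ)
    have e2 := abs_exp_neg_sub_le (mul_nonneg hθ hz.le)
    have e3 := abs_expQuot_sub_le hθ hh hh1
    have e4 : θ * z - θ * (ε ^ 2 * ⌊z / ε ^ 2⌋₊) ≤ θ * z ^ 2 := by nlinarith
    have e5 : |(expQuot θ (ε ^ 2) - θ) * z| ≤ θ ^ 2 * Real.exp θ * z ^ 2 := by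
      rw [abs_mul, abs_of_pos hz]
      calc |expQuot θ (ε ^ 2) - θ| * z ≤ θ ^ 2 * Real.exp θ * ε ^ 2 * z := by gcongr
        _ ≤ θ ^ 2 * Real.exp θ * z * z := by gcongr
        _ = _ := by ring
    have e6 : Real.exp (-(θ * (ε ^ 2 * ⌊z / ε ^ 2⌋₊))) - 1 + expQuot θ (ε ^ 2) * z =
        (Real.exp (-(θ * (ε ^ 2 * ⌊z / ε ^ 2⌋₊))) - Real.exp (-(θ * z))) +
        (Real.exp (-(θ * z)) - 1 + θ * z) + (expQuot θ (ε ^ 2) - θ) * z := by ring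
    rw [e6]
    refine (abs_add_three _ _ _).trans ?_
    nlinarith [sq_nonneg z]
  · have hz2 : 1 ≤ z ^ 2 := by nlinarith
    rw [indicator_of_notMem (fun hh : z ∈ Ioc (0 : ℝ) 1 => h.not_ge hh.2), min_eq_left hz2, add_zero]
    have := abs_exp_neg_sub_one_le (mul_nonneg hθ hN0)
    have : 0 ≤ θ ^ 2 * Real.exp θ := by positivity
    nlinarith [sq_nonneg θ]

theorem tendsto_approxKernel {θ z : ℝ} (hz : 0 < z) :
    Tendsto (fun ε => approxKernel ε θ z) (𝓝[>] 0) (𝓝 (levyKernel θ z)) := by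
  have hsq : Tendsto (fun ε : ℝ => ε ^ 2) (𝓝[>] 0) (𝓝[>] 0) := by
    refine tendsto_nhdsWithin_iff.2 ⟨?_, ?_⟩
    · have : Tendsto (fun ε : ℝ => ε ^ 2) (𝓝 0) (𝓝 (0 ^ 2)) := (continuous_pow 2).tendsto 0
      rw [zero_pow two_ne_zero] at this
      exact this.mono_left nhdsWithin_le_nhds
    · filter_upwards [self_mem_nhdsWithin] with ε hε
      have : 0 < ε := hε
      exact mem_Ioi.2 (by positivity)
  have hsq0 : Tendsto (fun ε : ℝ => ε ^ 2) (𝓝[>] 0) (𝓝 0) := hsq.mono_right nhdsWithin_le_nhds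
  have h1 : Tendsto (fun ε : ℝ => ε ^ 2 * (⌊z / ε ^ 2⌋₊ : ℝ)) (𝓝[>] 0) (𝓝 z) := by
    refine tendsto_of_tendsto_of_tendsto_of_le_of_le' (g := fun ε => z - ε ^ 2) (h := fun _ => z)
      (by simpa using (tendsto_const_nhds (x := z)).sub hsq0) tendsto_const_nhds ?_ ?_
    all_goals
      filter_upwards [self_mem_nhdsWithin] with ε hε
      have hε : 0 < ε := hε
      have := mul_floor_mem (z := z) (pow_pos hε 2) hz.le
      linarith [this.1, this.2]
  have h2 : Tendsto (fun ε : ℝ => Real.exp (-θ * ε ^ 2) ^ ⌊z / ε ^ 2⌋₊) (𝓝[>] 0)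
      (𝓝 (Real.exp (-θ * z))) := by
    rw [neg_mul]
    refine Tendsto.congr (fun ε => exp_pow_floor.symm) ?_
    exact (Real.continuous_exp.tendsto _).comp (h1.const_mul θ).neg
  have h3 : Tendsto (fun ε : ℝ => (Ioc (0 : ℝ) 1).indicator (fun z => expQuot θ (ε ^ 2) * z) z)
      (𝓝[>] 0) (𝓝 ((Ioc (0 : ℝ) 1).indicator (fun z => θ * z) z)) := by
    by_cases h : z ∈ Ioc (0 : ℝ) 1
    · simp only [indicator_of_mem h]
      exact ((tendsto_expQuot θ).comp hsq).mul_const z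
    · simp only [indicator_of_notMem h]
      exact tendsto_const_nhds
  have h4 := (h2.sub_const 1).add h3
  refine h4.congr' ?_
  filter_upwards [nhdsWithin_le_nhds (eventually_lt_nhds hz)] with ε hε
  unfold approxKernel
  rw [indicator_of_mem (mem_Ioi.2 hε)]

/-- With h = ε², the Gaussian steps ±h at equal rates combine through e^{θh} - 1 + e^{-θh} - 1 =
e^{-θh} (e^{θh} - 1)², and the drift becomes a difference quotient. In this form the exponent can be
compared with ψ term by term. -/
theorem approxExponent_eq {ε θ : ℝ} (hε : 0 < ε) (hθ : 0 ≤ θ) :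
    T.approxExponent ε θ = T.γ * expQuot θ (ε ^ 2) +
      T.σ ^ 2 * (Real.exp (-θ * ε ^ 2) * expQuot θ (ε ^ 2) ^ 2) / 2 +
      ∫ z in Ioi (0 : ℝ), approxKernel ε θ z ∂T.ν := by
  have hh : 0 < ε ^ 2 := by positivity
  have hfin := T.tail_lt_top hε
  have : IsFiniteMeasure (T.ν.restrict (Ioi ε)) := ⟨by simpa using hfin⟩
  set s := Real.exp (-θ * ε ^ 2) with hs
  have hs0 : 0 < s := Real.exp_pos _
  have hs1 : s ≤ 1 := Real.exp_le_one_iff.2 (by nlinarith [mul_nonneg hθ hh.le])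
  have hm : Measurable fun z : ℝ => 1 - s ^ ⌊z / ε ^ 2⌋₊ := by fun_prop
  have hb : ∀ z : ℝ, ‖1 - s ^ ⌊z / ε ^ 2⌋₊‖ ≤ 1 := by
    intro z
    have h1 : s ^ ⌊z / ε ^ 2⌋₊ ≤ 1 := pow_le_one₀ hs0.le hs1
    have h2 : 0 < s ^ ⌊z / ε ^ 2⌋₊ := by positivity
    rw [Real.norm_eq_abs, abs_le]; constructor <;> linarith
  have hi1 : Integrable (fun z : ℝ => 1 - s ^ ⌊z / ε ^ 2⌋₊) (T.ν.restrict (Ioi ε)) :=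
    (integrable_const (1 : ℝ)).mono' hm.aestronglyMeasurable (Eventually.of_forall hb)
  have hi2 : Integrable (fun z : ℝ => 1 - s ^ ⌊z / ε ^ 2⌋₊)
      (ENNReal.ofReal (T.σ ^ 2 / (2 * (ε ^ 2) ^ 2)) • Measure.dirac (ε ^ 2)) :=
    Integrable.smul_measure
      ((integrable_const (1 : ℝ)).mono' hm.aestronglyMeasurable (Eventually.of_forall hb))
      ENNReal.ofReal_ne_top
  have hJ : ∫ z, (1 - s ^ ⌊z / ε ^ 2⌋₊) ∂(T.jumpMeasure ε) =
      ∫ z in Ioi ε, (1 - s ^ ⌊z / ε ^ 2⌋₊) ∂T.ν + T.σ ^ 2 / (2 * (ε ^ 2) ^ 2) * (1 - s) := by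
    unfold jumpMeasure
    rw [integral_add_measure hi1 hi2, integral_smul_measure, integral_dirac, div_self hh.ne',
      ENNReal.toReal_ofReal (by positivity)]
    simp
  have hK : ∫ z in Ioi (0 : ℝ), approxKernel ε θ z ∂T.ν =
      - ∫ z in Ioi ε, (1 - s ^ ⌊z / ε ^ 2⌋₊) ∂T.ν + expQuot θ (ε ^ 2) * ∫ z in Ioc ε 1, z ∂T.ν := by
    unfold approxKernel
    rw [setIntegral_indicator measurableSet_Ioi, inter_eq_right.2 (Ioi_subset_Ioi hε.le),
      ← integral_neg, ← integral_const_mul]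
    have hset : Ioi ε ∩ Ioc (0 : ℝ) 1 = Ioc ε 1 := by
      ext x; simp only [mem_inter_iff, mem_Ioi, mem_Ioc]
      exact ⟨fun h => ⟨h.1, h.2.2⟩, fun h => ⟨h.1, hε.trans h.1, h.2⟩⟩
    have hi3 : Integrable ((Ioc (0 : ℝ) 1).indicator fun z => expQuot θ (ε ^ 2) * z)
        (T.ν.restrict (Ioi ε)) := by
      have h : IntegrableOn (fun z : ℝ => expQuot θ (ε ^ 2) * z) (Ioc ε 1) T.ν :=
        (T.integrableOn_id_Ioc hε).const_mul _
      rw [← hset] at h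
      have h' : Integrable (fun z : ℝ => expQuot θ (ε ^ 2) * z)
        ((T.ν.restrict (Ioi ε)).restrict (Ioc 0 1)) := by
        rw [Measure.restrict_restrict measurableSet_Ioc, inter_comm]; exact h
      exact IntegrableOn.integrable_indicator h' measurableSet_Ioc
    rw [← hset, ← setIntegral_indicator measurableSet_Ioc,
      ← integral_add (f := fun z => -(1 - s ^ ⌊z / ε ^ 2⌋₊)) hi1.neg hi3]
    refine integral_congr_ae (Eventually.of_forall fun z => ?_)
    simp only [hs]; ring
  have hse : Real.exp (θ * ε ^ 2) = 1 / s := by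
    rw [hs, neg_mul, Real.exp_neg, one_div, inv_inv]
  unfold approxExponent skipFreeExponent
  rw [← hs, hJ, hK]
  unfold upRate truncDrift expQuot
  rw [hse]
  field_simp
  ring

theorem tendsto_approxExponent {θ : ℝ} (hθ : 0 ≤ θ) :
    Tendsto (fun ε => T.approxExponent ε θ) (𝓝[>] 0) (𝓝 (T.psi θ)) := by
  have hsq : Tendsto (fun ε : ℝ => ε ^ 2) (𝓝[>] 0) (𝓝[>] 0) := by
    refine tendsto_nhdsWithin_iff.2 ⟨?_, ?_⟩
    · have : Tendsto (fun ε : ℝ => ε ^ 2) (𝓝 0) (𝓝 (0 ^ 2)) := (continuous_pow 2).tendsto 0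
      rw [zero_pow two_ne_zero] at this
      exact this.mono_left nhdsWithin_le_nhds
    · filter_upwards [self_mem_nhdsWithin] with ε hε
      have : 0 < ε := hε
      exact mem_Ioi.2 (by positivity)
  have hsq0 : Tendsto (fun ε : ℝ => ε ^ 2) (𝓝[>] 0) (𝓝 0) := hsq.mono_right nhdsWithin_le_nhds
  have hI : Tendsto (fun ε => ∫ z in Ioi (0 : ℝ), approxKernel ε θ z ∂T.ν) (𝓝[>] 0)
      (𝓝 (∫ z in Ioi (0 : ℝ), levyKernel θ z ∂T.ν)) := by
    refine tendsto_integral_filter_of_dominated_convergence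
      (fun z => (1 + θ ^ 2 + θ + θ ^ 2 * Real.exp θ) * min 1 (z ^ 2)) ?_ ?_ ?_ ?_
    · exact Eventually.of_forall fun ε => (measurable_approxKernel ε θ).aestronglyMeasurable
    · filter_upwards [self_mem_nhdsWithin, nhdsWithin_le_nhds (eventually_le_nhds one_pos)]
        with ε hε hε1
      refine (ae_restrict_iff' measurableSet_Ioi).2 (Eventually.of_forall fun z hz => ?_)
      exact abs_approxKernel_le hε hε1 hθ hz
    · exact T.integrableOn_min_one_sq.const_mul _
    · refine (ae_restrict_iff' measurableSet_Ioi).2 (Eventually.of_forall fun z hz => ?_)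
      exact tendsto_approxKernel hz
  have hD := (tendsto_expQuot θ).comp hsq
  have hE : Tendsto (fun ε : ℝ => Real.exp (-θ * ε ^ 2)) (𝓝[>] 0) (𝓝 1) := by
    have := (Real.continuous_exp.tendsto _).comp (hsq0.const_mul (-θ))
    rwa [mul_zero, Real.exp_zero] at this
  have := ((hD.const_mul T.γ).add
    (((hE.mul (hD.pow 2)).const_mul (T.σ ^ 2)).div_const 2)).add hI
  rw [one_mul, ← psi_eq] at this
  refine this.congr' ?_
  filter_upwards [self_mem_nhdsWithin] with ε hε
  exact (T.approxExponent_eq hε hθ).symm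

/-- Approximate scale functions. -/
theorem exists_approx_scale (hT : T.NotNegSubordinator) {p : ℝ} (hp : 0 < p) :
    ∃ (f : ℕ → ℝ → ℝ) (h : ℕ → ℝ), Tendsto h atTop (𝓝 0) ∧ (∀ n x, 0 ≤ f n x) ∧
      (∀ n, Monotone (f n)) ∧
      (∀ n x y δ, 0 ≤ x → x ≤ y → 0 ≤ δ → f n x * f n (y + δ) ≤ f n (x + δ + h n) * f n y) ∧
      ∀ θ, T.Phi p < θ →
        (∀ᶠ n in atTop, IntegrableOn (fun x => Real.exp (-θ * x) * f n x) (Ioi 0)) ∧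
        Tendsto (fun n => ∫ x in Ioi (0 : ℝ), Real.exp (-θ * x) * f n x) atTop
          (𝓝 (1 / (T.psi θ - p))) := by
  obtain ⟨ε₀, hε₀, hε₁, hA⟩ := T.exists_upRate_pos hT
  set u : ℕ → ℝ := fun n => ε₀ * (1 / ((n : ℝ) + 1)) with hu
  have hu0 : ∀ n, 0 < u n := fun n => by positivity
  have hule : ∀ n, u n ≤ ε₀ := fun n => by
    have : 1 / ((n : ℝ) + 1) ≤ 1 := by
      rw [div_le_one (by positivity)]; linarith [n.cast_nonneg (α := ℝ)]
    exact mul_le_of_le_one_right hε₀.le this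
  have hut0 : Tendsto u atTop (𝓝 0) := by
    have := (tendsto_one_div_add_atTop_nhds_zero_nat (𝕜 := ℝ)).const_mul ε₀
    rwa [mul_zero] at this
  have hut : Tendsto u atTop (𝓝[>] 0) :=
    tendsto_nhdsWithin_iff.2 ⟨hut0, Eventually.of_forall fun n => hu0 n⟩
  have hh0 : Tendsto (fun n => u n ^ 2) atTop (𝓝 0) := by simpa using hut0.pow 2
  have hht : Tendsto (fun n => u n ^ 2) atTop (𝓝[>] 0) :=
    tendsto_nhdsWithin_iff.2 ⟨hh0, Eventually.of_forall fun n => pow_pos (hu0 n) 2⟩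
  have hex : ∀ n, ∃ f : ℝ → ℝ, (∀ x, 0 ≤ f x) ∧ Monotone f ∧
      (∀ x y δ, 0 ≤ x → x ≤ y → 0 ≤ δ → f x * f (y + δ) ≤ f (x + δ + u n ^ 2) * f y) ∧
      ∀ θ, 0 < θ → p < T.approxExponent (u n) θ →
        IntegrableOn (fun x => Real.exp (-θ * x) * f x) (Ioi 0) ∧
          ∫ x in Ioi (0 : ℝ), Real.exp (-θ * x) * f x =
            (Real.exp (θ * u n ^ 2) - 1) / (θ * u n ^ 2) / (T.approxExponent (u n) θ - p) := by
    intro n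
    have := T.isFiniteMeasure_jumpMeasure (hu0 n)
    exact exists_skipFree_scale (by fun_prop) (hA _ (hu0 n) (hule n)) hp (pow_pos (hu0 n) 2)
  choose f hf using hex
  refine ⟨f, fun n => u n ^ 2, hh0, fun n => (hf n).1, fun n => (hf n).2.1,
    fun n => (hf n).2.2.1, fun θ hθ => ?_⟩
  have hθ0 : 0 < θ := (Phi_pos hT hp).trans hθ
  have hψ := (T.tendsto_approxExponent hθ0.le).comp hut
  have hlt := lt_psi_of_Phi_lt hT hp hθ
  have hev := hψ.eventually_const_lt hlt
  constructor
  · filter_upwards [hev] with n hn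
    exact ((hf n).2.2.2 θ hθ0 hn).1
  · have h1 : Tendsto (fun n => expQuot θ (u n ^ 2) / θ / (T.approxExponent (u n) θ - p)) atTop
        (𝓝 (1 / (T.psi θ - p))) := by
      have := (((tendsto_expQuot θ).comp hht).div_const θ).div (hψ.sub_const p)
        (by linarith : T.psi θ - p ≠ 0)
      rwa [div_self hθ0.ne'] at this
    refine h1.congr' ?_
    filter_upwards [hev] with n hn
    rw [((hf n).2.2.2 θ hθ0 hn).2]
    unfold expQuot
    rw [div_div (Real.exp (θ * u n ^ 2) - 1), mul_comm (u n ^ 2)]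

end LevyTriplet

/-! ### Helly-type compactness under convergence of Laplace transforms -/

/-- A non-decreasing function is dominated by its Laplace transform. -/
theorem le_laplace_mul_exp {f : ℝ → ℝ} (hf0 : ∀ x, 0 ≤ f x) (hf : Monotone f) {θ : ℝ} (hθ : 0 < θ)
    (hi : IntegrableOn (fun x => Real.exp (-θ * x) * f x) (Ioi 0)) {x : ℝ} (hx : 0 ≤ x) :
    f x ≤ θ * (∫ y in Ioi (0 : ℝ), Real.exp (-θ * y) * f y) * Real.exp (θ * x) := by
  have hθ' : -θ < 0 := by linarith
  have h1 : ∫ y in Ioi x, Real.exp (-θ * y) * f x ≤ ∫ y in Ioi x, Real.exp (-θ * y) * f y := by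
    refine setIntegral_mono_on ((integrableOn_exp_mul_Ioi hθ' x).mul_const _)
      (hi.mono_set (Ioi_subset_Ioi hx)) measurableSet_Ioi fun y hy => ?_
    exact mul_le_mul_of_nonneg_left (hf (mem_Ioi.1 hy).le) (Real.exp_pos _).le
  have h2 : ∫ y in Ioi x, Real.exp (-θ * y) * f y ≤ ∫ y in Ioi 0, Real.exp (-θ * y) * f y :=
    setIntegral_mono_set hi (Eventually.of_forall fun y => mul_nonneg (Real.exp_pos _).le (hf0 y))
      (Ioi_subset_Ioi hx).eventuallyLE
  rw [integral_mul_const, integral_exp_mul_Ioi hθ'] at h1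
  have h3 := h1.trans h2
  set I := ∫ y in Ioi (0 : ℝ), Real.exp (-θ * y) * f y
  have h4 : -Real.exp (-θ * x) / -θ * f x = Real.exp (-θ * x) * f x / θ := by field_simp
  rw [h4, div_le_iff₀ hθ] at h3
  have h5 : Real.exp (θ * x) * Real.exp (-θ * x) = 1 := by rw [← Real.exp_add]; simp
  calc f x = Real.exp (θ * x) * (Real.exp (-θ * x) * f x) := by rw [← mul_assoc, h5, one_mul]
    _ ≤ Real.exp (θ * x) * (I * θ) := mul_le_mul_of_nonneg_left h3 (Real.exp_pos _).le
    _ = _ := by ring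

/-- A compactness theorem for non-decreasing approximately log-concave functions with converging
Laplace transforms. -/
theorem exists_limit_of_laplace {f : ℕ → ℝ → ℝ} {h : ℕ → ℝ} {Φ : ℝ} {L : ℝ → ℝ} (hΦ : 0 ≤ Φ)
    (hh : Tendsto h atTop (𝓝 0)) (hf0 : ∀ n x, 0 ≤ f n x) (hfm : ∀ n, Monotone (f n))
    (hr : ∀ n x y δ, 0 ≤ x → x ≤ y → 0 ≤ δ → f n x * f n (y + δ) ≤ f n (x + δ + h n) * f n y)
    (hL : ∀ θ, Φ < θ → (∀ᶠ n in atTop, IntegrableOn (fun x => Real.exp (-θ * x) * f n x) (Ioi 0)) ∧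
      Tendsto (fun n => ∫ x in Ioi (0 : ℝ), Real.exp (-θ * x) * f n x) atTop (𝓝 (L θ))) :
    ∃ W : ℝ → ℝ, (∀ x < 0, W x = 0) ∧ (∀ x, 0 ≤ W x) ∧ Monotone W ∧
      (∀ x, 0 ≤ x → ∀ ε > 0, ∃ y > x, W y < W x + ε) ∧
      (∀ x y δ, 0 ≤ x → x ≤ y → 0 ≤ δ → W x * W (y + δ) ≤ W (x + δ) * W y) ∧
      ∀ θ, Φ < θ → IntegrableOn (fun x => Real.exp (-θ * x) * W x) (Ioi 0) ∧
        ∫ x in Ioi (0 : ℝ), Real.exp (-θ * x) * W x = L θ := by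
  have hbound : ∀ θ, Φ < θ → ∃ C, ∀ᶠ n in atTop, ∀ x, f n x ≤ C * Real.exp (θ * max x 0) := by
    intro θ hθ
    have hθ0 : 0 < θ := hΦ.trans_lt hθ
    refine ⟨θ * (L θ + 1), ?_⟩
    filter_upwards [(hL θ hθ).1, (hL θ hθ).2.eventually_le_const (lt_add_one (L θ))] with n hn1 hn2 x
    have h1 := le_laplace_mul_exp (hf0 n) (hfm n) hθ0 hn1 (le_max_right x 0)
    refine (hfm n (le_max_left x 0)).trans (h1.trans ?_)
    gcongr
  obtain ⟨C₀, hC₀⟩ := hbound (Φ + 1) (by linarith)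
  obtain ⟨n₀, hn₀⟩ := eventually_atTop.1 hC₀
  -- The values at the rationals lie in a product of compact intervals over a countable index set,
  -- so a subsequence converges at every rational.
  set K : Set (ℚ → ℝ) := Set.pi univ fun r : ℚ =>
    Icc 0 (C₀ * Real.exp ((Φ + 1) * max (r : ℝ) 0)) with hK
  have hKc : IsCompact K := isCompact_univ_pi fun r => isCompact_Icc
  obtain ⟨V, -, φ, hφ, hV⟩ := hKc.tendsto_subseq (x := fun n (r : ℚ) => f (n + n₀) r)
    fun n r _ => ⟨hf0 _ _, hn₀ _ (Nat.le_add_left _ _) _⟩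
  have hV : ∀ r : ℚ, Tendsto (fun n => f (φ n + n₀) r) atTop (𝓝 (V r)) := fun r =>
    (tendsto_pi_nhds.1 hV) r
  have hsub : Tendsto (fun n => φ n + n₀) atTop atTop :=
    tendsto_atTop_mono (fun n => Nat.le_add_right _ _) hφ.tendsto_atTop
  have hV0 : ∀ r, 0 ≤ V r := fun r => ge_of_tendsto' (hV r) fun n => hf0 _ _
  have hVm : Monotone V := fun r s hrs => le_of_tendsto_of_tendsto' (hV r) (hV s) fun n =>
    hfm _ (by exact_mod_cast hrs)
  -- The infimum over rationals strictly to the right makes the limit right-continuous on [0, ∞); to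
  -- the left of 0 it is set to zero.
  set W : ℝ → ℝ := fun x => if x < 0 then 0 else sInf (V '' {r : ℚ | x < r}) with hW
  have hWeq : ∀ x, 0 ≤ x → W x = sInf (V '' {r : ℚ | x < r}) := fun x hx => by
    simp [hW, hx.not_gt]
  have hbdd : ∀ x : ℝ, BddBelow (V '' {r : ℚ | x < r}) := fun x =>
    ⟨0, by rintro _ ⟨r, -, rfl⟩; exact hV0 r⟩
  have hne : ∀ x : ℝ, (V '' {r : ℚ | x < r}).Nonempty := fun x => by
    obtain ⟨r, hr⟩ := exists_rat_gt x
    exact ⟨V r, r, hr, rfl⟩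
  have hWle : ∀ (x : ℝ) (r : ℚ), 0 ≤ x → x < r → W x ≤ V r := fun x r hx hxr => by
    rw [hWeq x hx]; exact csInf_le (hbdd x) ⟨r, hxr, rfl⟩
  have hWlt : ∀ x : ℝ, 0 ≤ x → ∀ ε > 0, ∃ r : ℚ, x < r ∧ V r < W x + ε := by
    intro x hx ε hε
    rw [hWeq x hx]
    obtain ⟨_, ⟨r, hxr, rfl⟩, hlt⟩ := exists_lt_of_csInf_lt (hne x)
      (lt_add_of_pos_right (sInf (V '' {r : ℚ | x < r})) hε)
    exact ⟨r, hxr, hlt⟩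
  have hWneg : ∀ x < 0, W x = 0 := fun x hx => by simp [hW, hx]
  have hW0 : ∀ x, 0 ≤ W x := by
    intro x
    rcases lt_or_ge x 0 with hx | hx
    · rw [hWneg x hx]
    · rw [hWeq x hx]
      exact le_csInf (hne x) (by rintro _ ⟨r, -, rfl⟩; exact hV0 r)
  have hWm : Monotone W := by
    intro x y hxy
    rcases lt_or_ge x 0 with hx | hx
    · rw [hWneg x hx]; exact hW0 y
    · refine le_of_forall_pos_le_add fun ε hε => ?_
      obtain ⟨r, hyr, hlt⟩ := hWlt y (hx.trans hxy) ε hε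
      exact (hWle x r hx (hxy.trans_lt hyr)).trans hlt.le
  -- The shift error h n is eventually below d' - d; this slack is removed later by
  -- right-continuity.
  have hVr : ∀ r s d d' : ℚ, 0 ≤ r → r ≤ s → 0 ≤ d → d < d' → V r * V (s + d) ≤ V (r + d') * V s := by
    intro r s d d' h0 hrs hd hdd
    refine le_of_tendsto_of_tendsto ((hV r).mul (hV (s + d))) ((hV (r + d')).mul (hV s)) ?_
    have hpos : (0 : ℝ) < d' - d := by
      have : (d : ℝ) < d' := by exact_mod_cast hdd
      linarith
    filter_upwards [(hh.comp hsub).eventually_le_const hpos] with n hn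
    have hn : h (φ n + n₀) ≤ d' - d := hn
    have h1 := hr (φ n + n₀) r s d (by exact_mod_cast h0) (by exact_mod_cast hrs)
      (by exact_mod_cast hd)
    simp only [Rat.cast_add]
    refine h1.trans (mul_le_mul_of_nonneg_right (hfm _ ?_) (hf0 _ _))
    linarith
  have hconv : ∀ x, 0 < x → ContinuousAt W x →
      Tendsto (fun n => f (φ n + n₀) x) atTop (𝓝 (W x)) := by
    intro x hx hc
    refine tendsto_order.2 ⟨fun a ha => ?_, fun a ha => ?_⟩
    · have h1 : ∀ᶠ y in 𝓝[<] x, a < W y :=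
        nhdsWithin_le_nhds (hc.eventually_const_lt ha)
      have h2 : ∀ᶠ y in 𝓝[<] x, 0 < y := nhdsWithin_le_nhds (eventually_gt_nhds hx)
      obtain ⟨y, hy1, hy2, hy3⟩ := (h1.and (h2.and self_mem_nhdsWithin)).exists
      obtain ⟨r, hyr, hrx⟩ := exists_rat_btwn (show y < x from hy3)
      filter_upwards [(hV r).eventually_const_lt (hy1.trans_le (hWle y r hy2.le hyr))] with n hn
      exact hn.trans_le (hfm _ hrx.le)
    · obtain ⟨r, hxr, hlt⟩ := hWlt x hx.le (a - W x) (by linarith)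
      filter_upwards [(hV r).eventually_lt_const (by linarith : V r < a)] with n hn
      exact (hfm _ hxr.le).trans_lt hn
  have hae : ∀ᵐ x ∂(volume.restrict (Ioi (0 : ℝ))),
      Tendsto (fun n => f (φ n + n₀) x) atTop (𝓝 (W x)) := by
    have hcount := hWm.countable_not_continuousAt
    have h1 : ∀ᵐ x ∂(volume : Measure ℝ), ContinuousAt W x := by
      rw [ae_iff]; exact hcount.measure_zero _
    filter_upwards [ae_restrict_mem measurableSet_Ioi, ae_restrict_of_ae h1] with x hx hc
    exact hconv x hx hc
  refine ⟨W, hWneg, hW0, hWm, ?_, ?_, ?_⟩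
  · intro x hx ε hε
    obtain ⟨r, hxr, hlt⟩ := hWlt x hx ε hε
    obtain ⟨y, hxy, hyr⟩ := exists_between hxr
    exact ⟨y, hxy, (hWle y r (hx.trans hxy.le) hyr).trans_lt hlt⟩
  · intro x y δ hx hxy hδ
    have key : ∀ ε > 0, W x * W (y + δ) ≤ (W (x + δ) + ε) * (W y + ε) := by
      intro ε hε
      obtain ⟨R, hR, hRlt⟩ := hWlt (x + δ) (by linarith) ε hε
      obtain ⟨s, hs, hslt⟩ := hWlt y (by linarith) ε hε
      -- With r just above x there is room for d > δ with r + d < R. Taking d' = R - r then makes r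
      -- + d' equal to R, while s + d > y + δ.
      obtain ⟨r, hxr, hrlt⟩ := exists_rat_btwn
        (show x < min (s : ℝ) (R - δ) from lt_min (by linarith) (by linarith))
      have hrs : (r : ℝ) < s := hrlt.trans_le (min_le_left _ _)
      have hrR : (r : ℝ) < R - δ := hrlt.trans_le (min_le_right _ _)
      obtain ⟨d, hd1, hd2⟩ := exists_rat_btwn (show δ < R - r by linarith)
      have h1 := hVr r s d (R - r) (by exact_mod_cast hx.trans hxr.le) (by exact_mod_cast hrs.le)
        (by exact_mod_cast hδ.trans hd1.le) (by exact_mod_cast hd2)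
      rw [add_sub_cancel] at h1
      have h2 := hWle x r hx hxr
      have h3 := hWle (y + δ) (s + d) (by linarith) (by push_cast; linarith)
      calc W x * W (y + δ) ≤ V r * V (s + d) := mul_le_mul h2 h3 (hW0 _) (hV0 _)
        _ ≤ V R * V s := h1
        _ ≤ _ := mul_le_mul hRlt.le hslt.le (hV0 _) (by linarith [hW0 (x + δ)])
    have ht : Tendsto (fun ε => (W (x + δ) + ε) * (W y + ε)) (𝓝[>] 0)
        (𝓝 ((W (x + δ) + 0) * (W y + 0))) :=
      ((by fun_prop : Continuous fun ε => (W (x + δ) + ε) * (W y + ε)).tendsto 0).mono_left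
        nhdsWithin_le_nhds
    rw [add_zero, add_zero] at ht
    exact ge_of_tendsto ht (by filter_upwards [self_mem_nhdsWithin] with ε hε using key ε hε)
  · intro θ hθ
    -- The exponent (Φ + θ) / 2 lies strictly between Φ and θ, so the bound it gives remains
    -- integrable against exp(-θx).
    obtain ⟨C, hC⟩ := hbound ((Φ + θ) / 2) (by linarith)
    have hC' := hsub.eventually hC
    have hlt : -((θ - Φ) / 2) < 0 := by linarith
    have hgi := (integrableOn_exp_mul_Ioi hlt 0).const_mul C
    have hdom : ∀ x, 0 < x → ∀ a, 0 ≤ a → a ≤ C * Real.exp ((Φ + θ) / 2 * max x 0) →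
        ‖Real.exp (-θ * x) * a‖ ≤ C * Real.exp (-((θ - Φ) / 2) * x) := by
      intro x hx a ha0 ha
      rw [max_eq_left hx.le] at ha
      rw [Real.norm_of_nonneg (mul_nonneg (Real.exp_pos _).le ha0)]
      calc Real.exp (-θ * x) * a ≤ Real.exp (-θ * x) * (C * Real.exp ((Φ + θ) / 2 * x)) :=
            mul_le_mul_of_nonneg_left ha (Real.exp_pos _).le
        _ = C * (Real.exp (-θ * x) * Real.exp ((Φ + θ) / 2 * x)) := by ring
        _ = _ := by rw [← Real.exp_add]; congr 2; ring
    have hWi : IntegrableOn (fun x => Real.exp (-θ * x) * W x) (Ioi 0) := by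
      refine Integrable.mono' hgi
        ((by fun_prop : Measurable fun x => Real.exp (-θ * x)).mul
          hWm.measurable).aestronglyMeasurable ?_
      filter_upwards [ae_restrict_mem measurableSet_Ioi, hae] with x hx hc
      refine hdom x hx _ (hW0 x) (le_of_tendsto hc ?_)
      filter_upwards [hC'] with n hn using hn x
    refine ⟨hWi, ?_⟩
    have ht : Tendsto (fun n => ∫ x in Ioi (0 : ℝ), Real.exp (-θ * x) * f (φ n + n₀) x) atTop
        (𝓝 (∫ x in Ioi (0 : ℝ), Real.exp (-θ * x) * W x)) := by
      refine tendsto_integral_filter_of_dominated_convergence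
        (fun x => C * Real.exp (-((θ - Φ) / 2) * x)) ?_ ?_ hgi ?_
      · exact Eventually.of_forall fun n => ((by fun_prop : Measurable fun x =>
          Real.exp (-θ * x)).mul (hfm _).measurable).aestronglyMeasurable
      · filter_upwards [hC'] with n hn
        filter_upwards [ae_restrict_mem measurableSet_Ioi] with x hx
        exact hdom x hx _ (hf0 _ _) (hn x)
      · filter_upwards [hae] with x hc using hc.const_mul _
    exact tendsto_nhds_unique ht ((hL θ hθ).2.comp hsub)

/-! ### Regularity and growth from log-concavity -/

namespace LevyTriplet

/-- A log-concave function with the Laplace transform of the `p`-scale function. -/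
structure IsLogConcaveScale (T : LevyTriplet) (p : ℝ) (W : ℝ → ℝ) : Prop where
  eq_zero : ∀ x < 0, W x = 0
  nonneg : ∀ x, 0 ≤ W x
  monotone : Monotone W
  right : ∀ x, 0 ≤ x → ∀ ε > 0, ∃ y > x, W y < W x + ε
  ratio : ∀ x y δ, 0 ≤ x → x ≤ y → 0 ≤ δ → W x * W (y + δ) ≤ W (x + δ) * W y
  integrableOn : ∀ θ > T.Phi p, IntegrableOn (fun x => Real.exp (-θ * x) * W x) (Ioi 0)
  laplace : ∀ θ > T.Phi p, ∫ x in Ioi (0 : ℝ), Real.exp (-θ * x) * W x = 1 / (T.psi θ - p)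

theorem exists_isLogConcaveScale {T : LevyTriplet} (hT : T.NotNegSubordinator) {p : ℝ}
    (hp : 0 < p) : ∃ W, T.IsLogConcaveScale p W := by
  obtain ⟨f, h, hh, hf0, hfm, hr, hL⟩ := T.exists_approx_scale hT hp
  obtain ⟨W, h1, h2, h3, h4, h5, h6⟩ := exists_limit_of_laplace (L := fun θ => 1 / (T.psi θ - p))
    (Phi_pos hT hp).le hh hf0 hfm hr hL
  exact ⟨W, h1, h2, h3, h4, h5, fun θ hθ => (h6 θ hθ).1, fun θ hθ => (h6 θ hθ).2⟩

namespace IsLogConcaveScale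

variable {T : LevyTriplet} {p : ℝ} {W : ℝ → ℝ}

/-- A zero at x forces W = 0 on [0, x] by monotonicity; the Laplace transform would then be
O(exp(-θx)), whereas it is at least of order θ⁻² by `psi_le_mul_sq`. -/
theorem pos (hW : T.IsLogConcaveScale p W) (hT : T.NotNegSubordinator) (hp : 0 < p) {x : ℝ}
    (hx : 0 < x) : 0 < W x := by
  refine (hW.nonneg x).lt_of_ne fun h0 => ?_
  set θ₁ := T.Phi p + 1 with hθ₁
  have hθ₁0 : 0 < θ₁ := by have := Phi_pos hT hp; linarith
  have hi₁ := hW.integrableOn θ₁ (by linarith)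
  set I := ∫ y in Ioi (0 : ℝ), Real.exp (-θ₁ * y) * W y
  obtain ⟨C, hC⟩ := T.psi_le_mul_sq
  have key : ∀ᶠ θ in atTop, 1 ≤ (Real.exp (θ₁ * x) * I * |C| / x ^ 2) *
      ((θ * x) ^ 2 * Real.exp (-(θ * x))) := by
    filter_upwards [eventually_gt_atTop θ₁, eventually_ge_atTop 1] with θ hθ hθ1
    have hθΦ : T.Phi p < θ := by linarith
    have hle : ∫ y in Ioi (0 : ℝ), Real.exp (-θ * y) * W y ≤
        ∫ y in Ioi (0 : ℝ), Real.exp (-(θ - θ₁) * x) * (Real.exp (-θ₁ * y) * W y) := by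
      refine setIntegral_mono_on (hW.integrableOn θ hθΦ) (hi₁.const_mul _) measurableSet_Ioi
        fun y hy => ?_
      rcases le_or_gt y x with hyx | hyx
      · have : W y = 0 := le_antisymm (by rw [h0]; exact hW.monotone hyx) (hW.nonneg y)
        simp [this]
      · rw [← mul_assoc, ← Real.exp_add]
        refine mul_le_mul_of_nonneg_right (Real.exp_le_exp.2 ?_) (hW.nonneg y)
        nlinarith
    rw [hW.laplace θ hθΦ, integral_const_mul] at hle
    have hψ := lt_psi_of_Phi_lt hT hp hθΦ
    rw [div_le_iff₀ (by linarith)] at hle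
    have hψ2 : T.psi θ - p ≤ |C| * θ ^ 2 :=
      (by linarith [hC θ hθ1] : T.psi θ - p ≤ C * θ ^ 2).trans
        (mul_le_mul_of_nonneg_right (le_abs_self C) (sq_nonneg θ))
    have hI0 : 0 ≤ I := integral_nonneg fun y => mul_nonneg (Real.exp_pos _).le (hW.nonneg y)
    have h3 : (1 : ℝ) ≤ Real.exp (-(θ - θ₁) * x) * I * (|C| * θ ^ 2) :=
      hle.trans (mul_le_mul_of_nonneg_left hψ2 (mul_nonneg (Real.exp_pos _).le hI0))
    have h4 : Real.exp (-(θ - θ₁) * x) = Real.exp (θ₁ * x) * Real.exp (-(θ * x)) := by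
      rw [← Real.exp_add]; congr 1; ring
    rw [h4] at h3
    refine h3.trans (le_of_eq ?_)
    field_simp
  have ht : Tendsto (fun θ : ℝ => (Real.exp (θ₁ * x) * I * |C| / x ^ 2) *
      ((θ * x) ^ 2 * Real.exp (-(θ * x)))) atTop (𝓝 0) := by
    have h1 : Tendsto (fun θ : ℝ => θ * x) atTop atTop := tendsto_id.atTop_mul_const hx
    have h2 := ((Real.tendsto_pow_mul_exp_neg_atTop_nhds_zero 2).comp h1).const_mul
      (Real.exp (θ₁ * x) * I * |C| / x ^ 2)
    rwa [mul_zero] at h2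
  have := ge_of_tendsto ht key
  linarith

/-- If W grew by less than exp(rδ) on one step of length δ, log-concavity would pass this on to all
later steps, giving W(z) = O(exp(rz)). Since r < Φ(p), the Laplace transform would stay bounded as θ
↓ Φ(p), but there 1/(ψ(θ) - p) → ∞. -/
theorem exp_mul_le (hW : T.IsLogConcaveScale p W) (hT : T.NotNegSubordinator) (hp : 0 < p)
    {r x δ : ℝ} (hr0 : 0 ≤ r) (hr : r < T.Phi p) (hx : 0 ≤ x) (hδ : 0 ≤ δ) :
    Real.exp (r * δ) * W x ≤ W (x + δ) := by
  by_contra hlt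
  rw [not_le] at hlt
  have hδ : 0 < δ := by
    refine hδ.lt_of_ne fun h => ?_
    rw [← h] at hlt
    simp at hlt
  have hWx : 0 < W x := by
    have h1 := (hW.nonneg (x + δ)).trans_lt hlt
    exact (pos_iff_pos_of_mul_pos h1).1 (Real.exp_pos _)
  have hstep : ∀ y, x ≤ y → W (y + δ) ≤ Real.exp (r * δ) * W y := by
    intro y hy
    have h1 := hW.ratio x y δ hx hy hδ.le
    have h2 := mul_le_mul_of_nonneg_right hlt.le (hW.nonneg y)
    refine le_of_mul_le_mul_left ?_ hWx
    linarith
  have hiter : ∀ n : ℕ, W (x + n * δ) ≤ Real.exp (r * (n * δ)) * W x := by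
    intro n
    induction n with
    | zero => simp
    | succ n ih =>
      have h1 := hstep (x + n * δ) (by have : 0 ≤ n * δ := by positivity
                                       linarith)
      have h2 : x + ((n + 1 : ℕ) : ℝ) * δ = x + n * δ + δ := by push_cast; ring
      have h3 : Real.exp (r * (((n + 1 : ℕ) : ℝ) * δ)) =
          Real.exp (r * δ) * Real.exp (r * (n * δ)) := by
        rw [← Real.exp_add]; congr 1; push_cast; ring
      rw [h2, h3, mul_assoc]
      exact h1.trans (mul_le_mul_of_nonneg_left ih (Real.exp_pos _).le)
  have hbd : ∀ z, 0 ≤ z → W z ≤ (Real.exp (r * δ) * W x) * Real.exp (r * z) := by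
    intro z hz
    have e : (Real.exp (r * δ) * W x) * Real.exp (r * z) = Real.exp (r * (z + δ)) * W x := by
      rw [mul_add, Real.exp_add]; ring
    rw [e]
    rcases le_or_gt z x with hzx | hzx
    · refine (hW.monotone hzx).trans (le_mul_of_one_le_left hWx.le ?_)
      exact Real.one_le_exp (by positivity)
    · set n := ⌊(z - x) / δ⌋₊ + 1
      have h1 : z ≤ x + n * δ := by
        have := (Nat.lt_floor_add_one ((z - x) / δ)).le
        rw [div_le_iff₀ hδ] at this
        simp only [n]; push_cast; linarith
      have h2 : n * δ ≤ z + δ := by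
        have := Nat.floor_le (div_nonneg (by linarith : 0 ≤ z - x) hδ.le)
        rw [le_div_iff₀ hδ] at this
        simp only [n]; push_cast; linarith
      refine (hW.monotone h1).trans ((hiter n).trans ?_)
      gcongr
  set C := Real.exp (r * δ) * W x with hCdef
  have hC : 0 < C := by positivity
  have hge : ∀ θ, T.Phi p < θ → (T.Phi p - r) / C ≤ T.psi θ - p := by
    intro θ hθ
    have hψ := lt_psi_of_Phi_lt hT hp hθ
    have hneg : -(θ - r) < 0 := by linarith
    have hle : ∫ y in Ioi (0 : ℝ), Real.exp (-θ * y) * W y ≤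
        ∫ y in Ioi (0 : ℝ), C * Real.exp (-(θ - r) * y) := by
      refine setIntegral_mono_on (hW.integrableOn θ hθ)
        ((integrableOn_exp_mul_Ioi hneg 0).const_mul _) measurableSet_Ioi fun y hy => ?_
      have h1 := mul_le_mul_of_nonneg_left (hbd y (le_of_lt hy)) (Real.exp_pos (-θ * y)).le
      refine h1.trans (le_of_eq ?_)
      rw [mul_left_comm, ← Real.exp_add]
      congr 2; ring
    rw [hW.laplace θ hθ, integral_const_mul, integral_exp_mul_Ioi hneg] at hle
    simp only [mul_zero, Real.exp_zero] at hle
    have e : C * (-1 / -(θ - r)) = C / (θ - r) := by rw [neg_div_neg_eq]; ring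
    rw [e, div_le_div_iff₀ (by linarith) (by linarith)] at hle
    rw [div_le_iff₀ hC]
    linarith
  have hcont : Tendsto (fun θ => T.psi θ - p) (𝓝[>] T.Phi p) (𝓝 (T.psi (T.Phi p) - p)) := by
    have h1 : ContinuousWithinAt T.psi (Ioi (T.Phi p)) (T.Phi p) :=
      (T.continuousOn_psi _ (Phi_pos hT hp).le).mono fun y (hy : T.Phi p < y) =>
        (Phi_pos hT hp).le.trans hy.le
    exact h1.tendsto.sub_const p
  have h1 := ge_of_tendsto hcont (by filter_upwards [self_mem_nhdsWithin] with θ hθ using hge θ hθ)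
  rw [psi_Phi hT hp, sub_self] at h1
  have : 0 < (T.Phi p - r) / C := div_pos (by linarith) hC
  linarith

/-- By log-concavity the ratio u = W(y + δ) / W(y) is at most the growth ratio on each of the N =
⌊x/δ⌋ earlier steps of length δ inside [x, 2x]. Hence u ^ N ≤ W(2x) / W(x), and Bernoulli's
inequality makes u - 1 at most linear in δ. -/
theorem sub_le_of_le (hW : T.IsLogConcaveScale p W) (hT : T.NotNegSubordinator) (hp : 0 < p)
    {x y δ : ℝ} (hx : 0 < x) (hy : 2 * x ≤ y) (hδ : 0 < δ) (hδx : δ ≤ x) :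
    W (y + δ) - W y ≤ W y * (2 * W (2 * x) / (x * W x)) * δ := by
  have hWy := hW.pos hT hp (show 0 < y by linarith)
  have hWx := hW.pos hT hp hx
  set u := W (y + δ) / W y with hu
  have hu1 : 1 ≤ u := by
    rw [hu, one_le_div hWy]; exact hW.monotone (by linarith)
  set N := ⌊x / δ⌋₊ with hN
  have hN1 : 1 ≤ N := Nat.le_floor (by rw [Nat.cast_one, one_le_div hδ]; exact hδx)
  have hNle : (N : ℝ) * δ ≤ x := by
    have := Nat.floor_le (div_nonneg hx.le hδ.le)
    rwa [le_div_iff₀ hδ] at this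
  -- From x ≤ (N + 1) δ and N ≥ 1.
  have hNge : x ≤ 2 * N * δ := by
    have h1 := (Nat.lt_floor_add_one (x / δ)).le
    rw [div_le_iff₀ hδ] at h1
    have h2 : (1 : ℝ) ≤ N := by exact_mod_cast hN1
    rw [← hN] at h1
    nlinarith
  have hiter : ∀ i : ℕ, i ≤ N → u ^ i * W x ≤ W (x + i * δ) := by
    intro i
    induction i with
    | zero => intro _; simp
    | succ i ih =>
      intro hi
      have h1 := ih (by omega)
      have h0 : 0 ≤ (i : ℝ) * δ := by positivity
      have h2 : (i : ℝ) * δ ≤ N * δ := by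
        have : (i : ℝ) ≤ N := by exact_mod_cast (by omega : i ≤ N)
        gcongr
      have h3 := hW.ratio (x + i * δ) y δ (by linarith) (by linarith) hδ.le
      have h4 : x + ((i + 1 : ℕ) : ℝ) * δ = x + i * δ + δ := by push_cast; ring
      rw [h4, pow_succ]
      calc u ^ i * u * W x = (u ^ i * W x) * u := by ring
        _ ≤ W (x + i * δ) * u := mul_le_mul_of_nonneg_right h1 (by linarith)
        _ = W (x + i * δ) * W (y + δ) / W y := by rw [hu]; ring
        _ ≤ _ := by rw [div_le_iff₀ hWy]; exact h3
  have h1 := hiter N le_rfl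
  have h2 : 1 + (N : ℝ) * (u - 1) ≤ u ^ N := by
    have := one_add_mul_le_pow (show (-2 : ℝ) ≤ u - 1 by linarith) N
    rwa [add_sub_cancel] at this
  have h3 : W (x + N * δ) ≤ W (2 * x) := hW.monotone (by linarith)
  have h4 : (1 + (N : ℝ) * (u - 1)) * W x ≤ W (2 * x) :=
    (mul_le_mul_of_nonneg_right h2 hWx.le).trans (h1.trans h3)
  have h5 : W (y + δ) - W y = W y * (u - 1) := by rw [hu]; field_simp
  rw [h5, mul_assoc]
  refine mul_le_mul_of_nonneg_left ?_ hWy.le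
  rw [div_mul_eq_mul_div, le_div_iff₀ (by positivity)]
  have h6 : x * (u - 1) ≤ 2 * N * δ * (u - 1) := mul_le_mul_of_nonneg_right hNge (by linarith)
  have h7 : x * (u - 1) * W x ≤ 2 * N * δ * (u - 1) * W x := mul_le_mul_of_nonneg_right h6 hWx.le
  nlinarith

/-- Increments over at most a / 2 are controlled by `sub_le_of_le`; over longer distances W ≤ W b
suffices, which accounts for the second term of the constant. -/
theorem exists_lipschitzOnWith (hW : T.IsLogConcaveScale p W) (hT : T.NotNegSubordinator)
    (hp : 0 < p) {a b : ℝ} (ha : 0 < a) : ∃ C, LipschitzOnWith C W (Icc a b) := by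
  set x := a / 2 with hx
  have hx0 : 0 < x := by positivity
  have hWx := hW.pos hT hp hx0
  set M := 2 * W (2 * x) / (x * W x) with hM
  have hM0 : 0 ≤ M := div_nonneg (mul_nonneg zero_le_two (hW.nonneg _)) (by positivity)
  have hWb := hW.nonneg b
  have hC0 : 0 ≤ W b * M + W b / x := by positivity
  refine ⟨⟨W b * M + W b / x, hC0⟩, LipschitzOnWith.of_le_add_mul _ fun z hz y hy => ?_⟩
  change W z ≤ W y + (W b * M + W b / x) * dist z y
  rcases le_or_gt z y with h | h
  · exact (hW.monotone h).trans (le_add_of_nonneg_right (mul_nonneg hC0 dist_nonneg))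
  · rw [Real.dist_eq, abs_of_pos (by linarith)]
    rcases le_or_gt (z - y) x with h' | h'
    · have h1 := hW.sub_le_of_le hT hp hx0 (y := y) (by linarith [hy.1]) (sub_pos.2 h) h'
      rw [add_sub_cancel] at h1
      have h2 : W y * M * (z - y) ≤ W b * M * (z - y) := by
        have := hW.monotone hy.2
        have : 0 ≤ z - y := by linarith
        gcongr
      have h3 : 0 ≤ W b / x * (z - y) := mul_nonneg (by positivity) (by linarith)
      rw [← hM] at h1
      linarith
    · have h1 : W z ≤ W b := hW.monotone hz.2
      have h2 : W b ≤ W b / x * (z - y) := by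
        rw [div_mul_eq_mul_div, le_div_iff₀ hx0]
        exact mul_le_mul_of_nonneg_left h'.le hWb
      have h3 : 0 ≤ W b * M * (z - y) := mul_nonneg (by positivity) (by linarith)
      linarith [hW.nonneg y]

theorem continuousOn (hW : T.IsLogConcaveScale p W) (hT : T.NotNegSubordinator)
    (hp : 0 < p) : ContinuousOn W (Ici 0) := by
  intro x hx
  rcases (mem_Ici.1 hx).eq_or_lt with rfl | h
  · refine tendsto_order.2 ⟨fun a ha => ?_, fun a ha => ?_⟩
    · filter_upwards [self_mem_nhdsWithin] with y hy using ha.trans_le (hW.monotone hy)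
    · obtain ⟨y, hy, hlt⟩ := hW.right 0 le_rfl (a - W 0) (by linarith)
      filter_upwards [nhdsWithin_le_nhds (eventually_lt_nhds hy)] with z hz
      have := hW.monotone hz.le
      linarith
  · obtain ⟨C, hC⟩ := hW.exists_lipschitzOnWith hT hp (b := x + 1) (half_pos h)
    exact (hC.continuousOn.continuousAt (Icc_mem_nhds (by linarith) (by linarith))).continuousWithinAt

theorem strictMonoOn (hW : T.IsLogConcaveScale p W) (hT : T.NotNegSubordinator)
    (hp : 0 < p) : StrictMonoOn W (Ioi 0) := by
  intro x hx y hy hxy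
  have hΦ := Phi_pos hT hp
  have h1 := hW.exp_mul_le hT hp (half_pos hΦ).le (half_lt_self hΦ) (le_of_lt hx) (sub_pos.2 hxy).le
  rw [add_sub_cancel] at h1
  refine lt_of_lt_of_le ?_ h1
  refine lt_mul_of_one_lt_left (hW.pos hT hp hx) (Real.one_lt_exp_iff.2 ?_)
  exact mul_pos (half_pos hΦ) (sub_pos.2 hxy)

theorem isScaleFunction (hW : T.IsLogConcaveScale p W) (hT : T.NotNegSubordinator)
    (hp : 0 < p) : T.IsScaleFunction p W :=
  ⟨hW.eq_zero, hW.continuousOn hT hp, hW.strictMonoOn hT hp, hW.integrableOn, hW.laplace⟩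

end IsLogConcaveScale

end LevyTriplet

/-! ### Uniqueness of Laplace transforms and identification of the scale function -/

/-- A continuous function on `[0, ∞)` whose Laplace transform vanishes is zero. -/
theorem eqOn_zero_of_laplace_eq_zero {D : ℝ → ℝ} {θ₀ : ℝ} (hD : ContinuousOn D (Ici 0))
    (hi : ∀ θ > θ₀, IntegrableOn (fun x => Real.exp (-θ * x) * D x) (Ioi 0))
    (h0 : ∀ θ > θ₀, ∫ x in Ioi (0 : ℝ), Real.exp (-θ * x) * D x = 0) :
    EqOn D 0 (Ici 0) := by
  set θ₁ := θ₀ + 1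
  have hi₁ := hi θ₁ (by simp [θ₁])
  -- In the variable t = exp(-x) ∈ (0, 1), the transforms at θ₁ + n are polynomial moments;
  -- Weierstrass approximation then extends their vanishing to continuous test functions.
  have hpoly : ∀ P : Polynomial ℝ,
      IntegrableOn (fun x => Real.exp (-θ₁ * x) * D x * P.eval (Real.exp (-x))) (Ioi 0) ∧
      ∫ x in Ioi (0 : ℝ), Real.exp (-θ₁ * x) * D x * P.eval (Real.exp (-x)) = 0 := by
    intro P
    induction P using Polynomial.induction_on' with
    | add P Q hP hQ =>
      simp only [Polynomial.eval_add, mul_add]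
      refine ⟨hP.1.add hQ.1, ?_⟩
      rw [integral_add hP.1 hQ.1, hP.2, hQ.2, add_zero]
    | monomial n c =>
      have hlt : θ₁ + n > θ₀ := by
        have : (0 : ℝ) ≤ n := n.cast_nonneg
        simp only [θ₁]; linarith
      have e : ∀ x, Real.exp (-θ₁ * x) * D x * (Polynomial.monomial n c).eval (Real.exp (-x)) =
          c * (Real.exp (-(θ₁ + n) * x) * D x) := by
        intro x
        rw [Polynomial.eval_monomial, ← Real.exp_nat_mul]
        have : Real.exp (-(θ₁ + n) * x) = Real.exp (-θ₁ * x) * Real.exp (n * -x) := by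
          rw [← Real.exp_add]; congr 1; ring
        rw [this]; ring
      simp only [e]
      refine ⟨(hi _ hlt).const_mul c, ?_⟩
      rw [integral_const_mul, h0 _ hlt, mul_zero]
  have hcont : ∀ G : ℝ → ℝ, Continuous G →
      ∫ x in Ioi (0 : ℝ), Real.exp (-θ₁ * x) * D x * G (Real.exp (-x)) = 0 := by
    intro G hG
    set I := ∫ x in Ioi (0 : ℝ), ‖Real.exp (-θ₁ * x) * D x‖ with hI
    have hbd : ∀ ε > 0, |∫ x in Ioi (0 : ℝ), Real.exp (-θ₁ * x) * D x * G (Real.exp (-x))| ≤ I * ε := by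
      intro ε hε
      obtain ⟨P, hP⟩ := exists_polynomial_near_of_continuousOn 0 1 G hG.continuousOn ε hε
      have hmem : ∀ x ∈ Ioi (0 : ℝ), Real.exp (-x) ∈ Icc (0 : ℝ) 1 := fun x hx =>
        ⟨(Real.exp_pos _).le, Real.exp_le_one_iff.2 (by linarith [mem_Ioi.1 hx])⟩
      have hPi := hpoly P
      have hdi : IntegrableOn (fun x => Real.exp (-θ₁ * x) * D x *
          (G (Real.exp (-x)) - P.eval (Real.exp (-x)))) (Ioi 0) := by
        refine Integrable.mono' (hi₁.norm.mul_const ε) ?_ ?_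
        · refine hi₁.aestronglyMeasurable.mul ?_
          exact (Continuous.aestronglyMeasurable (by fun_prop))
        · filter_upwards [ae_restrict_mem measurableSet_Ioi] with x hx
          rw [norm_mul]
          refine mul_le_mul_of_nonneg_left ?_ (norm_nonneg _)
          rw [norm_sub_rev]
          exact (hP _ (hmem x hx)).le
      have hsplit : ∫ x in Ioi (0 : ℝ), Real.exp (-θ₁ * x) * D x * G (Real.exp (-x)) =
          ∫ x in Ioi (0 : ℝ), Real.exp (-θ₁ * x) * D x *
            (G (Real.exp (-x)) - P.eval (Real.exp (-x))) := by
        have hadd := integral_add hdi hPi.1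
        rw [hPi.2, add_zero] at hadd
        rw [← hadd]
        refine integral_congr_ae (Eventually.of_forall fun x => ?_)
        simp only; ring
      rw [hsplit, ← Real.norm_eq_abs, hI, ← integral_mul_const]
      refine norm_integral_le_of_norm_le (hi₁.norm.mul_const ε) ?_
      filter_upwards [ae_restrict_mem measurableSet_Ioi] with x hx
      rw [norm_mul]
      refine mul_le_mul_of_nonneg_left ?_ (norm_nonneg _)
      rw [norm_sub_rev]
      exact (hP _ (hmem x hx)).le
    have ht : Tendsto (fun ε => I * ε) (𝓝[>] 0) (𝓝 (I * 0)) :=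
      ((by fun_prop : Continuous fun ε => I * ε).tendsto 0).mono_left nhdsWithin_le_nhds
    rw [mul_zero] at ht
    have := ge_of_tendsto ht (by filter_upwards [self_mem_nhdsWithin] with ε hε using hbd ε hε)
    exact abs_nonpos_iff.1 this
  -- The factor s is used with values 1 and -1, to exclude both signs of D x.
  have hpos : ∀ s x : ℝ, 0 < x → ¬ 0 < s * D x := by
    intro s x hx hsx
    have hDx : ContinuousAt D x := hD.continuousAt (Ici_mem_nhds hx)
    have hev : ∀ᶠ y in 𝓝 x, 0 < y ∧ 0 < s * D y :=
      (eventually_gt_nhds hx).and ((hDx.const_mul s).eventually_const_lt hsx)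
    have hev2 : ∀ᶠ t in 𝓝 (Real.exp (-x)), 0 < t ∧ 0 < s * D (-Real.log t) := by
      have h1 : ContinuousAt (fun t => -Real.log t) (Real.exp (-x)) :=
        (Real.continuousAt_log (Real.exp_pos _).ne').neg
      have h2 : -Real.log (Real.exp (-x)) = x := by rw [Real.log_exp, neg_neg]
      have h3 := h1.tendsto
      rw [h2] at h3
      filter_upwards [eventually_gt_nhds (Real.exp_pos (-x)), h3.eventually hev] with t ht ht2
      exact ⟨ht, ht2.2⟩
    obtain ⟨δ, hδ, hball⟩ := Metric.eventually_nhds_iff.1 hev2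
    -- A tent around exp(-x), supported where s * D is positive: the integrand has one sign, so a
    -- zero integral forces it to vanish.
    set G : ℝ → ℝ := fun t => max 0 (δ - |t - Real.exp (-x)|) with hG
    have hGc : Continuous G := by fun_prop
    have hint := hcont G hGc
    have hnn : ∀ y, 0 ≤ s * (Real.exp (-θ₁ * y) * D y * G (Real.exp (-y))) := by
      intro y
      by_cases hy : |Real.exp (-y) - Real.exp (-x)| < δ
      · have h1 := (hball (y := Real.exp (-y)) (by rwa [Real.dist_eq])).2
        rw [Real.log_exp, neg_neg] at h1
        have h2 : 0 ≤ G (Real.exp (-y)) := le_max_left _ _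
        have h3 : s * (Real.exp (-θ₁ * y) * D y * G (Real.exp (-y))) =
          Real.exp (-θ₁ * y) * (s * D y) * G (Real.exp (-y)) := by ring
        rw [h3]; positivity
      · have : G (Real.exp (-y)) = 0 := max_eq_left (by linarith)
        simp [this]
    have hIi : IntegrableOn (fun y => s * (Real.exp (-θ₁ * y) * D y * G (Real.exp (-y)))) (Ioi 0) := by
      refine Integrable.const_mul ?_ s
      refine Integrable.mul_bdd (c := δ) hi₁ (Continuous.aestronglyMeasurable (by fun_prop)) ?_
      refine Eventually.of_forall fun y => ?_
      rw [Real.norm_of_nonneg (le_max_left _ _)]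
      exact max_le hδ.le (by linarith [abs_nonneg (Real.exp (-y) - Real.exp (-x))])
    have hz : ∫ y in Ioi (0 : ℝ), s * (Real.exp (-θ₁ * y) * D y * G (Real.exp (-y))) = 0 := by
      rw [integral_const_mul, hint, mul_zero]
    rw [integral_eq_zero_iff_of_nonneg hnn hIi] at hz
    have hcon : ContinuousOn (fun y => s * (Real.exp (-θ₁ * y) * D y * G (Real.exp (-y)))) (Ioi 0) := by
      have := hD.mono (Ioi_subset_Ici_self : Ioi (0 : ℝ) ⊆ Ici 0)
      fun_prop
    have h4 := Measure.eqOn_open_of_ae_eq hz isOpen_Ioi hcon continuousOn_const hx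
    simp only [Pi.zero_apply] at h4
    have hGx : G (Real.exp (-x)) = δ := by simp [hG, hδ.le]
    rw [hGx] at h4
    have h5 : s * (Real.exp (-θ₁ * x) * D x * δ) = Real.exp (-θ₁ * x) * (s * D x) * δ := by ring
    rw [h5] at h4
    have : 0 < Real.exp (-θ₁ * x) * (s * D x) * δ := by positivity
    linarith
  have hI : EqOn D 0 (Ioi 0) := by
    intro x hx
    have h1 := hpos 1 x hx
    have h2 := hpos (-1) x hx
    simp only [Pi.zero_apply]
    linarith
  refine hI.of_subset_closure hD continuousOn_const Ioi_subset_Ici_self ?_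
  rw [closure_Ioi]

namespace LevyTriplet

theorem IsScaleFunction.unique {T : LevyTriplet} {p : ℝ} {W₁ W₂ : ℝ → ℝ}
    (h₁ : T.IsScaleFunction p W₁) (h₂ : T.IsScaleFunction p W₂) : W₁ = W₂ := by
  have h := eqOn_zero_of_laplace_eq_zero (D := fun x => W₁ x - W₂ x) (θ₀ := T.Phi p)
    (h₁.continuousOn.sub h₂.continuousOn) ?_ ?_
  · ext x
    rcases lt_or_ge x 0 with hx | hx
    · rw [h₁.eq_zero x hx, h₂.eq_zero x hx]
    · exact sub_eq_zero.1 (h hx)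
  · intro θ hθ
    simp only [mul_sub]
    exact (h₁.integrableOn θ hθ).sub (h₂.integrableOn θ hθ)
  · intro θ hθ
    simp only [mul_sub]
    rw [integral_sub (h₁.integrableOn θ hθ) (h₂.integrableOn θ hθ), h₁.laplace θ hθ,
      h₂.laplace θ hθ, sub_self]

/-- The lattice limit shows that a scale function exists, so `Classical.epsilon` yields one;
uniqueness carries log-concavity over to it. -/
theorem isLogConcaveScale_scaleFunction {T : LevyTriplet} (hT : T.NotNegSubordinator) {p : ℝ}
    (hp : 0 < p) : T.IsLogConcaveScale p (T.scaleFunction p) := by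
  obtain ⟨W, hW⟩ := exists_isLogConcaveScale hT hp
  have h1 := hW.isScaleFunction hT hp
  have h2 : T.IsScaleFunction p (T.scaleFunction p) := Classical.epsilon_spec ⟨W, h1⟩
  rwa [h2.unique h1]

end LevyTriplet

/-! ### Volterra convolution and existence of the omega-scale function -/

/-- Kernels of Volterra equations: non-decreasing functions that vanish on `(-∞, 0)` and are
continuous on `[0, ∞)`. -/
structure IsVolterraKernel (k : ℝ → ℝ) : Prop where
  eq_zero : ∀ x < 0, k x = 0
  monotone : Monotone k
  continuousOn : ContinuousOn k (Ici 0)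

/-- The convolution on `[a, x)`. -/
def volterra (k f : ℝ → ℝ) (a x : ℝ) : ℝ := ∫ y in Ico a x, k (x - y) * f y

/-- Boundedness on the intervals `[a, b]`. -/
def BddFrom (a : ℝ) (f : ℝ → ℝ) : Prop := ∀ b, ∃ C, ∀ y ∈ Icc a b, |f y| ≤ C

theorem Continuous.bddFrom {f : ℝ → ℝ} (hf : Continuous f) (a : ℝ) : BddFrom a f := fun b => by
  obtain ⟨C, hC⟩ := (isCompact_Icc (a := a) (b := b)).exists_bound_of_continuousOn hf.continuousOn
  exact ⟨C, fun y hy => hC y hy⟩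

theorem BddFrom.mul {a : ℝ} {f g : ℝ → ℝ} (hf : BddFrom a f) (hg : BddFrom a g) :
    BddFrom a fun y => f y * g y := fun b => by
  obtain ⟨C, hC⟩ := hf b
  obtain ⟨D, hD⟩ := hg b
  refine ⟨C * D, fun y hy => ?_⟩
  rw [abs_mul]
  exact mul_le_mul (hC y hy) (hD y hy) (abs_nonneg _) ((abs_nonneg _).trans (hC y hy))

theorem BddFrom.of_abs_le {a C : ℝ} {f : ℝ → ℝ} (h : ∀ y, |f y| ≤ C) : BddFrom a f := fun _ =>
  ⟨C, fun y _ => h y⟩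

theorem Monotone.bddFrom {f : ℝ → ℝ} (hf : Monotone f) (a : ℝ) : BddFrom a f := fun b =>
  ⟨|f a| + |f b|, fun y hy => by
    have h1 := hf hy.1
    have h2 := hf hy.2
    rw [abs_le]
    constructor
    · linarith [neg_abs_le (f a), abs_nonneg (f b)]
    · linarith [le_abs_self (f b), abs_nonneg (f a)]⟩

namespace IsVolterraKernel

variable {k : ℝ → ℝ} {f : ℝ → ℝ} {a : ℝ}

theorem nonneg (hk : IsVolterraKernel k) (x : ℝ) : 0 ≤ k x := by
  rcases lt_or_ge x 0 with hx | hx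
  · exact (hk.eq_zero x hx).ge
  · exact (hk.eq_zero (-1) (by norm_num)).symm.le.trans (hk.monotone (by linarith))

theorem bound (hk : IsVolterraKernel k) {x b y C : ℝ} (hxb : x ≤ b) (hay : a ≤ y) (hC : |f y| ≤ C) :
    ‖k (x - y) * f y‖ ≤ k (b - a) * C := by
  rw [norm_mul, Real.norm_of_nonneg (hk.nonneg _)]
  exact mul_le_mul (hk.monotone (by linarith)) hC (abs_nonneg _) (hk.nonneg _)

theorem measurable_integrand (hk : IsVolterraKernel k) (hf : Measurable f) (x : ℝ) :
    Measurable fun y => k (x - y) * f y :=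
  (hk.monotone.measurable.comp (by fun_prop)).mul hf

theorem integrableOn (hk : IsVolterraKernel k) (hf : Measurable f) (hfb : BddFrom a f) (x b : ℝ) :
    IntegrableOn (fun y => k (x - y) * f y) (Ico a b) := by
  obtain ⟨C, hC⟩ := hfb b
  refine Measure.integrableOn_of_bounded (M := k (x - a) * C) (by simp)
    (hk.measurable_integrand hf x).aestronglyMeasurable ?_
  filter_upwards [ae_restrict_mem measurableSet_Ico] with y hy
  exact hk.bound le_rfl hy.1 (hC y ⟨hy.1, hy.2.le⟩)

/-- The kernel vanishes at negative arguments, so the domain may be enlarged; only y = x, where k 0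
may be positive, has to be discarded as a null set. A domain independent of x is what dominated
convergence and Fubini require. -/
theorem volterra_eq_of_le (hk : IsVolterraKernel k) (f : ℝ → ℝ) (a : ℝ) {x b : ℝ} (hxb : x ≤ b) :
    volterra k f a x = ∫ y in Ico a b, k (x - y) * f y := by
  refine (setIntegral_eq_of_subset_of_ae_sdiff_eq_zero measurableSet_Ico.nullMeasurableSet
    (Ico_subset_Ico_right hxb) ?_).symm
  filter_upwards [Measure.ae_ne volume x] with y hyx hy
  have : x < y := lt_of_le_of_ne (not_lt.1 fun h => hy.2 ⟨hy.1.1, h⟩) (Ne.symm hyx)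
  rw [hk.eq_zero _ (by linarith), zero_mul]

theorem continuousAt_of_ne (hk : IsVolterraKernel k) {x : ℝ} (hx : x ≠ 0) : ContinuousAt k x := by
  rcases lt_or_gt_of_ne hx with h | h
  · refine continuousAt_const.congr (f := fun _ => (0 : ℝ)) ?_
    filter_upwards [eventually_lt_nhds h] with y hy using (hk.eq_zero y hy).symm
  · exact hk.continuousOn.continuousAt (Ici_mem_nhds h)

/-- A jump of k at 0 does no harm: it is met only at y = x, a null set. -/
theorem continuous_volterra (hk : IsVolterraKernel k) (hf : Measurable f) (hfb : BddFrom a f) :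
    Continuous (volterra k f a) := by
  refine continuous_iff_continuousAt.2 fun x => ?_
  have hev : ∀ᶠ z in 𝓝 x, z ≤ x + 1 := eventually_le_nhds (by linarith)
  have h1 : ContinuousAt (fun z => ∫ y in Ico a (x + 1), k (z - y) * f y) x := by
    obtain ⟨C, hC⟩ := hfb (x + 1)
    refine continuousAt_of_dominated (bound := fun _ => k (x + 1 - a) * C) ?_ ?_ ?_ ?_
    · exact Eventually.of_forall fun z => (hk.measurable_integrand hf z).aestronglyMeasurable
    · filter_upwards [hev] with z hz
      filter_upwards [ae_restrict_mem measurableSet_Ico] with y hy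
      exact hk.bound hz hy.1 (hC y ⟨hy.1, hy.2.le⟩)
    · exact integrableOn_const (by simp)
    · filter_upwards [ae_restrict_of_ae (Measure.ae_ne volume x)] with y hy
      have h2 : ContinuousAt k (x - y) := hk.continuousAt_of_ne (sub_ne_zero.2 (Ne.symm hy))
      exact (ContinuousAt.comp (f := fun z => z - y) h2 (by fun_prop)).mul continuousAt_const
  refine h1.congr ?_
  filter_upwards [hev] with z hz using (hk.volterra_eq_of_le f a hz).symm

theorem volterra_add (hk : IsVolterraKernel k) {g : ℝ → ℝ} (hf : Measurable f) (hfb : BddFrom a f)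
    (hg : Measurable g) (hgb : BddFrom a g) (x : ℝ) :
    volterra k (fun y => f y + g y) a x = volterra k f a x + volterra k g a x := by
  unfold volterra
  rw [← integral_add (hk.integrableOn hf hfb x x) (hk.integrableOn hg hgb x x)]
  simp only [mul_add]

theorem volterra_const_mul (k f : ℝ → ℝ) (a c x : ℝ) :
    volterra k (fun y => c * f y) a x = c * volterra k f a x := by
  unfold volterra
  rw [← integral_const_mul]
  simp only [mul_left_comm]

/-- Associativity of the convolution. -/
theorem volterra_volterra {l : ℝ → ℝ} (hk : IsVolterraKernel k) (hl : IsVolterraKernel l)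
    (hf : Measurable f) (hfb : BddFrom a f) (x : ℝ) :
    volterra k (volterra l f a) a x = volterra (volterra k l 0) f a x := by
  obtain ⟨C, hC⟩ := hfb x
  have h1 : volterra k (volterra l f a) a x =
      ∫ y in Ico a x, ∫ z in Ico a x, k (x - y) * (l (y - z) * f z) := by
    refine setIntegral_congr_fun measurableSet_Ico fun y hy => ?_
    rw [hl.volterra_eq_of_le f a hy.2.le, integral_const_mul]
  rw [h1, integral_integral_swap]
  · refine setIntegral_congr_fun measurableSet_Ico fun z hz => ?_
    have h2 : ∫ y in Ico a x, k (x - y) * (l (y - z) * f z) =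
        (∫ y in Ico a x, k (x - y) * l (y - z)) * f z := by
      rw [← integral_mul_const]; simp only [mul_assoc]
    rw [h2]
    congr 1
    have h3 : ∫ y in Ico a x, k (x - y) * l (y - z) = ∫ y in Ico z x, k (x - y) * l (y - z) := by
      refine setIntegral_eq_of_subset_of_forall_sdiff_eq_zero measurableSet_Ico
        (Ico_subset_Ico_left hz.1) fun y hy => ?_
      have : y < z := not_le.1 fun h => hy.2 ⟨h, hy.1.2⟩
      rw [hl.eq_zero _ (by linarith), mul_zero]
    have h4 := (measurePreserving_add_right volume z).setIntegral_preimage_emb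
      (measurableEmbedding_addRight z) (fun y => k (x - y) * l (y - z)) (Ico z x)
    rw [h3, ← h4]
    unfold volterra
    have h5 : (fun y => y + z) ⁻¹' Ico z x = Ico 0 (x - z) := by
      ext y; simp [lt_sub_iff_add_lt]
    rw [h5]
    refine setIntegral_congr_fun measurableSet_Ico fun y _ => ?_
    simp only [add_sub_cancel_right]
    rw [show x - (y + z) = x - z - y by ring]
  · have hm : Measurable (Function.uncurry fun y z => k (x - y) * (l (y - z) * f z)) :=
      (hk.monotone.measurable.comp (by fun_prop)).mul
        ((hl.monotone.measurable.comp (by fun_prop)).mul (hf.comp measurable_snd))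
    refine Integrable.mono' (integrable_const (k (x - a) * (l (x - a) * C)))
      hm.aestronglyMeasurable ?_
    rw [Measure.prod_restrict]
    filter_upwards [ae_restrict_mem (measurableSet_Ico.prod measurableSet_Ico)] with ⟨y, z⟩ hyz
    obtain ⟨hy, hz⟩ := hyz
    simp only at hy hz
    exact hk.bound (f := fun y => l (y - z) * f z) le_rfl hy.1
      (hl.bound hy.2.le hz.1 (hC z ⟨hz.1, hz.2.le⟩))

end IsVolterraKernel

namespace LevyTriplet

variable {T : LevyTriplet}

theorem IsLogConcaveScale.isVolterraKernel {p : ℝ} {W : ℝ → ℝ} (hW : T.IsLogConcaveScale p W)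
    (hT : T.NotNegSubordinator) (hp : 0 < p) : IsVolterraKernel W :=
  ⟨hW.eq_zero, hW.monotone, hW.continuousOn hT hp⟩

theorem isVolterraKernel_scaleFunction (hT : T.NotNegSubordinator) {p : ℝ} (hp : 0 < p) :
    IsVolterraKernel (T.scaleFunction p) :=
  (isLogConcaveScale_scaleFunction hT hp).isVolterraKernel hT hp

/-- Resolvent identity: on the Laplace side it is the partial fraction φ / ((ψ - q)(ψ - q - φ)) =
1/(ψ - q - φ) - 1/(ψ - q). -/
theorem volterra_scaleFunction_scaleFunction (hT : T.NotNegSubordinator) {q φ : ℝ} (hq : 0 < q)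
    (hφ : 0 < φ) {x : ℝ} (hx : 0 ≤ x) :
    φ * volterra (T.scaleFunction q) (T.scaleFunction (q + φ)) 0 x =
      T.scaleFunction (q + φ) x - T.scaleFunction q x := by
  have hp : 0 < q + φ := by linarith
  have hΦ := Phi_lt_Phi hT hq (by linarith : q < q + φ)
  set U := T.scaleFunction q
  set V := T.scaleFunction (q + φ)
  have hU : T.IsLogConcaveScale q U := isLogConcaveScale_scaleFunction hT hq
  have hV : T.IsLogConcaveScale (q + φ) V := isLogConcaveScale_scaleFunction hT hp
  have hUk := hU.isVolterraKernel hT hq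
  have hVk := hV.isVolterraKernel hT hp
  have hcont : Continuous (volterra U V 0) :=
    hUk.continuous_volterra hV.monotone.measurable (hV.monotone.bddFrom 0)
  have hlap : ∀ θ > T.Phi (q + φ),
      IntegrableOn (fun x => Real.exp (-θ * x) * volterra U V 0 x) (Ioi 0) ∧
      ∫ x in Ioi (0 : ℝ), Real.exp (-θ * x) * volterra U V 0 x =
        1 / (T.psi θ - (q + φ)) * (1 / (T.psi θ - q)) := by
    intro θ hθ
    have hi1 := hV.integrableOn θ hθ
    have hi2 := hU.integrableOn θ (hΦ.trans hθ)
    have e : ∀ x ∈ Ioi (0 : ℝ), Real.exp (-θ * x) * volterra U V 0 x =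
        ∫ t in (0 : ℝ)..x, ContinuousLinearMap.mul ℝ ℝ (Real.exp (-θ * t) * V t)
          (Real.exp (-θ * (x - t)) * U (x - t)) := by
      intro x hx
      rw [intervalIntegral.integral_of_le (le_of_lt hx), ← integral_Ico_eq_integral_Ioc]
      unfold volterra
      rw [← integral_const_mul]
      refine integral_congr_ae (Eventually.of_forall fun t => ?_)
      simp only [ContinuousLinearMap.mul_apply']
      have : Real.exp (-θ * x) = Real.exp (-θ * t) * Real.exp (-θ * (x - t)) := by
        rw [← Real.exp_add]; congr 1; ring
      rw [this]; ring
    constructor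
    · have h1 := (integrable_posConvolution hi1 hi2 (ContinuousLinearMap.mul ℝ ℝ)).integrableOn
        (s := Ioi (0 : ℝ))
      refine h1.congr_fun (fun x hx => ?_) measurableSet_Ioi
      rw [posConvolution, indicator_of_mem hx]
      exact (e x hx).symm
    · rw [setIntegral_congr_fun measurableSet_Ioi e,
        integral_posConvolution hi1 hi2 (ContinuousLinearMap.mul ℝ ℝ), hV.laplace θ hθ,
        hU.laplace θ (hΦ.trans hθ)]
      rfl
  have h := eqOn_zero_of_laplace_eq_zero (θ₀ := T.Phi (q + φ))
    (D := fun x => φ * volterra U V 0 x - (V x - U x))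
    ((hcont.const_mul φ).continuousOn.sub (hVk.continuousOn.sub hUk.continuousOn)) ?_ ?_ hx
  · exact sub_eq_zero.1 h
  · intro θ hθ
    simp only [mul_sub, mul_left_comm _ φ]
    exact ((hlap θ hθ).1.const_mul φ).sub
      ((hV.integrableOn θ hθ).sub (hU.integrableOn θ (hΦ.trans hθ)))
  · intro θ hθ
    simp only [mul_sub, mul_left_comm _ φ]
    have hd : IntegrableOn (fun x => Real.exp (-θ * x) * V x - Real.exp (-θ * x) * U x) (Ioi 0) :=
      (hV.integrableOn θ hθ).sub (hU.integrableOn θ (hΦ.trans hθ))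
    rw [integral_sub ((hlap θ hθ).1.const_mul φ) hd,
      integral_sub (hV.integrableOn θ hθ) (hU.integrableOn θ (hΦ.trans hθ)), integral_const_mul,
      (hlap θ hθ).2, hV.laplace θ hθ, hU.laplace θ (hΦ.trans hθ)]
    have h1 := lt_psi_of_Phi_lt hT hp hθ
    have h2 : T.psi θ - (q + φ) ≠ 0 := by linarith
    have h3 : T.psi θ - q ≠ 0 := by linarith
    field_simp
    ring

/-- The integral of the exponentially weighted scale function over the whole line. -/
theorem integrable_exp_mul_scaleFunction (hT : T.NotNegSubordinator) {p : ℝ} (hp : 0 < p) {θ : ℝ}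
    (hθ : T.Phi p < θ) :
    Integrable (fun x => Real.exp (-θ * x) * T.scaleFunction p x) ∧
      ∫ x, Real.exp (-θ * x) * T.scaleFunction p x = 1 / (T.psi θ - p) := by
  have hW := isLogConcaveScale_scaleFunction hT hp
  have hz : ∀ x, x ∉ Ici (0 : ℝ) → Real.exp (-θ * x) * T.scaleFunction p x = 0 := fun x hx => by
    rw [hW.eq_zero x (not_le.1 hx), mul_zero]
  constructor
  · have h1 : IntegrableOn (fun x => Real.exp (-θ * x) * T.scaleFunction p x) (Ici 0) :=
      (hW.integrableOn θ hθ).congr_set_ae Ioi_ae_eq_Ici.symm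
    exact (integrableOn_iff_integrable_of_support_subset fun x hx =>
      by_contra fun h => hx (hz x h)).1 h1
  · rw [← setIntegral_eq_integral_of_forall_compl_eq_zero hz, integral_Ici_eq_integral_Ioi,
      hW.laplace θ hθ]

end LevyTriplet

namespace IsVolterraKernel

variable {k m : ℝ → ℝ} {a l c : ℝ}

/-- In the sup norm weighted by exp(-lx) the Volterra operator has norm at most c ∫ exp(-lt) k(t)
dt, which supplies the contraction constant below. -/
theorem abs_exp_mul_volterra_le (hk : IsVolterraKernel k)
    (hi : Integrable fun x => Real.exp (-l * x) * k x) (hmc : ∀ y, |m y| ≤ c)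
    {u : ℝ → ℝ} {U : ℝ} (hU : ∀ y, |u y| ≤ U) (x : ℝ) :
    |Real.exp (-l * x) * volterra k (fun y => m y * (Real.exp (l * y) * u y)) a x| ≤
      c * (∫ x, Real.exp (-l * x) * k x) * U := by
  have hc : 0 ≤ c := (abs_nonneg _).trans (hmc 0)
  have hU0 : 0 ≤ U := (abs_nonneg _).trans (hU 0)
  have hi' : Integrable fun y => Real.exp (-l * (x - y)) * k (x - y) * (c * U) :=
    (hi.comp_sub_left x).mul_const _
  have h1 : ∫ y, Real.exp (-l * (x - y)) * k (x - y) * (c * U) =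
      c * (∫ x, Real.exp (-l * x) * k x) * U := by
    rw [integral_mul_const, integral_sub_left_eq_self (fun t => Real.exp (-l * t) * k t)]
    ring
  have hnn : ∀ y, 0 ≤ Real.exp (-l * (x - y)) * k (x - y) * (c * U) := fun y =>
    mul_nonneg (mul_nonneg (Real.exp_pos _).le (hk.nonneg _)) (mul_nonneg hc hU0)
  rw [← h1]
  refine le_trans ?_ (setIntegral_le_integral (s := Ico a x) hi' (Eventually.of_forall hnn))
  unfold volterra
  rw [← integral_const_mul, ← Real.norm_eq_abs]
  refine norm_integral_le_of_norm_le hi'.integrableOn (Eventually.of_forall fun y => ?_)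
  have h2 : Real.exp (-l * x) * (k (x - y) * (m y * (Real.exp (l * y) * u y))) =
      Real.exp (-l * (x - y)) * k (x - y) * (m y * u y) := by
    have : Real.exp (-l * (x - y)) = Real.exp (-l * x) * Real.exp (l * y) := by
      rw [← Real.exp_add]; congr 1; ring
    rw [this]; ring
  rw [h2, norm_mul, Real.norm_of_nonneg (mul_nonneg (Real.exp_pos _).le (hk.nonneg _))]
  refine mul_le_mul_of_nonneg_left ?_ (mul_nonneg (Real.exp_pos _).le (hk.nonneg _))
  rw [norm_mul]
  exact mul_le_mul (hmc y) (hU y) (abs_nonneg _) hc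

/-- Existence of a continuous solution of a linear Volterra equation. -/
theorem exists_solution (hk : IsVolterraKernel k)
    (hi : Integrable fun x => Real.exp (-l * x) * k x) (hm : Measurable m) (hmc : ∀ y, |m y| ≤ c)
    (hlt : c * (∫ x, Real.exp (-l * x) * k x) < 1) {g : ℝ → ℝ} (hg : Continuous g) {C : ℝ}
    (hgC : ∀ x, a ≤ x → |Real.exp (-l * x) * g x| ≤ C) :
    ∃ H : ℝ → ℝ, Continuous H ∧ ∀ x, H x = g x + volterra k (fun y => m y * H y) a x := by
  have hc : 0 ≤ c := (abs_nonneg _).trans (hmc 0)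
  set I := ∫ x, Real.exp (-l * x) * k x with hI
  have hI0 : 0 ≤ I := integral_nonneg fun x => mul_nonneg (Real.exp_pos _).le (hk.nonneg _)
  have hmb : BddFrom a m := BddFrom.of_abs_le hmc
  have hcont : ∀ u : ℝ → ℝ, Continuous u →
      Continuous (volterra k (fun y => m y * (Real.exp (l * y) * u y)) a) := by
    intro u hu
    have hu' : Continuous fun y => Real.exp (l * y) * u y := by fun_prop
    exact hk.continuous_volterra (hm.mul hu'.measurable) (hmb.mul (hu'.bddFrom a))
  -- The unknown is u(x) = exp(-lx) H(x). Evaluating at max x a keeps the image bounded on the whole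
  -- line; values to the left of a never enter the integral.
  let A : BoundedContinuousFunction ℝ ℝ → BoundedContinuousFunction ℝ ℝ := fun u =>
    BoundedContinuousFunction.ofNormedAddCommGroup
      (fun x => Real.exp (-l * max x a) * (g (max x a) +
        volterra k (fun y => m y * (Real.exp (l * y) * u y)) a (max x a)))
      (by
        have := hcont u u.continuous
        fun_prop)
      (C + c * I * ‖u‖) (fun x => by
        rw [mul_add, Real.norm_eq_abs]
        refine (abs_add_le _ _).trans (add_le_add (hgC _ (le_max_right x a)) ?_)
        exact hk.abs_exp_mul_volterra_le hi hmc (fun y => u.norm_coe_le_norm y) _)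
  have hA : ∀ u x, A u x = Real.exp (-l * max x a) * (g (max x a) +
        volterra k (fun y => m y * (Real.exp (l * y) * u y)) a (max x a)) := fun u x => rfl
  have hcontr : ContractingWith ⟨c * I, mul_nonneg hc hI0⟩ A := by
    refine ⟨by exact_mod_cast hlt, LipschitzWith.of_dist_le_mul fun u v => ?_⟩
    change dist (A u) (A v) ≤ c * I * dist u v
    rw [BoundedContinuousFunction.dist_le (mul_nonneg (mul_nonneg hc hI0) dist_nonneg)]
    intro x
    set z := max x a
    have h1 : A u x - A v x = Real.exp (-l * z) *
        volterra k (fun y => m y * (Real.exp (l * y) * (u y - v y))) a z := by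
      have hu' : Continuous fun y => Real.exp (l * y) * u y := by fun_prop
      have hv' : Continuous fun y => Real.exp (l * y) * (u y - v y) := by fun_prop
      have h2 := hk.volterra_add (f := fun y => m y * (Real.exp (l * y) * (u y - v y)))
        (g := fun y => m y * (Real.exp (l * y) * v y)) (hm.mul (hv'.measurable)) (hmb.mul (hv'.bddFrom a))
        (hm.mul ((by fun_prop : Continuous fun y => Real.exp (l * y) * v y).measurable))
        (hmb.mul ((by fun_prop : Continuous fun y => Real.exp (l * y) * v y).bddFrom a)) z
      have h3 : (fun y => m y * (Real.exp (l * y) * (u y - v y)) + m y * (Real.exp (l * y) * v y)) =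
        fun y => m y * (Real.exp (l * y) * u y) := by ext y; ring
      rw [h3] at h2
      rw [hA, hA, h2]
      ring
    rw [Real.dist_eq, h1]
    refine hk.abs_exp_mul_volterra_le hi hmc (fun y => ?_) z
    rw [← Real.dist_eq]
    exact BoundedContinuousFunction.dist_coe_le_dist y
  set u := ContractingWith.fixedPoint A hcontr
  have hu : A u = u := hcontr.fixedPoint_isFixedPt
  -- The solution is taken to be the right-hand side of the equation rather than exp(lx) u(x): the
  -- two agree on [a, ∞), but only the former is correct to the left of a.
  refine ⟨fun x => g x + volterra k (fun y => m y * (Real.exp (l * y) * u y)) a x,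
    hg.add (hcont u u.continuous), fun x => ?_⟩
  simp only
  congr 1
  refine setIntegral_congr_fun measurableSet_Ico fun y hy => ?_
  have h1 := hA u y
  rw [hu, max_eq_left hy.1] at h1
  have h2 : Real.exp (l * y) * u y =
      g y + volterra k (fun y => m y * (Real.exp (l * y) * u y)) a y := by
    have : Real.exp (l * y) * Real.exp (-l * y) = 1 := by rw [← Real.exp_add]; simp
    rw [h1, ← mul_assoc, this, one_mul]
  simp only
  rw [← h2]

end IsVolterraKernel

namespace LevyTriplet

variable {T : LevyTriplet}

theorem exists_isOmegaScaleFunction (hT : T.NotNegSubordinator) {p : ℝ} (hp : 0 < p) {w : ℝ → ℝ}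
    (hw : Measurable w) {c : ℝ} (hwc : ∀ y, |w y - p| ≤ c) (a : ℝ) :
    ∃ H, T.IsOmegaScaleFunction w a p H := by
  have hk := isVolterraKernel_scaleFunction hT hp
  have hc : 0 ≤ c := (abs_nonneg _).trans (hwc 0)
  -- The contraction constant is c / (ψ(l) - p), which is below 1 once ψ(l) > p + c.
  obtain ⟨l, hl1, hl2⟩ := ((tendsto_psi_atTop T hT).eventually_gt_atTop (p + c) |>.and
    (eventually_gt_atTop (T.Phi p))).exists
  obtain ⟨hi, hI⟩ := integrable_exp_mul_scaleFunction hT hp hl2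
  obtain ⟨H, hH, hHe⟩ := hk.exists_solution (a := a) hi (hw.sub_const p) hwc (by
      rw [hI, mul_one_div, div_lt_one (by linarith)]; linarith)
    (g := fun x => Real.exp (T.Phi p * (x - a))) (by fun_prop) (C := Real.exp (-l * a)) (by
      intro x hx
      rw [abs_of_pos (by positivity), ← Real.exp_add]
      refine Real.exp_le_exp.2 ?_
      nlinarith)
  refine ⟨H, hH, fun x => ?_⟩
  rw [hHe x]
  simp only [volterra, mul_assoc]

end LevyTriplet

/-! ### Representation, growth and smoothness of the omega-scale function -/

namespace LevyTriplet

variable {T : LevyTriplet}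

/-- The `ω`-scale function for the constant killing rate `q` on the whole line, in the form
`φ e^{Φ(q + φ) (x - a)} ∫_{x - a}^∞ e^{-Φ(q + φ) t} W_q(t) dt`. -/
def baseFun (T : LevyTriplet) (q φ a x : ℝ) : ℝ :=
  φ * Real.exp (T.Phi (q + φ) * (x - a)) *
    ∫ t in Ioi (x - a), Real.exp (-T.Phi (q + φ) * t) * T.scaleFunction q t

section

variable {q φ a : ℝ}

theorem integrableOn_exp_Phi_mul (hT : T.NotNegSubordinator) (hq : 0 < q) (hφ : 0 < φ) (c : ℝ) :
    IntegrableOn (fun t => Real.exp (-T.Phi (q + φ) * t) * T.scaleFunction q t) (Ioi c) :=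
  (integrable_exp_mul_scaleFunction hT hq (Phi_lt_Phi hT hq (by linarith))).1.integrableOn

theorem integral_exp_Phi_mul (hT : T.NotNegSubordinator) (hq : 0 < q) (hφ : 0 < φ) :
    ∫ t in Ioi 0, Real.exp (-T.Phi (q + φ) * t) * T.scaleFunction q t = 1 / φ := by
  rw [(isLogConcaveScale_scaleFunction hT hq).laplace _ (Phi_lt_Phi hT hq (by linarith)),
    psi_Phi hT (by linarith), add_sub_cancel_left]

theorem integral_Ioi_add {c d : ℝ} {f : ℝ → ℝ} (h : IntegrableOn f (Ioi c)) (hcd : c ≤ d) :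
    ∫ t in Ioi c, f t = (∫ t in c..d, f t) + ∫ t in Ioi d, f t := by
  rw [intervalIntegral.integral_of_le hcd, ← setIntegral_union (Ioc_disjoint_Ioi le_rfl)
    measurableSet_Ioi (h.mono_set Ioc_subset_Ioi_self) (h.mono_set (Ioi_subset_Ioi hcd)),
    Ioc_union_Ioi_eq_Ioi hcd]

/-- Since ψ(Φ(q + φ)) - q = φ, the full integral over (0, ∞), multiplied by φ, is 1; the tail is its
complement. This form arises from the Volterra equation, while the tail form shows positivity and
growth. -/
theorem baseFun_eq (hT : T.NotNegSubordinator) (hq : 0 < q) (hφ : 0 < φ) {x : ℝ} (hx : a ≤ x) :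
    T.baseFun q φ a x = Real.exp (T.Phi (q + φ) * (x - a)) *
      (1 - φ * ∫ t in (0 : ℝ)..(x - a), Real.exp (-T.Phi (q + φ) * t) * T.scaleFunction q t) := by
  have h := integral_Ioi_add (integrableOn_exp_Phi_mul hT hq hφ 0) (sub_nonneg.2 hx)
  rw [integral_exp_Phi_mul hT hq hφ] at h
  have h2 : 1 - φ * (∫ t in (0 : ℝ)..(x - a), Real.exp (-T.Phi (q + φ) * t) * T.scaleFunction q t) =
      φ * ∫ t in Ioi (x - a), Real.exp (-T.Phi (q + φ) * t) * T.scaleFunction q t := by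
    have : (1 : ℝ) = φ * (1 / φ) := by field_simp
    rw [this, h]; ring
  rw [h2, baseFun]
  ring

theorem volterra_scaleFunction_exp (T : LevyTriplet) (q r a : ℝ) {x : ℝ} (hx : a ≤ x) :
    volterra (T.scaleFunction q) (fun y => Real.exp (r * (y - a))) a x =
      Real.exp (r * (x - a)) * ∫ t in (0 : ℝ)..(x - a), Real.exp (-r * t) * T.scaleFunction q t := by
  have h := intervalIntegral.integral_comp_sub_left (a := a) (b := x)
    (fun t => Real.exp (-r * t) * T.scaleFunction q t) x
  rw [sub_self] at h
  rw [← h, intervalIntegral.integral_of_le hx, ← integral_Ico_eq_integral_Ioc, volterra,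
    ← integral_const_mul]
  refine integral_congr_ae (Eventually.of_forall fun y => ?_)
  have : Real.exp (r * (y - a)) = Real.exp (r * (x - a)) * Real.exp (-r * (x - y)) := by
    rw [← Real.exp_add]; congr 1; ring
  simp only [this]
  ring

theorem baseFun_pos (hT : T.NotNegSubordinator) (hq : 0 < q) (hφ : 0 < φ) {x : ℝ} (hx : a ≤ x) :
    0 < T.baseFun q φ a x := by
  have hW := isLogConcaveScale_scaleFunction hT hq
  refine mul_pos (by positivity) ?_
  rw [integral_pos_iff_support_of_nonneg_ae]
  · have hsub : Ioi (x - a) ⊆ Function.support fun t =>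
        Real.exp (-T.Phi (q + φ) * t) * T.scaleFunction q t := fun t ht => by
      have := hW.pos hT hq (lt_of_le_of_lt (sub_nonneg.2 hx) ht)
      exact (mul_pos (Real.exp_pos _) this).ne'
    rw [Measure.restrict_apply' measurableSet_Ioi, inter_eq_right.2 hsub]
    simp
  · exact Eventually.of_forall fun t => mul_nonneg (Real.exp_pos _).le (hW.nonneg t)
  · exact integrableOn_exp_Phi_mul hT hq hφ _

/-- Shifting the variable by δ places W_q(t + δ) under the integral over the same tail, where the
growth of W_q applies pointwise. -/
theorem exp_mul_baseFun_le (hT : T.NotNegSubordinator) (hq : 0 < q) (hφ : 0 < φ) {r x δ : ℝ}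
    (hr0 : 0 ≤ r) (hr : r < T.Phi q) (hx : a ≤ x) (hδ : 0 ≤ δ) :
    Real.exp (r * δ) * T.baseFun q φ a x ≤ T.baseFun q φ a (x + δ) := by
  have hW := isLogConcaveScale_scaleFunction hT hq
  set Φ := T.Phi (q + φ)
  have h4 := (measurePreserving_add_right volume δ).setIntegral_preimage_emb
      (measurableEmbedding_addRight δ) (fun t => Real.exp (-Φ * t) * T.scaleFunction q t)
      (Ioi (x + δ - a))
  have h4i := ((measurePreserving_add_right volume δ).integrableOn_comp_preimage
      (measurableEmbedding_addRight δ) (f := fun t => Real.exp (-Φ * t) * T.scaleFunction q t)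
      (s := Ioi (x + δ - a))).2 (integrableOn_exp_Phi_mul hT hq hφ _)
  have h5 : (fun t => t + δ) ⁻¹' Ioi (x + δ - a) = Ioi (x - a) := by
    ext t; simp only [mem_preimage, mem_Ioi]; constructor <;> intro h <;> linarith
  rw [h5] at h4 h4i
  have h6 : Real.exp (r * δ) * Real.exp (-Φ * δ) *
      (∫ t in Ioi (x - a), Real.exp (-Φ * t) * T.scaleFunction q t) ≤
      ∫ t in Ioi (x + δ - a), Real.exp (-Φ * t) * T.scaleFunction q t := by
    rw [← h4, ← integral_const_mul]
    refine setIntegral_mono_on ((integrableOn_exp_Phi_mul hT hq hφ _).const_mul _) h4i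
      measurableSet_Ioi fun t ht => ?_
    have h7 := hW.exp_mul_le hT hq hr0 hr (le_trans (sub_nonneg.2 hx) (le_of_lt ht)) hδ
    have h8 : Real.exp (-Φ * (t + δ)) = Real.exp (-Φ * δ) * Real.exp (-Φ * t) := by
      rw [← Real.exp_add]; congr 1; ring
    rw [h8]
    calc Real.exp (r * δ) * Real.exp (-Φ * δ) * (Real.exp (-Φ * t) * T.scaleFunction q t) =
        Real.exp (-Φ * δ) * Real.exp (-Φ * t) * (Real.exp (r * δ) * T.scaleFunction q t) := by ring
      _ ≤ _ := mul_le_mul_of_nonneg_left h7 (by positivity)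
  have h9 : Real.exp (Φ * (x + δ - a)) * Real.exp (-Φ * δ) = Real.exp (Φ * (x - a)) := by
    rw [← Real.exp_add]; congr 1; ring
  unfold baseFun
  calc Real.exp (r * δ) * (φ * Real.exp (Φ * (x - a)) *
        ∫ t in Ioi (x - a), Real.exp (-Φ * t) * T.scaleFunction q t)
      = φ * Real.exp (Φ * (x + δ - a)) * (Real.exp (r * δ) * Real.exp (-Φ * δ) *
        ∫ t in Ioi (x - a), Real.exp (-Φ * t) * T.scaleFunction q t) := by rw [← h9]; ring
    _ ≤ _ := mul_le_mul_of_nonneg_left h6 (by positivity)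

theorem differentiableAt_baseFun (hT : T.NotNegSubordinator) (hq : 0 < q) (hφ : 0 < φ) {x : ℝ}
    (hx : a < x) : DifferentiableAt ℝ (T.baseFun q φ a) x := by
  have hW := isLogConcaveScale_scaleFunction hT hq
  have hk := hW.isVolterraKernel hT hq
  set F : ℝ → ℝ := fun t => Real.exp (-T.Phi (q + φ) * t) * T.scaleFunction q t
  have hFm : Measurable F := (by fun_prop : Measurable fun t =>
    Real.exp (-T.Phi (q + φ) * t)).mul hW.monotone.measurable
  have h1 : HasDerivAt (fun u => ∫ t in (0 : ℝ)..u, F t) (F (x - a)) (x - a) := by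
    refine intervalIntegral.integral_hasDerivAt_right ?_ ?_ ?_
    · rw [intervalIntegrable_iff_integrableOn_Ioc_of_le (sub_nonneg.2 hx.le)]
      exact (integrableOn_exp_Phi_mul hT hq hφ 0).mono_set Ioc_subset_Ioi_self
    · exact hFm.stronglyMeasurable.stronglyMeasurableAtFilter
    · exact ContinuousAt.mul (by fun_prop) (hk.continuousAt_of_ne (sub_pos.2 hx).ne')
  have h2 : DifferentiableAt ℝ (fun x => ∫ t in (0 : ℝ)..(x - a), F t) x :=
    h1.differentiableAt.comp x (f := fun x => x - a) (by fun_prop)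
  have h3 : DifferentiableAt ℝ (fun x => Real.exp (T.Phi (q + φ) * (x - a)) *
      (1 - φ * ∫ t in (0 : ℝ)..(x - a), F t)) x := by fun_prop
  refine h3.congr_of_eventuallyEq ?_
  filter_upwards [eventually_gt_nhds hx] with y hy using baseFun_eq hT hq hφ hy.le

end

/-- The representation of the `ω`-scale function through the `q`-scale function. -/
theorem IsOmegaScaleFunction.eq_baseFun_add (hT : T.NotNegSubordinator) {q φ a : ℝ} (hq : 0 < q)
    (hφ : 0 < φ) {ω H : ℝ → ℝ} (hωm : Measurable ω) (hωb : BddFrom a ω)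
    (hH : T.IsOmegaScaleFunction (fun x => q + ω x) a (q + φ) H) {x : ℝ} (hx : a ≤ x) :
    H x = T.baseFun q φ a x + volterra (T.scaleFunction q) (fun y => ω y * H y) a x := by
  have hp : 0 < q + φ := by linarith
  have hU := isVolterraKernel_scaleFunction hT hq
  have hV := isVolterraKernel_scaleFunction hT hp
  set Φ := T.Phi (q + φ) with hΦ
  set E : ℝ → ℝ := fun y => Real.exp (Φ * (y - a)) with hE
  set f : ℝ → ℝ := fun y => ω y * H y + -φ * H y with hf
  have hEc : Continuous E := by fun_prop
  have hωH : Measurable fun y => ω y * H y := hωm.mul hH.continuous.measurable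
  have hωHb : BddFrom a fun y => ω y * H y := hωb.mul (hH.continuous.bddFrom a)
  have hφH : Continuous fun y => -φ * H y := hH.continuous.const_mul _
  have hfm : Measurable f := hωH.add hφH.measurable
  have hfb : BddFrom a f := by
    have h1 : BddFrom a fun y => (ω y - φ) * H y := by
      refine BddFrom.mul (fun b => ?_) (hH.continuous.bddFrom a)
      obtain ⟨C, hC⟩ := hωb b
      exact ⟨C + |φ|, fun y hy => (abs_sub _ _).trans (by linarith [hC y hy])⟩
    have h2 : f = fun y => (ω y - φ) * H y := by ext y; simp only [hf]; ring
    rwa [h2]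
  have hHe : ∀ z, H z = E z + volterra (T.scaleFunction (q + φ)) f a z := by
    intro z
    rw [hH.eq z]
    congr 1
    refine integral_congr_ae (Eventually.of_forall fun y => ?_)
    simp only [hf]; ring
  have hVf := hV.continuous_volterra hfm hfb
  -- Convolve the equation for H with W_q. Multiplied by φ, the resolvent identity replaces W_q ∗
  -- W_{q+φ} by W_{q+φ} - W_q, and the W_{q+φ} term cancels against the original equation.
  have h1 : volterra (T.scaleFunction q) H a x = volterra (T.scaleFunction q) E a x +
      volterra (volterra (T.scaleFunction q) (T.scaleFunction (q + φ)) 0) f a x := by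
    rw [← hU.volterra_volterra hV hfm hfb, ← hU.volterra_add hEc.measurable (hEc.bddFrom a)
      hVf.measurable (hVf.bddFrom a)]
    congr 1
    ext z; exact hHe z
  have h2 : φ * volterra (volterra (T.scaleFunction q) (T.scaleFunction (q + φ)) 0) f a x =
      volterra (T.scaleFunction (q + φ)) f a x - volterra (T.scaleFunction q) f a x := by
    unfold volterra
    rw [← integral_const_mul, ← integral_sub (hV.integrableOn hfm hfb x x)
      (hU.integrableOn hfm hfb x x)]
    refine setIntegral_congr_fun measurableSet_Ico fun y hy => ?_
    have := volterra_scaleFunction_scaleFunction hT hq hφ (sub_nonneg.2 hy.2.le)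
    unfold volterra at this
    rw [← sub_mul, ← this, mul_assoc]
  have h3 : volterra (T.scaleFunction q) f a x =
      volterra (T.scaleFunction q) (fun y => ω y * H y) a x +
        -φ * volterra (T.scaleFunction q) H a x := by
    rw [hf, hU.volterra_add hωH hωHb hφH.measurable (hφH.bddFrom a),
      IsVolterraKernel.volterra_const_mul]
  have h4 := hHe x
  have h5 := volterra_scaleFunction_exp T q Φ a hx
  rw [baseFun_eq hT hq hφ hx]
  have h6 : Real.exp (Φ * (x - a)) * (1 - φ * ∫ t in (0 : ℝ)..(x - a),
      Real.exp (-Φ * t) * T.scaleFunction q t) = E x - φ * volterra (T.scaleFunction q) E a x := by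
    rw [hE, h5]; ring
  rw [h6]
  have h7 := congrArg (fun t => φ * t) h1
  simp only [mul_add] at h7
  linarith

section Bankruptcy

variable {q φ a : ℝ} {ω H : ℝ → ℝ}

/-- At the first point beyond a where H ≤ 0, the integral involves only earlier positive values of H
and is non-negative, while `baseFun` is positive. -/
theorem IsOmegaScaleFunction.pos (hT : T.NotNegSubordinator) (hq : 0 < q)
    (hφ : 0 < φ) (hωm : Measurable ω) (hωb : BddFrom a ω) (hω0 : ∀ x, 0 ≤ ω x)
    (hH : T.IsOmegaScaleFunction (fun x => q + ω x) a (q + φ) H) (x : ℝ) : 0 < H x := by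
  have hU := isVolterraKernel_scaleFunction hT hq
  rcases le_or_gt x a with hx | hx
  · rw [hH.eq x, Ico_eq_empty (not_lt.2 hx)]
    simp only [Measure.restrict_empty, integral_zero_measure, add_zero]
    positivity
  by_contra hle
  set S := {y | a ≤ y ∧ H y ≤ 0} with hS
  have hSc : IsClosed S := isClosed_Ici.inter (isClosed_le hH.continuous continuous_const)
  have hSb : BddBelow S := ⟨a, fun y hy => hy.1⟩
  have hSm : sInf S ∈ S := hSc.csInf_mem ⟨x, hx.le, not_lt.1 hle⟩ hSb
  have h1 : ∀ y ∈ Ico a (sInf S), 0 ≤ T.scaleFunction q (sInf S - y) * (ω y * H y) := by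
    intro y hy
    have : 0 < H y := by
      by_contra h
      exact absurd (csInf_le hSb (show y ∈ S from ⟨hy.1, not_lt.1 h⟩)) (not_le.2 hy.2)
    exact mul_nonneg (hU.nonneg _) (mul_nonneg (hω0 y) this.le)
  have h2 := hH.eq_baseFun_add hT hq hφ hωm hωb hSm.1
  have h3 := baseFun_pos hT hq hφ hSm.1
  have h4 : 0 ≤ volterra (T.scaleFunction q) (fun y => ω y * H y) a (sInf S) :=
    setIntegral_nonneg measurableSet_Ico h1
  linarith [hSm.2]

/-- With y confined to [a, 0), the kernel is evaluated at x - y > x, away from its possible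
singularity at 0 when x > 0. -/
theorem IsOmegaScaleFunction.eq_baseFun_add_of_nonneg (hT : T.NotNegSubordinator) (hq : 0 < q)
    (hφ : 0 < φ) (ha : a ≤ 0) (hωm : Measurable ω) (hωb : BddFrom a ω) (hωz : ∀ x, 0 ≤ x → ω x = 0)
    (hH : T.IsOmegaScaleFunction (fun x => q + ω x) a (q + φ) H) {x : ℝ} (hx : 0 ≤ x) :
    H x = T.baseFun q φ a x + ∫ y in Ico a 0, T.scaleFunction q (x - y) * (ω y * H y) := by
  rw [hH.eq_baseFun_add hT hq hφ hωm hωb (ha.trans hx), volterra]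
  congr 1
  refine setIntegral_eq_of_subset_of_forall_sdiff_eq_zero measurableSet_Ico
    (Ico_subset_Ico_right hx) fun y hy => ?_
  have : 0 ≤ y := not_lt.1 fun h => hy.2 ⟨hy.1.1, h⟩
  rw [hωz y this, zero_mul, mul_zero]

theorem IsOmegaScaleFunction.exp_mul_le (hT : T.NotNegSubordinator) (hq : 0 < q)
    (hφ : 0 < φ) (ha : a ≤ 0) (hωm : Measurable ω) (hωb : BddFrom a ω) (hω0 : ∀ x, 0 ≤ ω x)
    (hωz : ∀ x, 0 ≤ x → ω x = 0) (hH : T.IsOmegaScaleFunction (fun x => q + ω x) a (q + φ) H)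
    {r x δ : ℝ} (hr0 : 0 ≤ r) (hr : r < T.Phi q) (hx : 0 ≤ x) (hδ : 0 ≤ δ) :
    Real.exp (r * δ) * H x ≤ H (x + δ) := by
  have hW := isLogConcaveScale_scaleFunction hT hq
  have hU := hW.isVolterraKernel hT hq
  have hωH : Measurable fun y => ω y * H y := hωm.mul hH.continuous.measurable
  have hωHb : BddFrom a fun y => ω y * H y := hωb.mul (hH.continuous.bddFrom a)
  rw [hH.eq_baseFun_add_of_nonneg hT hq hφ ha hωm hωb hωz hx,
    hH.eq_baseFun_add_of_nonneg hT hq hφ ha hωm hωb hωz (by linarith : 0 ≤ x + δ), mul_add,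
    ← integral_const_mul]
  refine add_le_add (exp_mul_baseFun_le hT hq hφ hr0 hr (ha.trans hx) hδ) ?_
  refine setIntegral_mono_on ((hU.integrableOn hωH hωHb x 0).const_mul _)
    (hU.integrableOn hωH hωHb (x + δ) 0) measurableSet_Ico fun y hy => ?_
  have h1 := hW.exp_mul_le hT hq hr0 hr (by linarith [hy.2] : 0 ≤ x - y) hδ
  rw [← mul_assoc, show x + δ - y = x - y + δ by ring]
  exact mul_le_mul_of_nonneg_right h1
    (mul_nonneg (hω0 y) (hH.pos hT hq hφ hωm hωb hω0 y).le)

/-- W_q need not be differentiable everywhere. Under the integral, differentiability at x - y for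
almost every y suffices, given a Lipschitz bound uniform for z near x and y in [a, 0). -/
theorem IsOmegaScaleFunction.differentiableAt (hT : T.NotNegSubordinator) (hq : 0 < q)
    (hφ : 0 < φ) (ha : a ≤ 0) (hωm : Measurable ω) (hωb : BddFrom a ω)
    (hωz : ∀ x, 0 ≤ x → ω x = 0) (hH : T.IsOmegaScaleFunction (fun x => q + ω x) a (q + φ) H)
    {x : ℝ} (hx : 0 < x) : DifferentiableAt ℝ H x := by
  have hW := isLogConcaveScale_scaleFunction hT hq
  have hU := hW.isVolterraKernel hT hq
  have hωH : Measurable fun y => ω y * H y := hωm.mul hH.continuous.measurable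
  have hωHb : BddFrom a fun y => ω y * H y := hωb.mul (hH.continuous.bddFrom a)
  set g : ℝ → ℝ := fun y => ω y * H y with hg
  obtain ⟨D, hD⟩ := hωHb 0
  obtain ⟨C, hC⟩ := hW.exists_lipschitzOnWith hT hq (b := x + 1 - a) (half_pos hx)
  have hint : DifferentiableAt ℝ (fun z => ∫ y in Ico a 0, T.scaleFunction q (z - y) * g y) x := by
    have h := hasDerivAt_integral_of_dominated_loc_of_lip (𝕜 := ℝ) (μ := volume.restrict (Ico a 0))
      (F := fun z y => T.scaleFunction q (z - y) * g y) (x₀ := x) (s := Ioo (x / 2) (x + 1))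
      (bound := fun _ => C * D) (F' := fun y => deriv (T.scaleFunction q) (x - y) * g y)
      (Ioo_mem_nhds (by linarith) (by linarith)) ?_ ?_ ?_ ?_ ?_ ?_
    · exact h.2.differentiableAt
    · exact Eventually.of_forall fun z => (hU.measurable_integrand hωH z).aestronglyMeasurable
    · exact hU.integrableOn hωH hωHb x 0
    · exact (((measurable_deriv _).comp (by fun_prop)).mul hωH).aestronglyMeasurable
    · filter_upwards [ae_restrict_mem measurableSet_Ico] with y hy
      have hgy := hD y ⟨hy.1, hy.2.le⟩
      have hD0 : 0 ≤ D := (abs_nonneg _).trans hgy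
      refine LipschitzOnWith.of_dist_le_mul fun z hz z' hz' => ?_
      have hm : ∀ u ∈ Ioo (x / 2) (x + 1), u - y ∈ Icc (x / 2) (x + 1 - a) := fun u hu =>
        ⟨by linarith [hu.1, hy.2], by linarith [hu.2, hy.1]⟩
      have h1 := hC.dist_le_mul _ (hm z hz) _ (hm z' hz')
      rw [dist_sub_right] at h1
      rw [Real.coe_nnabs, abs_of_nonneg (by positivity), Real.dist_eq, ← sub_mul, abs_mul,
        ← Real.dist_eq]
      calc _ ≤ C * dist z z' * D := mul_le_mul h1 hgy (abs_nonneg _) (by positivity)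
        _ = _ := by ring
    · exact integrable_const _
    · have h1 : ∀ᵐ y ∂(volume : Measure ℝ), DifferentiableAt ℝ (T.scaleFunction q) (x - y) :=
        (Measure.measurePreserving_sub_left volume x).quasiMeasurePreserving.ae
          hW.monotone.ae_differentiableAt
      filter_upwards [ae_restrict_of_ae h1] with y hy
      have h2 := hy.hasDerivAt.comp x (h := fun z => z - y) ((hasDerivAt_id x).sub_const y)
      rw [mul_one] at h2
      exact h2.mul_const (g y)
  refine ((differentiableAt_baseFun hT hq hφ (ha.trans_lt hx)).add hint).congr_of_eventuallyEq ?_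
  filter_upwards [eventually_gt_nhds hx] with z hz
  exact hH.eq_baseFun_add_of_nonneg hT hq hφ ha hωm hωb hωz hz.le

end Bankruptcy

end LevyTriplet

/-! ### Minimisation of the difference quotient -/

section Minimization

variable {H : ℝ → ℝ} {r β : ℝ}

/-- With t = c₂ - c₁, growth gives H(c₂) - H(c₁) ≥ (exp(rt) - 1) H(c₁) and H(c₁) ≥ (1 + r c₁) H(0).
The first bound blows up as t ↓ β. The second, which needs the quadratic term of exp(rt), grows
linearly in c₂. -/
theorem gFun_lower_bounds (hr : 0 < r) (hβ : 0 < β) (h0 : 0 < H 0)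
    (hH : ∀ x δ, 0 ≤ x → 0 ≤ δ → Real.exp (r * δ) * H x ≤ H (x + δ)) {c : ℝ × ℝ}
    (hc : c ∈ gDom β) :
    r * β * H 0 / (c.2 - c.1 - β) ≤ gFun H β c ∧ H 0 * r * (1 + r * c.2 / 2) ≤ gFun H β c := by
  obtain ⟨h1, h2⟩ := hc
  set t := c.2 - c.1 with ht
  have htβ : 0 < t - β := by linarith
  have hinc := hH c.1 t h1 (by linarith)
  have hc1 := hH 0 c.1 le_rfl h1
  rw [zero_add] at hc1
  rw [ht, add_sub_cancel, ← ht] at hinc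
  have e1 := Real.add_one_le_exp (r * c.1)
  have e2 := Real.quadratic_le_exp_of_nonneg (show 0 ≤ r * t by nlinarith)
  have hrc : 0 ≤ r * c.1 := by positivity
  have hrt : 0 ≤ r * t := by nlinarith
  have hHc : (1 + r * c.1) * H 0 ≤ H c.1 :=
    (mul_le_mul_of_nonneg_right (by linarith) h0.le).trans hc1
  have hdiff : (r * t + (r * t) ^ 2 / 2) * ((1 + r * c.1) * H 0) ≤ H c.2 - H c.1 := by
    calc (r * t + (r * t) ^ 2 / 2) * ((1 + r * c.1) * H 0)
        ≤ (r * t + (r * t) ^ 2 / 2) * H c.1 := mul_le_mul_of_nonneg_left hHc (by positivity)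
      _ ≤ (Real.exp (r * t) - 1) * H c.1 := by
          refine mul_le_mul_of_nonneg_right (by linarith) (le_trans (by positivity) hHc)
      _ ≤ _ := by linarith
  unfold gFun
  constructor
  · refine div_le_div_of_nonneg_right (le_trans ?_ hdiff) htβ.le
    have h3 : r * β ≤ (r * t + (r * t) ^ 2 / 2) * (1 + r * c.1) := by
      have : r * β ≤ r * t := by nlinarith
      nlinarith [mul_nonneg hrt hrc, sq_nonneg (r * t), mul_nonneg (sq_nonneg (r * t)) hrc]
    rw [← mul_assoc]
    exact mul_le_mul_of_nonneg_right h3 h0.le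
  · rw [← ht, le_div_iff₀ htβ]
    refine le_trans ?_ hdiff
    have h3 : r * (1 + r * c.2 / 2) * (t - β) ≤ (r * t + (r * t) ^ 2 / 2) * (1 + r * c.1) := by
      have hc2 : c.2 = c.1 + t := by rw [ht]; ring
      have h4 : r * (1 + r * c.2 / 2) * (t - β) ≤ r * (1 + r * c.2 / 2) * t :=
        mul_le_mul_of_nonneg_left (by linarith) (mul_nonneg hr.le (by rw [hc2]; nlinarith))
      refine h4.trans ?_
      rw [hc2]
      nlinarith [mul_nonneg hrt hrc, mul_nonneg (sq_nonneg (r * t)) hrc]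
    calc H 0 * r * (1 + r * c.2 / 2) * (t - β) = r * (1 + r * c.2 / 2) * (t - β) * H 0 := by ring
      _ ≤ (r * t + (r * t) ^ 2 / 2) * (1 + r * c.1) * H 0 := mul_le_mul_of_nonneg_right h3 h0.le
      _ = _ := by ring

theorem Cstar_nonempty (hr : 0 < r) (hβ : 0 < β) (hHc : Continuous H) (h0 : 0 < H 0)
    (hH : ∀ x δ, 0 ≤ x → 0 ≤ δ → Real.exp (r * δ) * H x ≤ H (x + δ)) : (Cstar H β).Nonempty := by
  have hb := fun c (hc : c ∈ gDom β) => gFun_lower_bounds hr hβ h0 hH hc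
  have hbase : ((0, β + 1) : ℝ × ℝ) ∈ gDom β := ⟨le_rfl, by simp⟩
  set G := gFun H β (0, β + 1) with hG
  have hG0 : 0 < G := by
    refine lt_of_lt_of_le ?_ (hb _ hbase).1
    have : (0 : ℝ) < β + 1 - 0 - β := by linarith
    positivity
  -- κ and M are read off from the two lower bounds: where g is at most the reference value G, the
  -- gap c₂ - c₁ - β is at least κ and c₂ is at most M.
  set κ := r * β * H 0 / G with hκ
  have hκ0 : 0 < κ := by positivity
  set M := 2 * G / (H 0 * r ^ 2) with hM
  set K : Set (ℝ × ℝ) := {c | c ∈ Icc 0 M ×ˢ Icc 0 M ∧ c.1 + β + κ ≤ c.2} with hK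
  have hKc : IsCompact K := by
    have hcl : IsClosed {c : ℝ × ℝ | c.1 + β + κ ≤ c.2} := isClosed_le (by fun_prop) (by fun_prop)
    exact (isCompact_Icc.prod isCompact_Icc).inter_right hcl
  have hmem : ∀ c ∈ gDom β, gFun H β c ≤ G → c ∈ K := by
    intro c hc hle
    obtain ⟨b1, b2⟩ := hb c hc
    have hc' := hc
    obtain ⟨h1, h2⟩ := hc'
    have d1 : κ ≤ c.2 - c.1 - β := by
      have h3 := b1.trans hle
      rw [div_le_iff₀ (by linarith)] at h3
      rw [hκ, div_le_iff₀ hG0]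
      linarith
    have d2 : c.2 ≤ M := by
      have h3 := b2.trans hle
      rw [hM, le_div_iff₀ (by positivity)]
      nlinarith [mul_pos h0 hr]
    exact ⟨⟨⟨h1, by linarith⟩, ⟨by linarith, d2⟩⟩, by linarith⟩
  have hKdom : ∀ c ∈ K, c ∈ gDom β := fun c hc => ⟨hc.1.1.1, by linarith [hc.2]⟩
  have hcont : ContinuousOn (gFun H β) K := by
    unfold gFun
    refine ContinuousOn.div (by fun_prop) (by fun_prop) fun c hc => ?_
    have := hc.2
    linarith
  obtain ⟨c, hcK, hmin⟩ := hKc.exists_isMinOn ⟨_, hmem _ hbase le_rfl⟩ hcont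
  refine ⟨c, hKdom c hcK, IsLeast.isGLB ⟨mem_image_of_mem _ (hKdom c hcK), ?_⟩⟩
  rintro _ ⟨d, hd, rfl⟩
  rcases le_or_gt (gFun H β d) G with h | h
  · exact hmin (hmem d hd h)
  · exact (hmin (hmem _ hbase le_rfl)).trans h.le

theorem gFun_le_of_mem_Cstar {c d : ℝ × ℝ} (hc : c ∈ Cstar H β) (hd : d ∈ gDom β) :
    gFun H β c ≤ gFun H β d := hc.2.1 (mem_image_of_mem _ hd)

/-- The constraint on c₂ is open, so c₂ is a local minimum with c₁ fixed; the numerator of the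
quotient rule vanishes exactly when H'(c₂) = g(c₁, c₂). -/
theorem hasDerivAt_snd_of_mem_Cstar (hβ : 0 < β) (hd : ∀ x, 0 < x → DifferentiableAt ℝ H x)
    {c₁ c₂ : ℝ} (hc : (c₁, c₂) ∈ Cstar H β) : HasDerivAt H (gFun H β (c₁, c₂)) c₂ := by
  obtain ⟨h1, h2⟩ : 0 ≤ c₁ ∧ β + c₁ < c₂ := hc.1
  have hH := (hd c₂ (by linarith)).hasDerivAt
  have hD : c₂ - c₁ - β ≠ 0 := by linarith
  have hg : HasDerivAt (fun u => gFun H β (c₁, u)) ((deriv H c₂ * (c₂ - c₁ - β) -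
      (H c₂ - H c₁) * 1) / (c₂ - c₁ - β) ^ 2) c₂ :=
    (hH.sub_const (H c₁)).fun_div (((hasDerivAt_id' c₂).sub_const c₁).sub_const β) hD
  have hmin : IsLocalMin (fun u => gFun H β (c₁, u)) c₂ := by
    filter_upwards [eventually_gt_nhds h2] with u hu
    exact gFun_le_of_mem_Cstar hc ⟨h1, hu⟩
  have h0 := hmin.hasDerivAt_eq_zero hg
  have h3 : deriv H c₂ = gFun H β (c₁, c₂) := by
    unfold gFun
    rw [eq_div_iff hD]
    rcases div_eq_zero_iff.1 h0 with h | h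
    · linarith
    · exact absurd (pow_eq_zero_iff two_ne_zero |>.1 h) hD
  rwa [h3] at hH

theorem hasDerivAt_fst_of_mem_Cstar (hd : ∀ x, 0 < x → DifferentiableAt ℝ H x)
    {c₁ c₂ : ℝ} (hc : (c₁, c₂) ∈ Cstar H β) (hpos : 0 < c₁) :
    HasDerivAt H (gFun H β (c₁, c₂)) c₁ := by
  obtain ⟨h1, h2⟩ : 0 ≤ c₁ ∧ β + c₁ < c₂ := hc.1
  have hH := (hd c₁ hpos).hasDerivAt
  have hD : c₂ - c₁ - β ≠ 0 := by linarith
  have hg : HasDerivAt (fun u => gFun H β (u, c₂)) ((-deriv H c₁ * (c₂ - c₁ - β) -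
      (H c₂ - H c₁) * (-1)) / (c₂ - c₁ - β) ^ 2) c₁ :=
    (hH.const_sub (H c₂)).fun_div (((hasDerivAt_id' c₁).const_sub c₂).sub_const β) hD
  have hmin : IsLocalMin (fun u => gFun H β (u, c₂)) c₁ := by
    filter_upwards [eventually_gt_nhds hpos, eventually_lt_nhds (by linarith : c₁ < c₂ - β)]
      with u hu hu2
    exact gFun_le_of_mem_Cstar hc ⟨hu.le, by simp only; linarith⟩
  have h0 := hmin.hasDerivAt_eq_zero hg
  have h3 : deriv H c₁ = gFun H β (c₁, c₂) := by
    unfold gFun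
    rw [eq_div_iff hD]
    rcases div_eq_zero_iff.1 h0 with h | h
    · linarith
    · exact absurd (pow_eq_zero_iff two_ne_zero |>.1 h) hD
  rwa [h3] at hH

end Minimization

theorem IsDiscountingIntensity.le_left {ω : ℝ → ℝ} {a φ ρ : ℝ}
    (hω : IsDiscountingIntensity ω a φ ρ) (x : ℝ) : ω x ≤ φ := by
  rw [← hω.eq_left (min x (a - 1)) ((min_le_right _ _).trans_lt (by linarith))]
  exact hω.antitone (min_le_left _ _)

end

theorem mainTheorem4 (T : LevyTriplet) (hT : T.NotNegSubordinator)
    (hac : T.BoundedVariation → T.ν ≪ volume) (htail : T.LogConvexTail)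
    (q β : ℝ) (hq : 0 < q) (hβ : 0 < β)
    (ω : ℝ → ℝ) (a φ : ℝ) (hω : IsBankruptcyRate ω a φ)
    (H : ℝ → ℝ) (hH : H = T.omegaScaleFunction (fun x => q + ω x) a (q + φ)) :
    (Cstar H β).Nonempty ∧
      ∀ c₁ c₂ : ℝ, (c₁, c₂) ∈ Cstar H β →
        HasDerivAt H (gFun H β (c₁, c₂)) c₂ ∧
          ((∃ d : ℝ, HasDerivAt H d c₁ ∧ HasDerivAt H d c₂) ∨ c₁ = 0) := by
  have hφ := hω.φ_pos
  have hωm : Measurable ω := hω.antitone.measurable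
  have hωle := hω.le_left
  have hωb : BddFrom a ω := BddFrom.of_abs_le (C := φ) fun y => by
    rw [abs_of_nonneg (hω.nonneg y)]; exact hωle y
  have hΦ := T.Phi_pos hT hq
  have hspec : T.IsOmegaScaleFunction (fun x => q + ω x) a (q + φ) H := by
    rw [hH]
    refine Classical.epsilon_spec (LevyTriplet.exists_isOmegaScaleFunction hT (by linarith)
      (hωm.const_add q) (c := φ) (fun y => ?_) a)
    rw [abs_le]
    constructor <;> linarith [hω.nonneg y, hωle y]
  have hpos := hspec.pos hT hq hφ hωm hωb hω.nonneg
  -- Any rate in (0, Φ(q)) would do; half of Φ(q) is a convenient one.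
  have hgrowth : ∀ x δ, 0 ≤ x → 0 ≤ δ → Real.exp (T.Phi q / 2 * δ) * H x ≤ H (x + δ) :=
    fun x δ hx hδ => hspec.exp_mul_le hT hq hφ hω.a_nonpos hωm hωb hω.nonneg hω.eq_right
      (half_pos hΦ).le (half_lt_self hΦ) hx hδ
  have hdiff : ∀ x, 0 < x → DifferentiableAt ℝ H x := fun x hx =>
    hspec.differentiableAt hT hq hφ hω.a_nonpos hωm hωb hω.eq_right hx
  refine ⟨Cstar_nonempty (half_pos hΦ) hβ hspec.continuous (hpos 0) hgrowth, fun c₁ c₂ hc => ?_⟩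
  have h2 := hasDerivAt_snd_of_mem_Cstar hβ hdiff hc
  refine ⟨h2, ?_⟩
  rcases (show 0 ≤ c₁ from hc.1.1).eq_or_lt with h | h
  · exact Or.inr h.symm
  · exact Or.inl ⟨_, hasDerivAt_fst_of_mem_Cstar hdiff hc h, h2⟩
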